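/- Let $F$ be a field of characteristic $0$, let $t,q\in F$ with $q\neq 0$. **Ribbon categories and traces.** Let $\mathcal C$ be an $F$-linear ribbon category with braiding $c_{V,W}:V\otimes W\to W\otimes V$, twist $\theta_V:V\to V$, and duality $\operatorname{coev}_V:\mathbb 1\to V\otimes V^*$, $\operatorname{ev}_V:V^*\otimes V\to\mathbb 1$. Put $\operatorname{coev}'_V=(\mathrm{Id}_{V^*}\otimes\theta_V)\circ c_{V,V^*}\circ\operatorname{coev}_V$ and $\operatorname{ev}'_V=\operatorname{ev}_V\circ c_{V,V^*}\circ(\theta_V\otimes\mathrm{Id}_{V^*})$. For $f\in\operatorname{End}(V\otimes W)$ let $$\operatorname{tr}_L(f)=(\operatorname{ev}_V\otimes\mathrm{Id}_W)(\mathrm{Id}_{V^*}\otimes f)(\operatorname{coev}'_V\otimes\mathrm{Id}_W)\in\operatorname{End}(W),\qquad \operatorname{tr}_R(f)=(\mathrm{Id}_V\otimes\operatorname{ev}'_W)(f\otimes\mathrm{Id}_{W^*})(\mathrm{Id}_V\otimes\operatorname{coev}_W)\in\operatorname{End}(V).$$ An *ambidextrous trace* on an object $J$ is an $F$-linear map $\mathsf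 t_J:\operatorname{End}(J)\to F$ with $\mathsf t_J(\operatorname{tr}_L(h))=\mathsf t_J(\operatorname{tr}_R(h))$ for all $h\in\operatorname{End}(J\otimes J)$. **Deligne's category.** Let $FP_{a,b}$ be the $F$-vector space with basis the partition diagrams with $a$ top and $b$ bottom vertices, i.e. the set partitions of $\{1,\dots,a,1',\dots,b'\}$. Let $\mathrm{Rep}_0(S_t)$ be the category with objects $[n]$, $n\in\mathbb Z_{\ge0}$, and $\operatorname{Hom}([a],[b])=FP_{a,b}$; composition is the bilinear extension of vertical concatenation of diagrams, each block consisting of middle vertices only being replaced by a factor $t$. It is a ribbon category: $[a]\otimes[b]=[a+b]$ and, on morphisms, $\otimes$ is horizontal concatenation; $\mathbb 1=[0]$, with identities as associativity and unit constraints; the braiding $\beta_{a,b}:[a]\otimes[b]\to[b]\otimes[a]$ is the diagram of the block transposition; $[n]^*=[n]$, with evaluation and coevaluation the diagrams in $FP_{2n,0}$ and $FP_{0,2n}$ with blocks $\{i,n+i\}$, respectively $\{i',(n+i)'\}$, $1\le i\le n$; the twist is the identity. Let $\mathrm{Rep}(S_t)$ be the Karoubian envelope of the additive envelope of $\mathrm{Rep}_0(S_t)$,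 with the induced $F$-linear ribbon structure. **The graded variation.** Let $\mathrm{gRep}_0(S_t)_q$ be the category with objects the pairs $[a,b]$, $a,b\in\mathbb Z_{\ge0}$, with $\operatorname{Hom}([a,b],[c,d])=FP_{a+b,c+d}$ if $a-b=c-d$ and $0$ otherwise, and with composition as in $\mathrm{Rep}_0(S_t)$. It is a ribbon category: $[a,b]\otimes[c,d]=[a+c,b+d]$, with horizontal concatenation on morphisms, unit $[0,0]$, and identities as associativity and unit constraints; $[a,b]^*=[b,a]$, with evaluation and coevaluation given by the diagrams of $\mathrm{Rep}_0(S_t)$ for $[a+b]$; the braiding is $c_{[a,b],[c,d]}=q^{(a-b)(c-d)}\beta_{a+b,c+d}$; the twist is $\theta_{[a,b]}=q^{(a-b)^2}\mathrm{Id}$. Let $\mathrm{gRep}(S_t)_q$ be the Karoubian envelope of the additive envelope of $\mathrm{gRep}_0(S_t)_q$, with the induced $F$-linear ribbon structure. Let $\mathcal F:\mathrm{gRep}(S_t)_q\to\mathrm{Rep}(S_t)$ be the degrading functor, i.e. the functor induced on envelopes by $[a,b]\mapsto[a+b]$, $f\mapsto f$. **Theorem.** Let $V$ be an object of $\mathrm{gRep}(S_t)_q$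 and let $\mathsf t_{\mathcal F(V)}:\operatorname{End}_{\mathrm{Rep}(S_t)}(\mathcal F(V))\to F$ be an ambidextrous trace on $\mathcal F(V)$. Then the map $$\operatorname{End}_{\mathrm{gRep}(S_t)_q}(V)\to F,\qquad g\mapsto \mathsf t_{\mathcal F(V)}(\mathcal F(g)),$$ is an ambidextrous trace on $V$. -/

import Mathlib

set_option linter.unusedSectionVars false

open CategoryTheory MonoidalCategory

namespace PartitionDiagram

/-- A partition diagram with `a` top vertices and `b` bottom vertices: a set partition
(i.e. an equivalence relation) of the vertex set `{1, …, a, 1', …, b'}`. -/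
abbrev Diag (a b : ℕ) : Type := Setoid (Fin a ⊕ Fin b)

/-- The diagram whose blocks are the nonempty fibres of a labelling of the vertices. -/
abbrev ofLabel {a b : ℕ} {X : Type} (u : Fin a → X) (v : Fin b → X) : Diag a b :=
  Setoid.ker (Sum.elim u v)

/-- The diagram in which the top vertex `i` is joined with the bottom vertex `e i`. -/
abbrev perm {a b : ℕ} (e : Fin a ≃ Fin b) : Diag a b := ofLabel e id

/-- Two diagrams stacked on top of each other, as a partition of top, middle and bottom
vertices: the partition generated by the blocks of `π` and the blocks of `μ`. -/
def glue {a b c : ℕ} (π : Diag a b) (μ : Diag b c) : Setoid (Fin a ⊕ Fin b ⊕ Fin c) :=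
  Setoid.map π (Sum.map id Sum.inl) ⊔ Setoid.map μ Sum.inr

/-- The inclusion of the outer (top and bottom) vertices of a stack. -/
def outer {a b c : ℕ} : Fin a ⊕ Fin c → Fin a ⊕ Fin b ⊕ Fin c := Sum.map id Sum.inr

/-- Vertical concatenation: the stack restricted to the outer vertices. -/
abbrev stack {a b c : ℕ} (π : Diag a b) (μ : Diag b c) : Diag a c :=
  Setoid.comap outer (glue π μ)

/-- The number of blocks of the stack consisting only of middle vertices. -/
noncomputable def loops {a b c : ℕ} (π : Diag a b) (μ : Diag b c) : ℕ :=
  Nat.card {B : Quotient (glue π μ) //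
    ∀ x : Fin a ⊕ Fin c, (Quotient.mk (glue π μ) (outer x)) ≠ B}

/-- Horizontal concatenation of diagrams. -/
abbrev juxt {a b c d : ℕ} (π : Diag a b) (μ : Diag c d) : Diag (a + c) (b + d) :=
  Setoid.map π (Sum.map (Fin.castAdd c) (Fin.castAdd d)) ⊔
    Setoid.map μ (Sum.map (Fin.natAdd a) (Fin.natAdd b))

/-- The map sending the vertices `i` and `n + i` to `i`. -/
def fold (n : ℕ) : Fin (n + n) → Fin n := Fin.addCases id id

@[simp]
theorem fold_castAdd (n : ℕ) (i : Fin n) : fold n (Fin.castAdd n i) = i := Fin.addCases_left i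

@[simp]
theorem fold_natAdd (n : ℕ) (i : Fin n) : fold n (Fin.natAdd n i) = i := Fin.addCases_right i

/-- The diagram in `P_{2n,0}` joining the vertices `i` and `n + i`. -/
abbrev cap (n : ℕ) : Diag (n + n) 0 := ofLabel (fold n) Fin.elim0

/-- The diagram in `P_{0,2n}` joining the vertices `i'` and `(n + i)'`. -/
abbrev cup (n : ℕ) : Diag 0 (n + n) := ofLabel Fin.elim0 (fold n)

/-! ### Two-colourings of diagrams

A diagram is determined by its block-constant colourings with two colours, and concatenation
turns into multiplication of `0`-`1`-matrices, up to a power of two counting the loops. -/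

/-- The colouring `(x, y)` of the vertices is constant on the blocks of `π`. -/
def Col {a b : ℕ} (π : Diag a b) (x : Fin a → Bool) (y : Fin b → Bool) : Prop :=
  π ≤ Setoid.ker (Sum.elim x y)

theorem map_le_iff {A B : Type} (r : Setoid A) (f : A → B) (s : Setoid B) :
    Setoid.map r f ≤ s ↔ r ≤ Setoid.comap f s := by
  constructor
  · intro h x y hxy
    exact h (Setoid.le_comap_map (r := r) (f := f) hxy)
  · intro h
    refine Setoid.eqvGen_le ?_
    rintro _ _ ⟨x, y, hxy, rfl, rfl⟩
    exact h hxy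

theorem comap_ker {A B C : Type} (f : A → B) (g : B → C) :
    Setoid.comap f (Setoid.ker g) = Setoid.ker (g ∘ f) := rfl

theorem col_ext {a b : ℕ} {π μ : Diag a b} (h : ∀ x y, Col π x y ↔ Col μ x y) : π = μ := by
  have key : ∀ {π μ : Diag a b}, (∀ x y, Col μ x y → Col π x y) → π ≤ μ := by
    intro π μ h u v huv
    classical
    have := h (fun i => decide (μ u (Sum.inl i))) (fun i => decide (μ u (Sum.inr i))) (by
      intro p r hpr
      have hs : ∀ p, Sum.elim (fun i => decide (μ u (Sum.inl i)))
          (fun i => decide (μ u (Sum.inr i))) p = decide (μ u p) := by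
        rintro (p | p) <;> rfl
      simp only [Setoid.ker_def, hs, decide_eq_decide]
      exact ⟨fun h => μ.trans' h hpr, fun h => μ.trans' h (μ.symm' hpr)⟩) huv
    have hs : ∀ p, Sum.elim (fun i => decide (μ u (Sum.inl i)))
        (fun i => decide (μ u (Sum.inr i))) p = decide (μ u p) := by
      rintro (p | p) <;> rfl
    simp only [Setoid.ker_def, hs] at this
    rw [decide_eq_decide] at this
    exact this.1 (μ.refl' u)
  exact le_antisymm (key fun x y => (h x y).2) (key fun x y => (h x y).1)

theorem col_const {a b : ℕ} (π : Diag a b) (u : Bool) : Col π (fun _ => u) (fun _ => u) := by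
  intro x y _
  rcases x with x | x <;> rcases y with y | y <;> rfl

theorem col_ofLabel {a b : ℕ} {X : Type} (u : Fin a → X) (v : Fin b → X)
    (x : Fin a → Bool) (y : Fin b → Bool) :
    Col (ofLabel u v) x y ↔ (∀ i j, u i = u j → x i = x j) ∧ (∀ i j, u i = v j → x i = y j) ∧
      (∀ i j, v i = v j → y i = y j) := by
  constructor
  · intro h
    exact ⟨fun i j hij => @h (Sum.inl i) (Sum.inl j) hij,
      fun i j hij => @h (Sum.inl i) (Sum.inr j) hij, fun i j hij => @h (Sum.inr i) (Sum.inr j) hij⟩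
  · rintro ⟨h1, h2, h3⟩ (i | i) (j | j) hij
    · exact h1 _ _ hij
    · exact h2 _ _ hij
    · exact (h2 _ _ (Eq.symm hij)).symm
    · exact h3 _ _ hij

theorem col_perm {a b : ℕ} (e : Fin a ≃ Fin b) (x : Fin a → Bool) (y : Fin b → Bool) :
    Col (perm e) x y ↔ x = y ∘ e := by
  rw [perm, col_ofLabel]
  constructor
  · rintro ⟨_, h, _⟩
    funext i
    exact h i (e i) rfl
  · rintro rfl
    refine ⟨fun i j h => ?_, fun i j h => ?_, fun i j h => ?_⟩ <;> simp_all

theorem col_cap (n : ℕ) (x : Fin (n + n) → Bool) (y : Fin 0 → Bool) :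
    Col (cap n) x y ↔ x ∘ Fin.castAdd n = x ∘ Fin.natAdd n := by
  rw [cap, col_ofLabel]
  constructor
  · rintro ⟨h, _, _⟩
    funext i
    exact h _ _ ((fold_castAdd n i).trans (fold_natAdd n i).symm)
  · intro h
    refine ⟨fun i j => ?_, fun i j => j.elim0, fun i => i.elim0⟩
    have h' := fun i => congrFun h i
    simp only [Function.comp] at h'
    induction i using Fin.addCases <;> induction j using Fin.addCases <;>
      (intro hij; simp only [fold_castAdd, fold_natAdd] at hij; subst hij; simp only [h'])

theorem col_cup (n : ℕ) (x : Fin 0 → Bool) (y : Fin (n + n) → Bool) :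
    Col (cup n) x y ↔ y ∘ Fin.castAdd n = y ∘ Fin.natAdd n := by
  rw [cup, col_ofLabel]
  constructor
  · rintro ⟨_, _, h⟩
    funext i
    exact h _ _ ((fold_castAdd n i).trans (fold_natAdd n i).symm)
  · intro h
    refine ⟨fun i => i.elim0, fun i => i.elim0, fun i j => ?_⟩
    have h' := fun i => congrFun h i
    simp only [Function.comp] at h'
    induction i using Fin.addCases <;> induction j using Fin.addCases <;>
      (intro hij; simp only [fold_castAdd, fold_natAdd] at hij; subst hij; simp only [h'])

theorem col_juxt {a b c d : ℕ} (π : Diag a b) (μ : Diag c d)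
    (x : Fin (a + c) → Bool) (y : Fin (b + d) → Bool) :
    Col (juxt π μ) x y ↔ Col π (x ∘ Fin.castAdd c) (y ∘ Fin.castAdd d) ∧
      Col μ (x ∘ Fin.natAdd a) (y ∘ Fin.natAdd b) := by
  rw [Col, juxt, sup_le_iff, map_le_iff, map_le_iff, comap_ker, comap_ker,
    Sum.elim_comp_map, Sum.elim_comp_map]
  rfl

theorem glue_le {a b c : ℕ} (π : Diag a b) (μ : Diag b c) (x : Fin a → Bool) (y : Fin b → Bool)
    (z : Fin c → Bool) :
    glue π μ ≤ Setoid.ker (Sum.elim x (Sum.elim y z)) ↔ Col π x y ∧ Col μ y z := by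
  rw [glue, sup_le_iff, map_le_iff, map_le_iff, comap_ker, comap_ker, Sum.elim_comp_map]
  rfl

/-- The set of colourings of a stack extending a colouring of the outer vertices. -/
theorem card_col {a b c : ℕ} (π : Diag a b) (μ : Diag b c) (x : Fin a → Bool)
    (z : Fin c → Bool) (h : Col (stack π μ) x z) :
    Nat.card {y : Fin b → Bool // Col π x y ∧ Col μ y z} = 2 ^ loops π μ := by
  classical
  set Q := Quotient (glue π μ)
  let w : Fin a ⊕ Fin c → Bool := Sum.elim x z
  -- the value forced on a block meeting the outer vertices
  let ext (k : {B : Q // ∀ p, (Quotient.mk (glue π μ) (outer p)) ≠ B} → Bool) (B : Q) : Bool :=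
    if hB : ∀ p, (Quotient.mk (glue π μ) (outer p)) ≠ B then k ⟨B, hB⟩
    else w (not_forall_not.1 hB).choose
  have hext : ∀ k p, ext k (Quotient.mk _ (outer p)) = w p := by
    intro k p
    have hB : ¬ ∀ p', (Quotient.mk (glue π μ) (outer p')) ≠ Quotient.mk _ (outer p) :=
      fun H => H p rfl
    simp only [ext, dif_neg hB]
    have := (not_forall_not.1 hB).choose_spec
    have h2 : glue π μ (outer (not_forall_not.1 hB).choose) (outer p) := Quotient.exact this
    exact h h2
  have e : {y : Fin b → Bool // Col π x y ∧ Col μ y z} ≃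
      ({B : Q // ∀ p, (Quotient.mk (glue π μ) (outer p)) ≠ B} → Bool) :=
    { toFun := fun y B => Quotient.lift (Sum.elim x (Sum.elim y.1 z))
        (fun p r hpr => (glue_le π μ x y.1 z).2 y.2 hpr) B.1
      invFun := fun k => ⟨fun i => ext k (Quotient.mk _ (Sum.inr (Sum.inl i))), by
        rw [← glue_le]
        have : Sum.elim x (Sum.elim (fun i => ext k (Quotient.mk _ (Sum.inr (Sum.inl i)))) z) =
            fun p => ext k (Quotient.mk _ p) := by
          funext p
          rcases p with p | p | p
          · exact (hext k (Sum.inl p)).symm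
          · rfl
          · exact (hext k (Sum.inr p)).symm
        rw [this]
        intro p r hpr
        exact congrArg (ext k) (Quotient.sound hpr)⟩
      left_inv := by
        rintro ⟨y, hy⟩
        ext i
        simp only [ext]
        split_ifs with hB
        · rfl
        · have := (not_forall_not.1 hB).choose_spec
          set p := (not_forall_not.1 hB).choose
          have h2 := (glue_le π μ x y z).2 hy (Quotient.exact this)
          have : w p = Sum.elim x (Sum.elim y z) (outer p) := by
            rcases p with p | p <;> rfl
          rw [this]
          exact h2
      right_inv := by
        intro k
        funext ⟨B, hB⟩
        induction B using Quotient.inductionOn with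
        | h p =>
          rcases p with p | p | p
          · exact absurd rfl (hB (Sum.inl p))
          · show ext k _ = _
            simp only [ext, dif_pos hB]
          · exact absurd rfl (hB (Sum.inr p)) }
  rw [Nat.card_congr e, Nat.card_fun]
  simp [loops, Q]

theorem col_stack_of {a b c : ℕ} (π : Diag a b) (μ : Diag b c) (x : Fin a → Bool)
    (y : Fin b → Bool) (z : Fin c → Bool) (h1 : Col π x y) (h2 : Col μ y z) :
    Col (stack π μ) x z := by
  intro p r hpr
  have := (glue_le π μ x y z).2 ⟨h1, h2⟩ hpr
  rcases p with p | p <;> rcases r with r | r <;> exact this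

open Classical in
/-- The matrix of a diagram scaled by a power of two. -/
noncomputable def mat {a b : ℕ} (k : ℕ) (π : Diag a b) :
    Matrix (Fin a → Bool) (Fin b → Bool) ℕ := fun x y => if Col π x y then 2 ^ k else 0

theorem mat_inj {a b : ℕ} {k l : ℕ} {π μ : Diag a b} (h : mat k π = mat l μ) : k = l ∧ π = μ := by
  classical
  have h' := fun x y => congrFun (congrFun h x) y
  simp only [mat] at h'
  constructor
  · have := h' (fun _ => true) (fun _ => true)
    rw [if_pos (col_const _ _), if_pos (col_const _ _)] at this
    exact Nat.pow_right_injective le_rfl this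
  · refine col_ext fun x y => ?_
    have := h' x y
    split_ifs at this with h1 h2 <;> simp_all [(pow_pos (two_pos : (0 : ℕ) < 2) l).ne]

theorem mat_mul {a b c : ℕ} (k l : ℕ) (π : Diag a b) (μ : Diag b c) :
    mat k π * mat l μ = mat (k + l + loops π μ) (stack π μ) := by
  classical
  ext x z
  simp only [Matrix.mul_apply, mat, mul_ite, ite_mul, zero_mul, mul_zero, ← ite_and]
  rw [← Finset.sum_filter, Finset.sum_const, smul_eq_mul]
  split_ifs with h
  · have := card_col π μ x z h
    rw [Nat.card_eq_fintype_card, Fintype.card_subtype] at this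
    rw [pow_add, pow_add, ← this, mul_comm]
    congr 2
    ext y
    simp [and_comm]
  · have : (Finset.univ.filter fun y => Col μ y z ∧ Col π x y) = ∅ := by
      rw [Finset.filter_eq_empty_iff]
      rintro y - ⟨h2, h1⟩
      exact h (col_stack_of π μ x y z h1 h2)
    simp [this]

end PartitionDiagram

namespace PartitionDiagram

theorem stack_assoc {a b c d : ℕ} (π : Diag a b) (μ : Diag b c) (ν : Diag c d) :
    loops π μ + loops (stack π μ) ν = loops μ ν + loops π (stack μ ν) ∧
      stack (stack π μ) ν = stack π (stack μ ν) := by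
  have h := Matrix.mul_assoc (mat 0 π) (mat 0 μ) (mat 0 ν)
  simp only [mat_mul, zero_add, add_zero] at h
  exact mat_inj h

open Classical in
theorem mat_perm {a b : ℕ} (e : Fin a ≃ Fin b) (x : Fin a → Bool) (y : Fin b → Bool) :
    mat 0 (perm e) x y = if x = y ∘ e then 1 else 0 := by
  simp [mat, col_perm]

theorem mat_perm_mul {a b c : ℕ} (e : Fin a ≃ Fin b) (M : Matrix (Fin b → Bool) (Fin c → Bool) ℕ)
    (x : Fin a → Bool) (z : Fin c → Bool) :
    (mat 0 (perm e) * M) x z = M (x ∘ e.symm) z := by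
  classical
  rw [Matrix.mul_apply, Finset.sum_eq_single (x ∘ e.symm)]
  · simp [mat_perm, Function.comp_assoc]
  · intro y _ hy
    rw [mat_perm, if_neg, zero_mul]
    rintro rfl
    exact hy (by simp [Function.comp_assoc])
  · simp

theorem mat_mul_perm {a b c : ℕ} (e : Fin b ≃ Fin c) (M : Matrix (Fin a → Bool) (Fin b → Bool) ℕ)
    (x : Fin a → Bool) (z : Fin c → Bool) :
    (M * mat 0 (perm e)) x z = M x (z ∘ e) := by
  classical
  rw [Matrix.mul_apply, Finset.sum_eq_single (z ∘ e)]
  · simp [mat_perm]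
  · intro y _ hy
    rw [mat_perm, if_neg hy, mul_zero]
  · simp

theorem mat_juxt {a b c d : ℕ} (k l : ℕ) (π : Diag a b) (μ : Diag c d)
    (x : Fin (a + c) → Bool) (y : Fin (b + d) → Bool) :
    mat (k + l) (juxt π μ) x y = mat k π (x ∘ Fin.castAdd c) (y ∘ Fin.castAdd d) *
      mat l μ (x ∘ Fin.natAdd a) (y ∘ Fin.natAdd b) := by
  classical
  simp only [mat, col_juxt, pow_add]
  split_ifs <;> simp_all

theorem juxt_stack {a b c a' b' c' : ℕ} (π : Diag a b) (μ : Diag b c) (π' : Diag a' b')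
    (μ' : Diag b' c') :
    loops (juxt π π') (juxt μ μ') = loops π μ + loops π' μ' ∧
      stack (juxt π π') (juxt μ μ') = juxt (stack π μ) (stack π' μ') := by
  have h : mat 0 (juxt π π') * mat 0 (juxt μ μ') =
      mat (loops π μ + loops π' μ') (juxt (stack π μ) (stack π' μ')) := by
    ext x z
    have h1 := mat_mul 0 0 π μ
    have h2 := mat_mul 0 0 π' μ'
    simp only [zero_add] at h1 h2
    rw [mat_juxt, ← h1, ← h2, Matrix.mul_apply, Matrix.mul_apply, Matrix.mul_apply,
      Finset.sum_mul_sum, ← Finset.sum_product', Finset.univ_product_univ,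
      ← (Fin.appendEquiv b b').sum_comp]
    refine Finset.sum_congr rfl fun y _ => ?_
    have e1 : Fin.appendEquiv b b' y ∘ Fin.castAdd b' = y.1 := by
      funext i; simp [Fin.appendEquiv]
    have e2 : Fin.appendEquiv b b' y ∘ Fin.natAdd b = y.2 := by
      funext i; simp [Fin.appendEquiv, -Fin.natAdd_eq_addNat]
    have m1 := mat_juxt 0 0 π π' x (Fin.appendEquiv b b' y)
    have m2 := mat_juxt 0 0 μ μ' (Fin.appendEquiv b b' y) z
    rw [e1, e2] at m1 m2
    rw [add_zero] at m1 m2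
    rw [m1, m2]
    ring
  rw [mat_mul, zero_add, zero_add] at h
  exact mat_inj h

theorem juxt_refl (a b : ℕ) :
    juxt (perm (Equiv.refl (Fin a))) (perm (Equiv.refl (Fin b))) =
      perm (Equiv.refl (Fin (a + b))) := by
  refine col_ext fun x y => ?_
  rw [col_juxt, col_perm, col_perm, col_perm]
  constructor
  · rintro ⟨h1, h2⟩
    funext i
    induction i using Fin.addCases with
    | left i => exact congrFun h1 i
    | right i => exact congrFun h2 i
  · rintro rfl
    exact ⟨rfl, rfl⟩

theorem loops_perm_left {a b c : ℕ} (e : Fin a ≃ Fin b) (π : Diag b c) :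
    loops (perm e) π = 0 := by
  have h := congrFun (congrFun (mat_mul 0 0 (perm e) π) (fun _ => true)) (fun _ => true)
  rw [mat_perm_mul, mat, mat, if_pos (by exact col_const π true), if_pos (col_const _ _)] at h
  have := Nat.pow_right_injective le_rfl h
  simpa using this.symm

theorem loops_perm_right {a b c : ℕ} (e : Fin b ≃ Fin c) (π : Diag a b) :
    loops π (perm e) = 0 := by
  have h := congrFun (congrFun (mat_mul 0 0 π (perm e)) (fun _ => true)) (fun _ => true)
  rw [mat_mul_perm, mat, mat, if_pos (by exact col_const π true), if_pos (col_const _ _)] at h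
  have := Nat.pow_right_injective le_rfl h
  simpa using this.symm

theorem col_perm_stack {a b c : ℕ} (e : Fin a ≃ Fin b) (π : Diag b c) (x : Fin a → Bool)
    (y : Fin c → Bool) : Col (stack (perm e) π) x y ↔ Col π (x ∘ e.symm) y := by
  have h := congrFun (congrFun (mat_mul 0 0 (perm e) π) x) y
  rw [mat_perm_mul, mat, mat, loops_perm_left] at h
  split_ifs at h <;> simp_all

theorem col_stack_perm {a b c : ℕ} (e : Fin b ≃ Fin c) (π : Diag a b) (x : Fin a → Bool)
    (y : Fin c → Bool) : Col (stack π (perm e)) x y ↔ Col π x (y ∘ e) := by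
  have h := congrFun (congrFun (mat_mul 0 0 π (perm e)) x) y
  rw [mat_mul_perm, mat, mat, loops_perm_right] at h
  split_ifs at h <;> simp_all

/-- Straightening the two zigzags formed by a cup and a cap. -/
theorem zigzag_aux {a b c : ℕ} (π : Diag a b) (μ : Diag b c) (ν : Diag a c)
    (s : (Fin a → Bool) → (Fin c → Bool) → Fin b → Bool)
    (h : ∀ x y z, Col π x y ∧ Col μ y z ↔ Col ν x z ∧ y = s x z) :
    loops π μ = 0 ∧ stack π μ = ν := by
  classical
  have : mat 0 π * mat 0 μ = mat 0 ν := by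
    ext x z
    rw [Matrix.mul_apply, Finset.sum_eq_single (s x z)]
    · have := h x (s x z) z
      simp only [mat]
      split_ifs <;> simp_all
    · intro y _ hy
      have := h x y z
      simp only [mat]
      split_ifs <;> simp_all
    · simp
  rw [mat_mul, zero_add, zero_add] at this
  exact mat_inj this

end PartitionDiagram

universe u

namespace PartitionDiagram

variable (F : Type u) [Field F]

/-- The space `FP_{a,b}` spanned by the partition diagrams. -/
abbrev FP (a b : ℕ) : Type u := Diag a b →₀ F

variable {F}

/-- A partition diagram as a basis vector of `FP_{a,b}`. -/
noncomputable abbrev FP.of {a b : ℕ} (π : Diag a b) : FP F a b := Finsupp.single π 1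

/-- Vertical composition with parameter `t`: the bilinear extension of
`(π, μ) ↦ t ^ loops π μ • stack π μ`, with `π` on top of `μ`. -/
noncomputable def vcomp (t : F) {a b c : ℕ} : FP F a b →ₗ[F] FP F b c →ₗ[F] FP F a c :=
  Finsupp.linearCombination F fun π =>
    Finsupp.linearCombination F fun μ => t ^ loops π μ • FP.of (stack π μ)

/-- Horizontal composition: the bilinear extension of the juxtaposition of diagrams. -/
noncomputable def hcomp {a b c d : ℕ} : FP F a b →ₗ[F] FP F c d →ₗ[F] FP F (a + c) (b + d) :=
  Finsupp.linearCombination F fun π =>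
    Finsupp.linearCombination F fun μ => FP.of (juxt π μ)

theorem vcomp_of (t : F) {a b c : ℕ} (π : Diag a b) (μ : Diag b c) :
    vcomp t (FP.of π) (FP.of μ) = t ^ loops π μ • FP.of (stack π μ) := by
  simp [vcomp]

theorem hcomp_of {a b c d : ℕ} (π : Diag a b) (μ : Diag c d) :
    hcomp (FP.of π : FP F a b) (FP.of μ) = FP.of (juxt π μ) := by
  simp [hcomp]

theorem FP.induction {a b : ℕ} {p : FP F a b → Prop} (f : FP F a b)
    (add : ∀ f g, p f → p g → p (f + g)) (smul : ∀ (r : F) f, p f → p (r • f))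
    (of : ∀ π, p (FP.of π)) : p f := by
  induction f using Finsupp.induction_linear with
  | zero => simpa using smul 0 _ (of ⊥)
  | add f g hf hg => exact add f g hf hg
  | single π r => rw [← Finsupp.smul_single_one]; exact smul r _ (of π)

end PartitionDiagram

open PartitionDiagram

/-- Deligne's category before taking envelopes: the objects are `[n]` for natural numbers `n`,
the morphisms `[a] ⟶ [b]` are the elements of `FP_{a,b}(t)`. -/
@[ext]
structure Rep₀ (F : Type u) [Field F] (t : F) where
  /-- the number of vertices -/
  n : ℕ

namespace Rep₀

variable {F : Type u} [Field F] {t : F}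

noncomputable instance : Category (Rep₀ F t) where
  Hom X Y := FP F X.n Y.n
  id X := FP.of (perm (Equiv.refl _))
  comp f g := vcomp t f g
  id_comp f := by
    induction f using FP.induction with
    | add f g hf hg => rw [map_add, hf, hg]
    | smul r f hf => rw [map_smul, hf]
    | of π =>
      rw [vcomp_of, loops_perm_left, pow_zero, one_smul]
      congr 1
      exact col_ext fun x y => col_perm_stack _ _ _ _
  comp_id f := by
    induction f using FP.induction with
    | add f g hf hg => rw [map_add, LinearMap.add_apply, hf, hg]
    | smul r f hf => rw [map_smul, LinearMap.smul_apply, hf]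
    | of π =>
      rw [vcomp_of, loops_perm_right, pow_zero, one_smul]
      congr 1
      exact col_ext fun x y => col_stack_perm _ _ _ _
  assoc f g h := by
    induction f using FP.induction with
    | add f f' hf hf' => simp only [map_add, LinearMap.add_apply, hf, hf']
    | smul r f hf => simp only [map_smul, LinearMap.smul_apply, hf]
    | of π =>
      induction g using FP.induction with
      | add f f' hf hf' => simp only [map_add, LinearMap.add_apply, hf, hf']
      | smul r f hf => simp only [map_smul, LinearMap.smul_apply, hf]
      | of μ =>
        induction h using FP.induction with
        | add f f' hf hf' => simp only [map_add, hf, hf']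
        | smul r f hf => simp only [map_smul, hf]
        | of ν =>
          simp only [vcomp_of, map_smul, LinearMap.smul_apply, smul_smul, ← pow_add]
          rw [(stack_assoc π μ ν).2, (stack_assoc π μ ν).1, add_comm (loops μ ν)]

theorem id_eq (X : Rep₀ F t) : 𝟙 X = (FP.of (perm (Equiv.refl _)) : FP F X.n X.n) := rfl

theorem comp_eq {X Y Z : Rep₀ F t} (f : X ⟶ Y) (g : Y ⟶ Z) :
    f ≫ g = vcomp t (a := X.n) (b := Y.n) (c := Z.n) f g := rfl

noncomputable instance : Preadditive (Rep₀ F t) where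
  homGroup X Y := inferInstanceAs (AddCommGroup (FP F X.n Y.n))
  add_comp _ _ _ f f' g := by
    rw [comp_eq, comp_eq, comp_eq, map_add]; rfl
  comp_add _ _ _ f g g' := by
    rw [comp_eq, comp_eq, comp_eq, map_add]

noncomputable instance : Linear F (Rep₀ F t) where
  homModule X Y := inferInstanceAs (Module F (FP F X.n Y.n))
  smul_comp _ _ _ r f g := by
    rw [comp_eq, comp_eq]; erw [map_smul]; rfl
  comp_smul _ _ _ f r g := by
    rw [comp_eq, comp_eq]; erw [map_smul]

/-- A partition diagram as a morphism. -/
noncomputable def of {X Y : Rep₀ F t} (π : Diag X.n Y.n) : X ⟶ Y := (FP.of π : FP F X.n Y.n)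

theorem hom_induction {X Y : Rep₀ F t} {p : (X ⟶ Y) → Prop} (f : X ⟶ Y)
    (add : ∀ f g, p f → p g → p (f + g)) (smul : ∀ (r : F) f, p f → p (r • f))
    (of : ∀ π, p (of π)) : p f := FP.induction (p := p) f add smul of

theorem of_comp_of {X Y Z : Rep₀ F t} (π : Diag X.n Y.n) (μ : Diag Y.n Z.n) :
    (of π : X ⟶ Y) ≫ (of μ : Y ⟶ Z) = t ^ loops π μ • of (stack π μ) := vcomp_of t π μ

theorem id_eq_of (X : Rep₀ F t) : 𝟙 X = of (perm (Equiv.refl _)) := rfl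

/-- The isomorphism given by a permutation diagram. -/
noncomputable def permIso {X Y : Rep₀ F t} (e : Fin X.n ≃ Fin Y.n) : X ≅ Y where
  hom := of (perm e)
  inv := of (perm e.symm)
  hom_inv_id := by
    rw [of_comp_of, loops_perm_left, pow_zero, one_smul, id_eq_of]
    congr 1
    refine col_ext fun x y => ?_
    rw [col_perm_stack, col_perm, col_perm]
    exact ⟨fun h => e.symm.surjective.injective_comp_right h, fun h => by rw [h]; rfl⟩
  inv_hom_id := by
    rw [of_comp_of, loops_perm_left, pow_zero, one_smul, id_eq_of]
    congr 1
    refine col_ext fun x y => ?_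
    rw [col_perm_stack, col_perm, col_perm]
    exact ⟨fun h => e.surjective.injective_comp_right h, fun h => by rw [h]; rfl⟩

theorem eqToHom_eq {X Y : Rep₀ F t} (h : X = Y) :
    eqToHom h = of (perm (finCongr (congrArg Rep₀.n h))) := by
  subst h; rfl

/-- The tensor product of objects, `[a] ⊗ [b] = [a + b]`. -/
abbrev tensorObj (X Y : Rep₀ F t) : Rep₀ F t := ⟨X.n + Y.n⟩

/-- The tensor product of morphisms, given by horizontal concatenation. -/
noncomputable def tensorHom {X Y X' Y' : Rep₀ F t} (f : X ⟶ Y) (g : X' ⟶ Y') :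
    tensorObj X X' ⟶ tensorObj Y Y' := hcomp (a := X.n) (b := Y.n) (c := X'.n) (d := Y'.n) f g

theorem tensorHom_of {X Y X' Y' : Rep₀ F t} (π : Diag X.n Y.n) (μ : Diag X'.n Y'.n) :
    tensorHom (of π : X ⟶ Y) (of μ : X' ⟶ Y') = of (juxt π μ) := hcomp_of π μ

theorem add_tensorHom {X Y X' Y' : Rep₀ F t} (f f' : X ⟶ Y) (g : X' ⟶ Y') :
    tensorHom (f + f') g = tensorHom f g + tensorHom f' g := by
  simp only [tensorHom]; erw [map_add]; rfl

theorem tensorHom_add {X Y X' Y' : Rep₀ F t} (f : X ⟶ Y) (g g' : X' ⟶ Y') :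
    tensorHom f (g + g') = tensorHom f g + tensorHom f g' := by
  simp only [tensorHom]; erw [map_add]

theorem smul_tensorHom {X Y X' Y' : Rep₀ F t} (r : F) (f : X ⟶ Y) (g : X' ⟶ Y') :
    tensorHom (r • f) g = r • tensorHom f g := by
  simp only [tensorHom]; erw [map_smul]; rfl

theorem tensorHom_smul {X Y X' Y' : Rep₀ F t} (r : F) (f : X ⟶ Y) (g : X' ⟶ Y') :
    tensorHom f (r • g) = r • tensorHom f g := by
  simp only [tensorHom]; erw [map_smul]

theorem id_tensorHom_id (X Y : Rep₀ F t) : tensorHom (𝟙 X) (𝟙 Y) = 𝟙 (tensorObj X Y) := by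
  rw [id_eq_of, id_eq_of, tensorHom_of, juxt_refl]; rfl

theorem tensorHom_comp {X Y Z X' Y' Z' : Rep₀ F t} (f : X ⟶ Y) (f' : X' ⟶ Y') (g : Y ⟶ Z)
    (g' : Y' ⟶ Z') :
    tensorHom f f' ≫ tensorHom g g' = tensorHom (f ≫ g) (f' ≫ g') := by
  induction f using hom_induction with
  | add f₁ f₂ h₁ h₂ => simp only [add_tensorHom, Preadditive.add_comp, h₁, h₂]
  | smul r f h => simp only [smul_tensorHom, Linear.smul_comp, h]
  | of π =>
  induction g using hom_induction with
  | add f₁ f₂ h₁ h₂ => simp only [add_tensorHom, Preadditive.comp_add, h₁, h₂]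
  | smul r f h => simp only [smul_tensorHom, Linear.comp_smul, h]
  | of μ =>
  induction f' using hom_induction with
  | add f₁ f₂ h₁ h₂ => simp only [tensorHom_add, Preadditive.add_comp, h₁, h₂]
  | smul r f h => simp only [tensorHom_smul, Linear.smul_comp, h]
  | of π' =>
  induction g' using hom_induction with
  | add f₁ f₂ h₁ h₂ => simp only [tensorHom_add, Preadditive.comp_add, h₁, h₂]
  | smul r f h => simp only [tensorHom_smul, Linear.comp_smul, h]
  | of μ' =>
    rw [tensorHom_of, tensorHom_of, of_comp_of, of_comp_of, of_comp_of, tensorHom_smul,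
      smul_tensorHom, tensorHom_of, smul_smul, ← pow_add, add_comm (loops π' μ')]
    have h := juxt_stack π μ π' μ'
    have h1 := h.1
    have h2 := h.2
    erw [h1, h2]

/-- Naturality of permutation diagrams, reduced to colourings. -/
theorem of_perm_comp {X Y X' Y' : Rep₀ F t} (e : Fin X.n ≃ Fin Y.n) (e' : Fin X'.n ≃ Fin Y'.n)
    (π : Diag X.n X'.n) (μ : Diag Y.n Y'.n)
    (h : ∀ x y, Col π x (y ∘ e') ↔ Col μ (x ∘ e.symm) y) :
    (of π : X ⟶ X') ≫ (of (perm e') : X' ⟶ Y') = (of (perm e) : X ⟶ Y) ≫ (of μ : Y ⟶ Y') := by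
  rw [of_comp_of, of_comp_of, loops_perm_left, loops_perm_right]
  congr 2
  refine col_ext fun x y => ?_
  rw [col_perm_stack, col_stack_perm, h]

theorem eqToHom_tensorHom {X X' Y : Rep₀ F t} (h : X = X') :
    tensorHom (eqToHom h) (𝟙 Y) = eqToHom (by rw [h]) := by
  subst h; simp [id_tensorHom_id]

theorem tensorHom_eqToHom {X X' Y : Rep₀ F t} (h : X = X') :
    tensorHom (𝟙 Y) (eqToHom h) = eqToHom (by rw [h]) := by
  subst h; simp [id_tensorHom_id]

theorem tensorObj_assoc (X Y Z : Rep₀ F t) :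
    tensorObj (tensorObj X Y) Z = tensorObj X (tensorObj Y Z) :=
  Rep₀.ext (Nat.add_assoc _ _ _)

theorem unit_tensorObj (X : Rep₀ F t) : tensorObj ⟨0⟩ X = X := Rep₀.ext (Nat.zero_add _)

theorem tensorObj_unit (X : Rep₀ F t) : tensorObj X ⟨0⟩ = X := Rep₀.ext (Nat.add_zero _)

/-- The monoidal structure; it is strict. -/
noncomputable instance : MonoidalCategory (Rep₀ F t) :=
  letI : MonoidalCategoryStruct (Rep₀ F t) :=
    { tensorObj := tensorObj
      tensorHom := tensorHom
      whiskerLeft := fun X _ _ f => tensorHom (𝟙 X) f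
      whiskerRight := fun f X => tensorHom f (𝟙 X)
      tensorUnit := ⟨0⟩
      associator := fun X Y Z => eqToIso (Rep₀.ext (Nat.add_assoc X.n Y.n Z.n))
      leftUnitor := fun X => eqToIso (Rep₀.ext (Nat.zero_add X.n))
      rightUnitor := fun X => eqToIso (Rep₀.ext (Nat.add_zero X.n)) }
  MonoidalCategory.ofTensorHom
    (id_tensorHom_id := id_tensorHom_id)
    (tensorHom_comp_tensorHom := tensorHom_comp)
    (associator_naturality := by
      intro X₁ X₂ X₃ Y₁ Y₂ Y₃ f₁ f₂ f₃
      show tensorHom (tensorHom f₁ f₂) f₃ ≫ eqToHom (tensorObj_assoc _ _ _) =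
        eqToHom (tensorObj_assoc _ _ _) ≫ tensorHom f₁ (tensorHom f₂ f₃)
      induction f₁ using hom_induction with
      | add f₁ f₂ h₁ h₂ => simp only [add_tensorHom, Preadditive.add_comp, Preadditive.comp_add, h₁, h₂]
      | smul r f h => simp only [smul_tensorHom, Linear.smul_comp, Linear.comp_smul, h]
      | of π₁ =>
      induction f₂ using hom_induction with
      | add f₁ f₂ h₁ h₂ => simp only [tensorHom_add, add_tensorHom, Preadditive.add_comp, Preadditive.comp_add, h₁, h₂]
      | smul r f h => simp only [tensorHom_smul, smul_tensorHom, Linear.smul_comp, Linear.comp_smul, h]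
      | of π₂ =>
      induction f₃ using hom_induction with
      | add f₁ f₂ h₁ h₂ => simp only [tensorHom_add, Preadditive.add_comp, Preadditive.comp_add, h₁, h₂]
      | smul r f h => simp only [tensorHom_smul, Linear.smul_comp, Linear.comp_smul, h]
      | of π₃ =>
        rw [eqToHom_eq, eqToHom_eq]
        simp only [tensorHom_of]
        refine of_perm_comp _ _ _ _ fun x y => ?_
        erw [col_juxt, col_juxt, col_juxt, col_juxt, and_assoc]
        refine and_congr (iff_of_eq (congrArg₂ _ ?_ ?_)) (and_congr
          (iff_of_eq (congrArg₂ _ ?_ ?_)) (iff_of_eq (congrArg₂ _ ?_ ?_)))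
        all_goals
          funext i
          first
          | exact congrArg x (Fin.ext (by simp <;> omega))
          | exact congrArg y (Fin.ext (by simp <;> omega)))
    (leftUnitor_naturality := by
      intro X Y f
      show tensorHom (𝟙 _) f ≫ eqToHom (unit_tensorObj _) = eqToHom (unit_tensorObj _) ≫ f
      induction f using hom_induction with
      | add f₁ f₂ h₁ h₂ => simp only [tensorHom_add, Preadditive.add_comp, Preadditive.comp_add, h₁, h₂]
      | smul r f h => simp only [tensorHom_smul, Linear.smul_comp, Linear.comp_smul, h]
      | of π =>
        rw [eqToHom_eq, eqToHom_eq, id_eq_of]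
        simp only [tensorHom_of]
        refine of_perm_comp _ _ _ _ fun x y => ?_
        erw [col_juxt]
        rw [col_perm]
        refine ⟨fun h => ?_, fun h => ⟨funext fun i => i.elim0, ?_⟩⟩
        · convert h.2 using 1 <;> (funext i; first
            | exact congrArg x (Fin.ext (by simp))
            | exact congrArg y (Fin.ext (by simp)))
        · convert h using 1 <;> (funext i; first
            | exact congrArg x (Fin.ext (by simp))
            | exact congrArg y (Fin.ext (by simp))))
    (rightUnitor_naturality := by
      intro X Y f
      show tensorHom f (𝟙 _) ≫ eqToHom (tensorObj_unit _) = eqToHom (tensorObj_unit _) ≫ f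
      induction f using hom_induction with
      | add f₁ f₂ h₁ h₂ => simp only [add_tensorHom, Preadditive.add_comp, Preadditive.comp_add, h₁, h₂]
      | smul r f h => simp only [smul_tensorHom, Linear.smul_comp, Linear.comp_smul, h]
      | of π =>
        rw [eqToHom_eq, eqToHom_eq, id_eq_of]
        simp only [tensorHom_of]
        refine of_perm_comp _ _ _ _ fun x y => ?_
        erw [col_juxt]
        rw [col_perm]
        refine ⟨fun h => ?_, fun h => ⟨?_, funext fun i => i.elim0⟩⟩
        · convert h.1 using 1 <;> (funext i; first
            | exact congrArg x (Fin.ext (by simp))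
            | exact congrArg y (Fin.ext (by simp)))
        · convert h using 1 <;> (funext i; first
            | exact congrArg x (Fin.ext (by simp))
            | exact congrArg y (Fin.ext (by simp))))
    (pentagon := by
      intro W X Y Z
      show tensorHom (eqToHom (tensorObj_assoc _ _ _)) (𝟙 _) ≫ eqToHom (tensorObj_assoc _ _ _) ≫
        tensorHom (𝟙 _) (eqToHom (tensorObj_assoc _ _ _)) = eqToHom (tensorObj_assoc _ _ _) ≫ eqToHom (tensorObj_assoc _ _ _)
      rw [eqToHom_tensorHom, tensorHom_eqToHom, eqToHom_trans, eqToHom_trans]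
      erw [eqToHom_trans])
    (triangle := by
      intro X Y
      show eqToHom (tensorObj_assoc _ _ _) ≫ tensorHom (𝟙 _) (eqToHom (unit_tensorObj _)) =
        tensorHom (eqToHom (tensorObj_unit _)) (𝟙 _)
      rw [eqToHom_tensorHom, tensorHom_eqToHom]
      erw [eqToHom_trans])

theorem whiskerLeft_eq (X : Rep₀ F t) {Y Z : Rep₀ F t} (f : Y ⟶ Z) :
    X ◁ f = tensorHom (𝟙 X) f := rfl

theorem whiskerRight_eq {Y Z : Rep₀ F t} (f : Y ⟶ Z) (X : Rep₀ F t) :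
    f ▷ X = tensorHom f (𝟙 X) := rfl

instance : MonoidalPreadditive (Rep₀ F t) where
  whiskerLeft_zero {X Y Z} := by
    have h := tensorHom_smul (0 : F) (𝟙 X) (0 : Y ⟶ Z)
    rw [zero_smul, zero_smul] at h
    exact h
  zero_whiskerRight {X Y Z} := by
    have h := smul_tensorHom (0 : F) (0 : Y ⟶ Z) (𝟙 X)
    rw [zero_smul, zero_smul] at h
    exact h
  whiskerLeft_add f g := tensorHom_add _ f g
  add_whiskerRight f g := add_tensorHom f g _

instance : MonoidalLinear F (Rep₀ F t) where
  whiskerLeft_smul _ _ _ r f := tensorHom_smul r _ f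
  smul_whiskerRight r _ _ f _ := smul_tensorHom r f _

theorem tensor_induction {X Y X' Y' : Rep₀ F t} {p : (X ⊗ X' ⟶ Y ⊗ Y') → Prop}
    (f : X ⟶ Y) (g : X' ⟶ Y')
    (add : ∀ f g, p f → p g → p (f + g)) (smul : ∀ (r : F) f, p f → p (r • f))
    (of : ∀ π μ, p (of (juxt π μ))) : p (tensorHom f g) := by
  induction f using hom_induction with
  | add f₁ f₂ h₁ h₂ => rw [add_tensorHom]; exact add _ _ h₁ h₂
  | smul r f h => rw [smul_tensorHom]; exact smul _ _ h
  | of π =>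
  induction g using hom_induction with
  | add f₁ f₂ h₁ h₂ => rw [tensorHom_add]; exact add _ _ h₁ h₂
  | smul r f h => rw [tensorHom_smul]; exact smul _ _ h
  | of μ => rw [tensorHom_of]; exact of π μ

theorem perm_comp_perm {X Y Z : Rep₀ F t} (e : Fin X.n ≃ Fin Y.n) (e' : Fin Y.n ≃ Fin Z.n) :
    (of (perm e) : X ⟶ Y) ≫ (of (perm e') : Y ⟶ Z) = of (perm (e.trans e')) := by
  rw [of_comp_of, loops_perm_left, pow_zero, one_smul]
  congr 1
  refine col_ext fun x y => ?_
  rw [col_perm_stack, col_perm, col_perm]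
  exact ⟨fun h => e.symm.surjective.injective_comp_right
    (h.trans (by funext i; simp)), fun h => by rw [h]; funext i; simp⟩

theorem finAddFlip_symm' (a b : ℕ) :
    (finAddFlip : Fin (a + b) ≃ Fin (b + a)).symm = finAddFlip := rfl

/-- The juxtaposition of two bijections. -/
def sumPerm {a b c d : ℕ} (e : Fin a ≃ Fin b) (e' : Fin c ≃ Fin d) :
    Fin (a + c) ≃ Fin (b + d) :=
  finSumFinEquiv.symm.trans ((Equiv.sumCongr e e').trans finSumFinEquiv)

theorem sumPerm_castAdd {a b c d : ℕ} (e : Fin a ≃ Fin b) (e' : Fin c ≃ Fin d) (i : Fin a) :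
    sumPerm e e' (Fin.castAdd c i) = Fin.castAdd d (e i) := by
  simp [sumPerm]

theorem sumPerm_natAdd {a b c d : ℕ} (e : Fin a ≃ Fin b) (e' : Fin c ≃ Fin d) (i : Fin c) :
    sumPerm e e' (Fin.natAdd a i) = Fin.natAdd b (e' i) := by
  simp [sumPerm, -Fin.natAdd_eq_addNat]

theorem juxt_perm {a b c d : ℕ} (e : Fin a ≃ Fin b) (e' : Fin c ≃ Fin d) :
    juxt (perm e) (perm e') = perm (sumPerm e e') := by
  refine col_ext fun x y => ?_
  rw [col_juxt, col_perm, col_perm, col_perm]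
  constructor
  · rintro ⟨h1, h2⟩
    funext i
    induction i using Fin.addCases with
    | left i => simpa [sumPerm_castAdd] using congrFun h1 i
    | right i => simpa [sumPerm_natAdd, -Fin.natAdd_eq_addNat] using congrFun h2 i
  · rintro rfl
    constructor <;> funext i <;> simp [sumPerm_castAdd, sumPerm_natAdd, -Fin.natAdd_eq_addNat]

theorem associator_hom (X Y Z : Rep₀ F t) :
    (α_ X Y Z).hom = of (perm (finCongr (Nat.add_assoc X.n Y.n Z.n))) :=
  eqToHom_eq (tensorObj_assoc X Y Z)

theorem associator_inv (X Y Z : Rep₀ F t) :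
    (α_ X Y Z).inv = of (perm (finCongr (Nat.add_assoc X.n Y.n Z.n).symm)) :=
  eqToHom_eq (tensorObj_assoc X Y Z).symm

theorem val_flip {a b : ℕ} (i : Fin (a + b)) :
    (finAddFlip i : Fin (b + a)).val = if i.val < a then i.val + b else i.val - a := by
  induction i using Fin.addCases with
  | left i => rw [finAddFlip_apply_castAdd]; simp [Nat.add_comm]
  | right i => rw [finAddFlip_apply_natAdd]; simp

theorem val_sumPerm_left {a b c : ℕ} (i : Fin (a + b + c)) :
    (sumPerm (finAddFlip : Fin (a + b) ≃ Fin (b + a)) (Equiv.refl (Fin c)) i).val =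
      if i.val < a + b then (if i.val < a then i.val + b else i.val - a) else i.val := by
  induction i using Fin.addCases with
  | left i => rw [sumPerm_castAdd, Fin.val_castAdd, val_flip]; simp
  | right i => rw [sumPerm_natAdd]; simp; omega

theorem val_sumPerm_right {a b c : ℕ} (i : Fin (c + (a + b))) :
    (sumPerm (Equiv.refl (Fin c)) (finAddFlip : Fin (a + b) ≃ Fin (b + a)) i).val =
      if i.val < c then i.val else if i.val < c + a then i.val + b else i.val - a := by
  induction i using Fin.addCases with
  | left i => rw [sumPerm_castAdd]; simp
  | right i => rw [sumPerm_natAdd, Fin.val_natAdd, val_flip, Fin.val_natAdd]; split_ifs <;> omega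

/-- The block transposition `i ↦ m + i`, `n + j ↦ j` exchanging the first `n` and the last `m`
vertices. -/
noncomputable def braidIso (X Y : Rep₀ F t) : X ⊗ Y ≅ Y ⊗ X :=
  permIso (X := tensorObj X Y) (Y := tensorObj Y X) finAddFlip

/-- The (symmetric) braiding. -/
noncomputable instance : SymmetricCategory (Rep₀ F t) where
  braiding := braidIso
  braiding_naturality_right X Y Z f := by
    show tensorHom (𝟙 X) f ≫ of (perm finAddFlip) = of (perm finAddFlip) ≫ tensorHom f (𝟙 X)
    induction f using hom_induction with
    | add f₁ f₂ h₁ h₂ =>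
      simp only [add_tensorHom, tensorHom_add, Preadditive.add_comp, Preadditive.comp_add, h₁, h₂]
    | smul r f h =>
      simp only [tensorHom_smul, smul_tensorHom, Linear.smul_comp, Linear.comp_smul, h]
    | of π =>
      rw [id_eq_of, tensorHom_of, tensorHom_of]
      refine of_perm_comp _ _ _ _ fun x y => ?_
      erw [col_juxt, col_juxt]
      rw [and_comm]
      refine and_congr (iff_of_eq (congrArg₂ _ ?_ ?_)) (iff_of_eq (congrArg₂ _ ?_ ?_))
      all_goals
        funext i
        simp [-Fin.natAdd_eq_addNat, finAddFlip_symm']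
  braiding_naturality_left f X := by
    show tensorHom f (𝟙 X) ≫ of (perm finAddFlip) = of (perm finAddFlip) ≫ tensorHom (𝟙 X) f
    induction f using hom_induction with
    | add f₁ f₂ h₁ h₂ =>
      simp only [add_tensorHom, tensorHom_add, Preadditive.add_comp, Preadditive.comp_add, h₁, h₂]
    | smul r f h =>
      simp only [tensorHom_smul, smul_tensorHom, Linear.smul_comp, Linear.comp_smul, h]
    | of π =>
      rw [id_eq_of, tensorHom_of, tensorHom_of]
      refine of_perm_comp _ _ _ _ fun x y => ?_
      erw [col_juxt, col_juxt]
      rw [and_comm]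
      refine and_congr (iff_of_eq (congrArg₂ _ ?_ ?_)) (iff_of_eq (congrArg₂ _ ?_ ?_))
      all_goals
        funext i
        simp [-Fin.natAdd_eq_addNat, finAddFlip_symm']
  hexagon_forward X Y Z := by
    rw [associator_hom, associator_hom, associator_hom]
    show _ ≫ of (perm finAddFlip) ≫ _ =
      tensorHom (of (X := tensorObj X Y) (Y := tensorObj Y X) (perm finAddFlip)) (𝟙 Z) ≫ _ ≫
        tensorHom (𝟙 Y) (of (X := tensorObj X Z) (Y := tensorObj Z X) (perm finAddFlip))
    rw [id_eq_of, id_eq_of, tensorHom_of, tensorHom_of, juxt_perm, juxt_perm]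
    erw [perm_comp_perm, perm_comp_perm, perm_comp_perm, perm_comp_perm]
    congr 2
    refine Equiv.ext fun i => ?_
    have hi := i.isLt
    refine Fin.ext ?_
    simp only [Equiv.trans_apply, finCongr_apply, Fin.val_cast]
    erw [val_sumPerm_right, val_flip]
    simp only [Fin.val_cast]
    erw [val_sumPerm_left]
    dsimp only at hi ⊢
    split_ifs <;> omega
  hexagon_reverse X Y Z := by
    rw [associator_inv, associator_inv, associator_inv]
    show _ ≫ of (perm finAddFlip) ≫ _ =
      tensorHom (𝟙 X) (of (X := tensorObj Y Z) (Y := tensorObj Z Y) (perm finAddFlip)) ≫ _ ≫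
        tensorHom (of (X := tensorObj X Z) (Y := tensorObj Z X) (perm finAddFlip)) (𝟙 Y)
    rw [id_eq_of, id_eq_of, tensorHom_of, tensorHom_of, juxt_perm, juxt_perm]
    erw [perm_comp_perm, perm_comp_perm, perm_comp_perm, perm_comp_perm]
    congr 2
    refine Equiv.ext fun i => ?_
    have hi := i.isLt
    refine Fin.ext ?_
    simp only [Equiv.trans_apply, finCongr_apply, Fin.val_cast]
    erw [val_sumPerm_left, val_flip]
    simp only [Fin.val_cast]
    erw [val_sumPerm_right]
    dsimp only at hi ⊢
    split_ifs <;> omega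
  symmetry X Y := by
    show (of (perm finAddFlip) : tensorObj X Y ⟶ tensorObj Y X) ≫
      (of (perm finAddFlip) : tensorObj Y X ⟶ tensorObj X Y) = _
    rw [perm_comp_perm, id_eq_of]
    congr 2
    exact Equiv.ext fun i => (Equiv.symm_apply_apply (finAddFlip (m := X.n) (n := Y.n)) i)

theorem append3_iff {n : ℕ} (y : Fin (n + (n + n)) → Bool) (w : Fin n → Bool) :
    y = Fin.append w (Fin.append w w) ↔ y ∘ Fin.castAdd (n + n) = w ∧
      (y ∘ Fin.natAdd n) ∘ Fin.castAdd n = w ∧ (y ∘ Fin.natAdd n) ∘ Fin.natAdd n = w := by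
  constructor
  · rintro rfl
    refine ⟨?_, ?_, ?_⟩ <;> funext i <;> simp [-Fin.natAdd_eq_addNat]
  · rintro ⟨h1, h2, h3⟩
    funext i
    induction i using Fin.addCases with
    | left i => simpa using congrFun h1 i
    | right i =>
      induction i using Fin.addCases with
      | left i => simpa [-Fin.natAdd_eq_addNat] using congrFun h2 i
      | right i => simpa [-Fin.natAdd_eq_addNat] using congrFun h3 i

theorem append3_iff' {n : ℕ} (y : Fin (n + n + n) → Bool) (w : Fin n → Bool) :
    y = Fin.append (Fin.append w w) w ↔ (y ∘ Fin.castAdd n) ∘ Fin.castAdd n = w ∧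
      (y ∘ Fin.castAdd n) ∘ Fin.natAdd n = w ∧ y ∘ Fin.natAdd (n + n) = w := by
  constructor
  · rintro rfl
    refine ⟨?_, ?_, ?_⟩ <;> funext i <;> simp [-Fin.natAdd_eq_addNat]
  · rintro ⟨h1, h2, h3⟩
    funext i
    induction i using Fin.addCases with
    | right i => simpa [-Fin.natAdd_eq_addNat] using congrFun h3 i
    | left i =>
      induction i using Fin.addCases with
      | left i => simpa [-Fin.natAdd_eq_addNat] using congrFun h1 i
      | right i => simpa [-Fin.natAdd_eq_addNat] using congrFun h2 i

theorem zigzag_left (n : ℕ) :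
    loops (juxt (perm (Equiv.refl (Fin n))) (cup n))
        (stack (perm (finCongr (Nat.add_assoc n n n).symm))
          (juxt (cap n) (perm (Equiv.refl (Fin n))))) = 0 ∧
      stack (juxt (perm (Equiv.refl (Fin n))) (cup n))
        (stack (perm (finCongr (Nat.add_assoc n n n).symm))
          (juxt (cap n) (perm (Equiv.refl (Fin n))))) =
        perm (finCongr ((Nat.add_zero n).trans (Nat.zero_add n).symm)) := by
  refine zigzag_aux _ _ _ (fun x _ => Fin.append (x ∘ Fin.castAdd 0)
    (Fin.append (x ∘ Fin.castAdd 0) (x ∘ Fin.castAdd 0))) fun x y z => ?_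
  rw [col_juxt, col_perm, col_cup, col_perm_stack, col_juxt, col_perm, col_cap, col_perm,
    append3_iff]
  set y₁ := y ∘ Fin.castAdd (n + n) with h₁
  set y₂ := (y ∘ Fin.natAdd n) ∘ Fin.castAdd n with h₂
  set y₃ := (y ∘ Fin.natAdd n) ∘ Fin.natAdd n with h₃
  have k₁ : ((y ∘ (finCongr (Nat.add_assoc n n n).symm).symm) ∘ Fin.castAdd n) ∘ Fin.castAdd n
      = y₁ := by
    funext i; exact congrArg y (Fin.ext (by simp))
  have k₂ : ((y ∘ (finCongr (Nat.add_assoc n n n).symm).symm) ∘ Fin.castAdd n) ∘ Fin.natAdd n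
      = y₂ := by
    funext i; exact congrArg y (Fin.ext (by simp <;> omega))
  have k₃ : (y ∘ (finCongr (Nat.add_assoc n n n).symm).symm) ∘ Fin.natAdd (n + n)
      = y₃ := by
    funext i; exact congrArg y (Fin.ext (by simp <;> omega))
  have k₄ : x = z ∘ finCongr ((Nat.add_zero n).trans (Nat.zero_add n).symm) ↔
      x ∘ Fin.castAdd 0 = z ∘ Fin.natAdd 0 := by
    have : (z ∘ finCongr ((Nat.add_zero n).trans (Nat.zero_add n).symm)) ∘ Fin.castAdd 0 =
        z ∘ Fin.natAdd 0 := by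
      funext i; exact congrArg z (Fin.ext (by simp))
    rw [← this]
    exact ⟨fun h => by rw [h], fun h => h⟩
  rw [k₁, k₂, k₃, k₄]
  simp only [Equiv.coe_refl, Function.comp_id]
  constructor
  · rintro ⟨⟨h1, h2⟩, h3, h4⟩
    exact ⟨by rw [h1, h3, h2, h4], h1.symm, by rw [h1, h3], by rw [h1, h3, h2]⟩
  · rintro ⟨h1, h2, h3, h4⟩
    exact ⟨⟨h2.symm, by rw [h3, h4]⟩, by rw [h2, h3], by rw [h4, h1]⟩

theorem zigzag_right (n : ℕ) :
    loops (juxt (cup n) (perm (Equiv.refl (Fin n))))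
        (stack (perm (finCongr (Nat.add_assoc n n n)))
          (juxt (perm (Equiv.refl (Fin n))) (cap n))) = 0 ∧
      stack (juxt (cup n) (perm (Equiv.refl (Fin n))))
        (stack (perm (finCongr (Nat.add_assoc n n n)))
          (juxt (perm (Equiv.refl (Fin n))) (cap n))) =
        perm (finCongr ((Nat.zero_add n).trans (Nat.add_zero n).symm)) := by
  refine zigzag_aux _ _ _ (fun x _ => Fin.append
    (Fin.append (x ∘ Fin.natAdd 0) (x ∘ Fin.natAdd 0)) (x ∘ Fin.natAdd 0)) fun x y z => ?_
  rw [col_juxt, col_perm, col_cup, col_perm_stack, col_juxt, col_perm, col_cap, col_perm,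
    append3_iff']
  set y₁ := (y ∘ Fin.castAdd n) ∘ Fin.castAdd n with h₁
  set y₂ := (y ∘ Fin.castAdd n) ∘ Fin.natAdd n with h₂
  set y₃ := y ∘ Fin.natAdd (n + n) with h₃
  have k₁ : (y ∘ (finCongr (Nat.add_assoc n n n)).symm) ∘ Fin.castAdd (n + n) = y₁ := by
    funext i; exact congrArg y (Fin.ext (by simp))
  have k₂ : ((y ∘ (finCongr (Nat.add_assoc n n n)).symm) ∘ Fin.natAdd n) ∘ Fin.castAdd n
      = y₂ := by
    funext i; exact congrArg y (Fin.ext (by simp <;> omega))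
  have k₃ : ((y ∘ (finCongr (Nat.add_assoc n n n)).symm) ∘ Fin.natAdd n) ∘ Fin.natAdd n
      = y₃ := by
    funext i; exact congrArg y (Fin.ext (by simp <;> omega))
  have k₄ : x = z ∘ finCongr ((Nat.zero_add n).trans (Nat.add_zero n).symm) ↔
      x ∘ Fin.natAdd 0 = z ∘ Fin.castAdd 0 := by
    constructor
    · rintro rfl
      funext i; exact congrArg z (Fin.ext (by simp))
    · intro h
      funext i
      have := congrFun h (Fin.cast (Nat.zero_add n) i)
      refine Eq.trans (congrArg x (Fin.ext (by simp))) (this.trans (congrArg z (Fin.ext ?_)))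
      simp
  rw [k₁, k₂, k₃, k₄]
  simp only [Equiv.coe_refl, Function.comp_id]
  constructor
  · rintro ⟨⟨h1, h2⟩, h3, h4⟩
    exact ⟨by rw [h2, ← h4, ← h1, h3], by rw [h1, h4, h2], by rw [h4, h2], h2.symm⟩
  · rintro ⟨h1, h2, h3, h4⟩
    exact ⟨⟨by rw [h2, h3], h4.symm⟩, by rw [h2, h1], by rw [h3, h4]⟩

/-- The coevaluation `𝟙 ⟶ [n] ⊗ [n]`. -/
noncomputable def coev (X : Rep₀ F t) : 𝟙_ (Rep₀ F t) ⟶ X ⊗ X :=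
  of (X := ⟨0⟩) (Y := tensorObj X X) (cup X.n)

/-- The evaluation `[n] ⊗ [n] ⟶ 𝟙`. -/
noncomputable def ev (X : Rep₀ F t) : X ⊗ X ⟶ 𝟙_ (Rep₀ F t) :=
  of (X := tensorObj X X) (Y := ⟨0⟩) (cap X.n)

theorem leftUnitor_eq (X : Rep₀ F t) : λ_ X = eqToIso (unit_tensorObj X) := rfl

theorem rightUnitor_eq (X : Rep₀ F t) : ρ_ X = eqToIso (tensorObj_unit X) := rfl

/-- Every object is its own dual. -/
noncomputable instance exactPairing (X : Rep₀ F t) : ExactPairing X X where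
  coevaluation' := coev X
  evaluation' := ev X
  coevaluation_evaluation' := by
    rw [associator_inv, rightUnitor_eq, leftUnitor_eq]
    show tensorHom (𝟙 X) (of (X := ⟨0⟩) (Y := tensorObj X X) (cup X.n)) ≫ _ ≫
      tensorHom (of (X := tensorObj X X) (Y := ⟨0⟩) (cap X.n)) (𝟙 X) =
        eqToHom (tensorObj_unit X) ≫ eqToHom (unit_tensorObj X).symm
    rw [id_eq_of, tensorHom_of, tensorHom_of, eqToHom_trans, eqToHom_eq]
    erw [of_comp_of]
    rw [loops_perm_left, pow_zero, one_smul]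
    have h := zigzag_left X.n
    erw [of_comp_of]
    erw [h.1, h.2]
    rw [pow_zero, one_smul]
  evaluation_coevaluation' := by
    rw [associator_hom, rightUnitor_eq, leftUnitor_eq]
    show tensorHom (of (X := ⟨0⟩) (Y := tensorObj X X) (cup X.n)) (𝟙 X) ≫ _ ≫
      tensorHom (𝟙 X) (of (X := tensorObj X X) (Y := ⟨0⟩) (cap X.n)) =
        eqToHom (unit_tensorObj X) ≫ eqToHom (tensorObj_unit X).symm
    rw [id_eq_of, tensorHom_of, tensorHom_of, eqToHom_trans, eqToHom_eq]
    erw [of_comp_of]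
    rw [loops_perm_left, pow_zero, one_smul]
    have h := zigzag_right X.n
    erw [of_comp_of]
    erw [h.1, h.2]
    rw [pow_zero, one_smul]

noncomputable instance : RightRigidCategory (Rep₀ F t) where
  rightDual X := { rightDual := X }

end Rep₀

/-- A ribbon category: a braided tensor category with duality (with evaluation
`V* ⊗ V ⟶ 𝟙` and coevaluation `𝟙 ⟶ V ⊗ V*`) and a twist. -/
class RibbonCategory (C : Type*) [Category* C] [MonoidalCategory C] [BraidedCategory C]
    [RightRigidCategory C] where
  /-- the twist -/
  twist (V : C) : V ≅ V
  twist_naturality {V W : C} (f : V ⟶ W) : f ≫ (twist W).hom = (twist V).hom ≫ f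
  twist_tensor (V W : C) : (twist (V ⊗ W)).hom =
    (β_ V W).hom ≫ (β_ W V).hom ≫ ((twist V).hom ⊗ₘ (twist W).hom)
  twist_dual (V : C) : (twist (Vᘁ)).hom = ((twist V).hom)ᘁ

namespace RibbonCategory

section

variable {C : Type*} [Category* C] [MonoidalCategory C] [BraidedCategory C]
  [RightRigidCategory C] [RibbonCategory C]

/-- `coev'_V = (Id ⊗ θ_V) ∘ c_{V,V*} ∘ coev_V`. -/
noncomputable def coev' (V : C) : 𝟙_ C ⟶ Vᘁ ⊗ V :=
  η_ V (Vᘁ) ≫ (β_ V (Vᘁ)).hom ≫ (Vᘁ : C) ◁ (twist V).hom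

/-- `ev'_V = ev_V ∘ c_{V,V*} ∘ (θ_V ⊗ Id)`. -/
noncomputable def ev' (V : C) : V ⊗ Vᘁ ⟶ 𝟙_ C :=
  (twist V).hom ▷ (Vᘁ : C) ≫ (β_ V (Vᘁ)).hom ≫ ε_ V (Vᘁ)

/-- The left partial trace
`(ev_V ⊗ Id_W) ∘ (Id_{V*} ⊗ f) ∘ (coev'_V ⊗ Id_W)` of an endomorphism of `V ⊗ W`. -/
noncomputable def trL {V W : C} (f : V ⊗ W ⟶ V ⊗ W) : W ⟶ W :=
  (λ_ W).inv ≫ coev' V ▷ W ≫ (α_ (Vᘁ) V W).hom ≫ (Vᘁ : C) ◁ f ≫ (α_ (Vᘁ) V W).inv ≫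
    ε_ V (Vᘁ) ▷ W ≫ (λ_ W).hom

/-- The right partial trace
`(Id_V ⊗ ev'_W) ∘ (f ⊗ Id_{W*}) ∘ (Id_V ⊗ coev_W)` of an endomorphism of `V ⊗ W`. -/
noncomputable def trR {V W : C} (f : V ⊗ W ⟶ V ⊗ W) : V ⟶ V :=
  (ρ_ V).inv ≫ V ◁ η_ W (Wᘁ) ≫ (α_ V W (Wᘁ)).inv ≫ f ▷ (Wᘁ : C) ≫ (α_ V W (Wᘁ)).hom ≫
    V ◁ ev' W ≫ (ρ_ V).hom

/-- A linear functional `τ` on `End(J)` is an ambidextrous trace on `J` if it takes the same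
value on the left and the right partial trace of each endomorphism of `J ⊗ J`. -/
def IsAmbidextrousTrace {F : Type*} [Field F] [Preadditive C] [Linear F C] {J : C}
    (τ : (J ⟶ J) →ₗ[F] F) : Prop :=
  ∀ h : J ⊗ J ⟶ J ⊗ J, τ (trL h) = τ (trR h)

end

section

variable {C : Type*} [Category* C] [MonoidalCategory C]

/-- The dual morphism is characterized by its evaluation. -/
theorem eq_rightAdjointMate {X Y : C} [HasRightDual X] [HasRightDual Y] (f : X ⟶ Y)
    (g : Yᘁ ⟶ Xᘁ) (h : g ▷ X ≫ ε_ X (Xᘁ) = (Yᘁ : C) ◁ f ≫ ε_ Y (Yᘁ)) : g = fᘁ := by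
  have h' := h.trans (rightAdjointMate_comp_evaluation f).symm
  have key : ∀ k : (Yᘁ : C) ⟶ Xᘁ, k = 𝟙 _ ⊗≫ (Yᘁ : C) ◁ η_ X (Xᘁ) ⊗≫
      (k ▷ X ≫ ε_ X (Xᘁ)) ▷ (Xᘁ : C) ⊗≫ 𝟙 _ := by
    intro k
    symm
    calc
      _ = 𝟙 _ ⊗≫ ((Yᘁ : C) ◁ η_ X (Xᘁ) ≫ k ▷ (X ⊗ Xᘁ)) ⊗≫ ε_ X (Xᘁ) ▷ (Xᘁ : C) ⊗≫ 𝟙 _ := by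
        monoidal
      _ = k ⊗≫ ((Xᘁ : C) ◁ η_ X (Xᘁ) ⊗≫ ε_ X (Xᘁ) ▷ (Xᘁ : C)) ⊗≫ 𝟙 _ := by
        rw [whisker_exchange]; monoidal
      _ = k := by
        rw [ExactPairing.coevaluation_evaluation'']; monoidal
  rw [key g, key (fᘁ), h']

end

end RibbonCategory

namespace Rep₀

variable {F : Type u} [Field F] {t : F}

/-- The twist is the identity. -/
noncomputable instance : RibbonCategory (Rep₀ F t) where
  twist X := Iso.refl X
  twist_naturality f := by simp
  twist_tensor X Y := by simp
  twist_dual X := by simp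

end Rep₀

/-- The graded category before taking envelopes: the objects are the pairs `[a, b]` of natural
numbers. The parameter `q` only enters the braiding and the twist. -/
@[ext]
structure GrRep₀ (F : Type u) [Field F] (t : F) (q : Fˣ) where
  /-- the first entry -/
  a : ℕ
  /-- the second entry -/
  b : ℕ

namespace GrRep₀

variable {F : Type u} [Field F] {t : F} {q : Fˣ}

/-- The degree of `[a, b]` is `a - b`. -/
def deg (X : GrRep₀ F t q) : ℤ := (X.a : ℤ) - X.b

/-- The underlying object `[a + b]` of Deligne's category. -/
abbrev und (X : GrRep₀ F t q) : Rep₀ F t := ⟨X.a + X.b⟩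

/-- The morphisms `[a, b] ⟶ [c, d]`: all of `FP_{a+b,c+d}` if the degrees agree, and zero
otherwise. -/
noncomputable def homs (X Y : GrRep₀ F t q) : Submodule F (X.und ⟶ Y.und) :=
  if X.deg = Y.deg then ⊤ else ⊥

theorem mem_homs {X Y : GrRep₀ F t q} {f : X.und ⟶ Y.und} :
    f ∈ homs X Y ↔ (X.deg ≠ Y.deg → f = 0) := by
  unfold homs
  split_ifs with h <;> simp [h]

theorem mem_homs_of_deg {X Y : GrRep₀ F t q} (h : X.deg = Y.deg) (f : X.und ⟶ Y.und) :
    f ∈ homs X Y := mem_homs.2 fun h' => absurd h h'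

noncomputable instance : Category (GrRep₀ F t q) where
  Hom X Y := homs X Y
  id X := ⟨𝟙 X.und, mem_homs_of_deg rfl _⟩
  comp {X Y Z} f g := ⟨f.1 ≫ g.1, mem_homs.2 fun h => by
    by_cases hXY : X.deg = Y.deg
    · rw [mem_homs.1 g.2 (hXY ▸ h), Limits.comp_zero]
    · rw [mem_homs.1 f.2 hXY, Limits.zero_comp]⟩
  id_comp f := Subtype.ext (Category.id_comp _)
  comp_id f := Subtype.ext (Category.comp_id _)
  assoc f g h := Subtype.ext (Category.assoc _ _ _)

noncomputable instance : Preadditive (GrRep₀ F t q) where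
  homGroup X Y := inferInstanceAs (AddCommGroup (homs X Y))
  add_comp _ _ _ _ _ _ := Subtype.ext (Preadditive.add_comp _ _ _ _ _ _)
  comp_add _ _ _ _ _ _ := Subtype.ext (Preadditive.comp_add _ _ _ _ _ _)

noncomputable instance : Linear F (GrRep₀ F t q) where
  homModule X Y := inferInstanceAs (Module F (homs X Y))
  smul_comp _ _ _ _ _ _ := Subtype.ext (Linear.smul_comp _ _ _ _ _ _)
  comp_smul _ _ _ _ _ _ := Subtype.ext (Linear.comp_smul _ _ _ _ _ _)

variable (F t q) in
/-- The degrading functor `[a, b] ↦ [a + b]`, which is the identity on morphisms. -/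
noncomputable def degrade₀ : GrRep₀ F t q ⥤ Rep₀ F t where
  obj X := X.und
  map f := f.1

@[simp]
theorem degrade₀_obj (X : GrRep₀ F t q) : (degrade₀ F t q).obj X = X.und := rfl

instance : (degrade₀ F t q).Faithful where
  map_injective h := Subtype.ext h

instance : (degrade₀ F t q).Additive where

instance : (degrade₀ F t q).Linear F where

/-- Morphisms between objects of the same degree. -/
noncomputable def lift {X Y : GrRep₀ F t q} (h : X.deg = Y.deg) (f : X.und ⟶ Y.und) : X ⟶ Y :=
  ⟨f, mem_homs_of_deg h f⟩

@[simp]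
theorem map_lift {X Y : GrRep₀ F t q} (h : X.deg = Y.deg) (f : X.und ⟶ Y.und) :
    (degrade₀ F t q).map (lift h f) = f := rfl

/-- Isomorphisms between objects of the same degree. -/
@[simps]
noncomputable def liftIso {X Y : GrRep₀ F t q} (h : X.deg = Y.deg) (f : X.und ≅ Y.und) :
    X ≅ Y where
  hom := lift h f.hom
  inv := lift h.symm f.inv
  hom_inv_id := Subtype.ext f.hom_inv_id
  inv_hom_id := Subtype.ext f.inv_hom_id

/-- `[a, b] ⊗ [c, d] = [a + c, b + d]`. -/
abbrev tensorObj (X Y : GrRep₀ F t q) : GrRep₀ F t q := ⟨X.a + Y.a, X.b + Y.b⟩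

theorem deg_tensorObj (X Y : GrRep₀ F t q) : (tensorObj X Y).deg = X.deg + Y.deg := by
  simp only [deg]; push_cast; ring

theorem und_tensorObj (X Y : GrRep₀ F t q) : X.und ⊗ Y.und = (tensorObj X Y).und :=
  Rep₀.ext (show X.a + X.b + (Y.a + Y.b) = X.a + Y.a + (X.b + Y.b) by omega)

/-- The tensor product of morphisms is the one of Deligne's category, i.e. horizontal
concatenation. -/
noncomputable def tensorHom {X Y X' Y' : GrRep₀ F t q} (f : X ⟶ Y) (g : X' ⟶ Y') :
    tensorObj X X' ⟶ tensorObj Y Y' :=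
  ⟨eqToHom (und_tensorObj X X').symm ≫ (f.1 ⊗ₘ g.1) ≫ eqToHom (und_tensorObj Y Y'),
    mem_homs.2 fun h => by
      rw [deg_tensorObj, deg_tensorObj] at h
      by_cases h1 : X.deg = Y.deg
      · have h2 : X'.deg ≠ Y'.deg := fun h2 => h (by rw [h1, h2])
        rw [mem_homs.1 g.2 h2]
        simp
      · rw [mem_homs.1 f.2 h1]
        simp⟩

theorem tensorObj_assoc (X Y Z : GrRep₀ F t q) :
    tensorObj (tensorObj X Y) Z = tensorObj X (tensorObj Y Z) :=
  GrRep₀.ext (Nat.add_assoc _ _ _) (Nat.add_assoc _ _ _)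

theorem unit_tensorObj (X : GrRep₀ F t q) : tensorObj ⟨0, 0⟩ X = X :=
  GrRep₀.ext (Nat.zero_add _) (Nat.zero_add _)

theorem tensorObj_unit (X : GrRep₀ F t q) : tensorObj X ⟨0, 0⟩ = X :=
  GrRep₀.ext (Nat.add_zero _) (Nat.add_zero _)

noncomputable instance : MonoidalCategoryStruct (GrRep₀ F t q) where
  tensorObj := tensorObj
  tensorHom := tensorHom
  whiskerLeft X _ _ f := tensorHom (𝟙 X) f
  whiskerRight f X := tensorHom f (𝟙 X)
  tensorUnit := ⟨0, 0⟩
  associator X Y Z := eqToIso (tensorObj_assoc X Y Z)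
  leftUnitor X := eqToIso (unit_tensorObj X)
  rightUnitor X := eqToIso (tensorObj_unit X)

/-- The degrading functor is compatible with the (strict) tensor products. -/
noncomputable def degrade₀Data : Monoidal.InducingFunctorData (degrade₀ F t q) where
  μIso X Y := eqToIso (und_tensorObj X Y)
  εIso := Iso.refl _
  whiskerLeft_eq X _ _ f := by
    show _ ≫ (𝟙 _ ⊗ₘ f.1) ≫ _ = _ ≫ X.und ◁ f.1 ≫ _
    rw [id_tensorHom]; rfl
  whiskerRight_eq f X := by
    show _ ≫ (f.1 ⊗ₘ 𝟙 _) ≫ _ = _ ≫ f.1 ▷ X.und ≫ _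
    rw [tensorHom_id]; rfl
  tensorHom_eq f g := rfl
  associator_eq X Y Z := by
    show (degrade₀ F t q).map (eqToHom (tensorObj_assoc X Y Z)) = _
    have h : (α_ X.und Y.und Z.und) = eqToIso (Rep₀.tensorObj_assoc _ _ _) := rfl
    simp [eqToHom_map, h]
  leftUnitor_eq X := by
    show (degrade₀ F t q).map (eqToHom (unit_tensorObj X)) = _
    rw [Rep₀.leftUnitor_eq, eqToHom_map]
    simp only [Iso.trans_hom, Iso.symm_hom, tensorIso_hom, Iso.refl_hom, tensorHom_id,
      eqToIso.hom]
    erw [id_whiskerRight, Category.comp_id]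
    exact (eqToHom_trans (und_tensorObj ⟨0, 0⟩ X).symm (Rep₀.unit_tensorObj X.und)).symm
  rightUnitor_eq X := by
    show (degrade₀ F t q).map (eqToHom (tensorObj_unit X)) = _
    rw [Rep₀.rightUnitor_eq, eqToHom_map]
    simp only [Iso.trans_hom, Iso.symm_hom, tensorIso_hom, Iso.refl_hom, id_tensorHom,
      eqToIso.hom]
    erw [whiskerLeft_id, Category.comp_id]
    exact (eqToHom_trans (und_tensorObj X ⟨0, 0⟩).symm (Rep₀.tensorObj_unit X.und)).symm

noncomputable instance : MonoidalCategory (GrRep₀ F t q) :=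
  Monoidal.induced (degrade₀ F t q) degrade₀Data

noncomputable instance : (degrade₀ F t q).Monoidal :=
  Monoidal.fromInducedMonoidal (degrade₀ F t q) degrade₀Data

instance : MonoidalPreadditive (GrRep₀ F t q) :=
  monoidalPreadditive_of_faithful (degrade₀ F t q)

instance : MonoidalLinear F (GrRep₀ F t q) := MonoidalLinear.ofFaithful F (degrade₀ F t q)

theorem deg_tensor (X Y : GrRep₀ F t q) : (X ⊗ Y).deg = X.deg + Y.deg := deg_tensorObj X Y

/-- The block transposition, as a morphism of the graded category. -/
noncomputable def braid₀ (X Y : GrRep₀ F t q) : X ⊗ Y ≅ Y ⊗ X :=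
  liftIso (by rw [deg_tensor, deg_tensor, add_comm])
    (eqToIso (und_tensorObj X Y).symm ≪≫ β_ X.und Y.und ≪≫ eqToIso (und_tensorObj Y X))

/-- The symmetric braiding given by the block transpositions (not the one we are interested in
unless `q = 1`). -/
@[reducible]
noncomputable def braided₀ : BraidedCategory (GrRep₀ F t q) :=
  BraidedCategory.ofFaithful (degrade₀ F t q) braid₀ fun X Y => by
    show eqToHom (und_tensorObj X Y) ≫ (eqToHom (und_tensorObj X Y).symm ≫
      (β_ X.und Y.und).hom ≫ eqToHom (und_tensorObj Y X)) = _
    rw [eqToHom_trans_assoc, eqToHom_refl, Category.id_comp]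
    rfl

/-- A morphism between objects of different degrees vanishes. -/
theorem deg_eq_or {X Y : GrRep₀ F t q} (f : X ⟶ Y) : X.deg = Y.deg ∨ f = 0 := by
  by_cases h : X.deg = Y.deg
  · exact Or.inl h
  · exact Or.inr (Subtype.ext (mem_homs.1 f.2 h))

/-- Rescaling an isomorphism. -/
@[simps]
noncomputable def smulIso {X Y : GrRep₀ F t q} (r : Fˣ) (f : X ≅ Y) : X ≅ Y where
  hom := (r : F) • f.hom
  inv := ((r⁻¹ : Fˣ) : F) • f.inv
  hom_inv_id := by simp [Linear.smul_comp, Linear.comp_smul, smul_smul]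
  inv_hom_id := by simp [Linear.smul_comp, Linear.comp_smul, smul_smul]

/-- The braiding `c_{X,Y} = q ^ (deg X * deg Y) • β_{X,Y}`. -/
noncomputable instance : BraidedCategory (GrRep₀ F t q) where
  braiding X Y := smulIso (q ^ (X.deg * Y.deg)) (braid₀ X Y)
  braiding_naturality_right X Y Z f := by
    have h := braided₀.braiding_naturality_right X f
    change X ◁ f ≫ (braid₀ X Z).hom = (braid₀ X Y).hom ≫ f ▷ X at h
    rcases deg_eq_or f with hd | rfl
    · simp only [smulIso_hom, Linear.comp_smul, Linear.smul_comp, h, hd]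
    · simp
  braiding_naturality_left {X Y} f Z := by
    have h := braided₀.braiding_naturality_left f Z
    change f ▷ Z ≫ (braid₀ Y Z).hom = (braid₀ X Z).hom ≫ Z ◁ f at h
    rcases deg_eq_or f with hd | rfl
    · simp only [smulIso_hom, Linear.comp_smul, Linear.smul_comp, h, hd]
    · simp
  hexagon_forward X Y Z := by
    have h := braided₀.hexagon_forward X Y Z
    change _ ≫ (braid₀ _ _).hom ≫ _ = (braid₀ X Y).hom ▷ Z ≫ _ ≫ Y ◁ (braid₀ X Z).hom at h
    simp only [smulIso_hom, Linear.comp_smul, Linear.smul_comp, h, MonoidalLinear.whiskerLeft_smul,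
      MonoidalLinear.smul_whiskerRight, smul_smul, deg_tensor]
    rw [mul_add, zpow_add, mul_comm]
    push_cast
    rfl
  hexagon_reverse X Y Z := by
    have h := braided₀.hexagon_reverse X Y Z
    change _ ≫ (braid₀ _ _).hom ≫ _ = X ◁ (braid₀ Y Z).hom ≫ _ ≫ (braid₀ X Z).hom ▷ Y at h
    simp only [smulIso_hom, Linear.comp_smul, Linear.smul_comp, h, MonoidalLinear.whiskerLeft_smul,
      MonoidalLinear.smul_whiskerRight, smul_smul, deg_tensor]
    rw [add_mul, zpow_add]
    push_cast
    rfl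

/-- `[a, b]* = [b, a]`. -/
abbrev dual (X : GrRep₀ F t q) : GrRep₀ F t q := ⟨X.b, X.a⟩

theorem deg_dual (X : GrRep₀ F t q) : X.dual.deg = -X.deg := by
  simp [deg]

theorem und_dual (X : GrRep₀ F t q) : X.dual.und = X.und := Rep₀.ext (Nat.add_comm _ _)

theorem deg_unit : (𝟙_ (GrRep₀ F t q)).deg = 0 := by
  show deg ⟨0, 0⟩ = 0
  simp [deg]

/-- The evaluation `[a, b]* ⊗ [a, b] ⟶ 𝟙`, given by the evaluation diagram of `[a + b]`. -/
noncomputable def ev (X : GrRep₀ F t q) : X.dual ⊗ X ⟶ 𝟙_ (GrRep₀ F t q) :=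
  lift (by rw [deg_tensor, deg_dual, deg_unit, neg_add_cancel])
    (eqToHom (und_tensorObj X.dual X).symm ≫ eqToHom (und_dual X) ▷ X.und ≫ Rep₀.ev X.und)

/-- The coevaluation `𝟙 ⟶ [a, b] ⊗ [a, b]*`, given by the coevaluation diagram of `[a + b]`. -/
noncomputable def coev (X : GrRep₀ F t q) : 𝟙_ (GrRep₀ F t q) ⟶ X ⊗ X.dual :=
  lift (by rw [deg_tensor, deg_dual, deg_unit, add_neg_cancel])
    (Rep₀.coev X.und ≫ X.und ◁ eqToHom (und_dual X).symm ≫ eqToHom (und_tensorObj X X.dual))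

noncomputable instance (X : GrRep₀ F t q) : ExactPairing X X.dual :=
  letI : ExactPairing ((degrade₀ F t q).obj X) ((degrade₀ F t q).obj X.dual) :=
    exactPairingCongrRight (X := X.und) (eqToIso (und_dual X))
  ExactPairing.ofFaithful (degrade₀ F t q) (ev X) (coev X)
    (by
      show _ = eqToHom (und_tensorObj X.dual X).symm ≫
        (eqToHom (und_dual X) ▷ X.und ≫ Rep₀.ev X.und) ≫ 𝟙 _
      rw [Category.comp_id]; rfl)
    (by
      show _ = 𝟙 _ ≫ (Rep₀.coev X.und ≫ X.und ◁ eqToHom (und_dual X).symm) ≫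
        eqToHom (und_tensorObj X X.dual)
      rw [Category.id_comp, Category.assoc]; rfl)

noncomputable instance : RightRigidCategory (GrRep₀ F t q) where
  rightDual X := { rightDual := X.dual }

theorem deg_rightDual (X : GrRep₀ F t q) : (Xᘁ : GrRep₀ F t q).deg = -X.deg := deg_dual X

theorem braiding_hom (X Y : GrRep₀ F t q) :
    (β_ X Y).hom = ((q ^ (X.deg * Y.deg) : Fˣ) : F) • (braid₀ X Y).hom := rfl

/-- The twist is `q ^ (deg X) ^ 2`. -/
noncomputable instance : RibbonCategory (GrRep₀ F t q) where
  twist X := smulIso (q ^ (X.deg ^ 2)) (Iso.refl X)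
  twist_naturality {V W} f := by
    rcases deg_eq_or f with hd | rfl
    · simp [hd]
    · simp
  twist_tensor V W := by
    have h : (braid₀ V W).hom ≫ (braid₀ W V).hom = 𝟙 _ := by
      refine Subtype.ext ?_
      show (eqToHom (und_tensorObj V W).symm ≫ (β_ V.und W.und).hom ≫
          eqToHom (und_tensorObj W V)) ≫
        (eqToHom (und_tensorObj W V).symm ≫ (β_ W.und V.und).hom ≫
          eqToHom (und_tensorObj V W)) = 𝟙 (tensorObj V W).und
      simp
    simp only [smulIso_hom, Iso.refl_hom, braiding_hom, Linear.comp_smul, Linear.smul_comp,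
      deg_tensor, MonoidalCategory.tensorHom_def, MonoidalLinear.whiskerLeft_smul,
      MonoidalLinear.smul_whiskerRight, id_whiskerRight, whiskerLeft_id, Category.comp_id, h,
      smul_smul, ← Units.val_mul, ← zpow_add]
    congr 3
    ring
  twist_dual X := by
    refine RibbonCategory.eq_rightAdjointMate _ _ ?_
    simp only [smulIso_hom, Iso.refl_hom, Linear.smul_comp, MonoidalLinear.whiskerLeft_smul,
      MonoidalLinear.smul_whiskerRight, id_whiskerRight, whiskerLeft_id, deg_rightDual, neg_sq]

end GrRep₀

/-! ### The additive envelope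

The tensor product of two tuples of objects is the tuple of the pairwise tensor products; all
structure morphisms are given by (generalized) diagonal matrices. -/

namespace CategoryTheory.Mat_

variable {C : Type*} [Category* C] [Preadditive C]

noncomputable instance {R : Type*} [Semiring R] [Linear R C] : Linear R (Mat_ C) where
  homModule M N := inferInstanceAs (Module R (∀ i j, M.X i ⟶ N.X j))
  smul_comp M N K r f g := by
    ext i k
    show ∑ j, (r • f i j) ≫ g j k = r • ∑ j, f i j ≫ g j k
    simp only [Linear.smul_comp, Finset.smul_sum]
  comp_smul M N K f r g := by
    ext i k
    show ∑ j, f i j ≫ (r • g j k) = r • ∑ j, f i j ≫ g j k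
    simp only [Linear.comp_smul, Finset.smul_sum]

open Classical in
/-- The matrix whose only nonzero entries are `f i` at the places `(i, e i)`. -/
noncomputable def diag {M N : Mat_ C} (e : M.ι ≃ N.ι) (f : ∀ i, M.X i ⟶ N.X (e i)) : M ⟶ N :=
  fun i j => if h : e i = j then f i ≫ eqToHom (congrArg N.X h) else 0

theorem diag_self {M N : Mat_ C} (e : M.ι ≃ N.ι) (f : ∀ i, M.X i ⟶ N.X (e i)) (i : M.ι) :
    diag e f i (e i) = f i := by
  simp [diag]

theorem diag_ne {M N : Mat_ C} (e : M.ι ≃ N.ι) (f : ∀ i, M.X i ⟶ N.X (e i)) {i : M.ι} {j : N.ι}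
    (h : e i ≠ j) : diag e f i j = 0 := by
  simp [diag, h]

theorem diag_comp_apply {M N K : Mat_ C} (e : M.ι ≃ N.ι) (f : ∀ i, M.X i ⟶ N.X (e i))
    (g : N ⟶ K) (i : M.ι) (k : K.ι) : (diag e f ≫ g) i k = f i ≫ g (e i) k := by
  rw [comp_apply, Finset.sum_eq_single (e i)]
  · rw [diag_self]
  · intro j _ hj
    rw [diag_ne _ _ hj.symm, Limits.zero_comp]
  · simp

theorem comp_diag_apply {M N K : Mat_ C} (g : K ⟶ M) (e : M.ι ≃ N.ι)
    (f : ∀ i, M.X i ⟶ N.X (e i)) (k : K.ι) (i : M.ι) :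
    (g ≫ diag e f) k (e i) = g k i ≫ f i := by
  rw [comp_apply, Finset.sum_eq_single i]
  · rw [diag_self]
  · intro j _ hj
    rw [diag_ne _ _ (fun h => hj (e.injective h)), Limits.comp_zero]
  · simp

/-- Equality of morphisms can be tested on entries, up to reindexing the columns. -/
theorem ext_equiv {M N : Mat_ C} {κ : Type} (e : κ ≃ N.ι) {f g : M ⟶ N}
    (h : ∀ i k, f i (e k) = g i (e k)) : f = g := by
  ext i j
  obtain ⟨k, rfl⟩ := e.surjective j
  exact h i k

theorem diag_comp_diag {M N K : Mat_ C} (e : M.ι ≃ N.ι) (f : ∀ i, M.X i ⟶ N.X (e i))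
    (e' : N.ι ≃ K.ι) (f' : ∀ i, N.X i ⟶ K.X (e' i)) :
    diag e f ≫ diag e' f' = diag (e.trans e') (fun i => f i ≫ f' (e i)) := by
  refine ext_equiv (e.trans e') fun i j => ?_
  rw [diag_comp_apply]
  by_cases h : i = j
  · subst h
    rw [diag_self]
    exact congrArg _ (diag_self e' f' (e i))
  · rw [diag_ne (e.trans e') _ (fun h' => h ((e.trans e').injective h')), diag_ne,
      Limits.comp_zero]
    exact fun h' => h (e.injective (e'.injective h'))

theorem id_eq_diag (M : Mat_ C) : 𝟙 M = diag (Equiv.refl M.ι) (fun i => 𝟙 (M.X i)) := by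
  ext i j
  by_cases h : i = j
  · subst h
    rw [id_apply_self]
    exact (diag_self (Equiv.refl M.ι) (fun i => 𝟙 (M.X i)) i).symm
  · rw [id_apply_of_ne _ _ _ h]
    exact (diag_ne (Equiv.refl M.ι) (fun i => 𝟙 (M.X i)) h).symm

theorem diag_congr {M N : Mat_ C} {e e' : M.ι ≃ N.ι} {f : ∀ i, M.X i ⟶ N.X (e i)}
    {f' : ∀ i, M.X i ⟶ N.X (e' i)} (he : e = e')
    (h : ∀ i, f i ≫ eqToHom (by rw [he]) = f' i) : diag e f = diag e' f' := by
  subst he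
  congr 1
  funext i
  simpa using h i

open Classical in
/-- The matrix whose only nonzero entries are `g i` at the places `(e i, i)`. -/
noncomputable def codiag {M N : Mat_ C} (e : M.ι ≃ N.ι) (g : ∀ i, N.X (e i) ⟶ M.X i) : N ⟶ M :=
  fun j i => if h : e i = j then eqToHom (congrArg N.X h.symm) ≫ g i else 0

theorem codiag_self {M N : Mat_ C} (e : M.ι ≃ N.ι) (g : ∀ i, N.X (e i) ⟶ M.X i) (i : M.ι) :
    codiag e g (e i) i = g i := by
  simp [codiag]

theorem codiag_ne {M N : Mat_ C} (e : M.ι ≃ N.ι) (g : ∀ i, N.X (e i) ⟶ M.X i) {i : M.ι}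
    {j : N.ι} (h : e i ≠ j) : codiag e g j i = 0 := by
  simp [codiag, h]

theorem comp_codiag_apply {M N K : Mat_ C} (f : K ⟶ N) (e : M.ι ≃ N.ι)
    (g : ∀ i, N.X (e i) ⟶ M.X i) (k : K.ι) (i : M.ι) :
    (f ≫ codiag e g) k i = f k (e i) ≫ g i := by
  rw [comp_apply, Finset.sum_eq_single (e i)]
  · rw [codiag_self]
  · intro j _ hj
    rw [codiag_ne _ _ hj.symm, Limits.comp_zero]
  · simp

theorem codiag_comp_apply {M N K : Mat_ C} (e : M.ι ≃ N.ι) (g : ∀ i, N.X (e i) ⟶ M.X i)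
    (f : M ⟶ K) (i : M.ι) (k : K.ι) : (codiag e g ≫ f) (e i) k = g i ≫ f i k := by
  rw [comp_apply, Finset.sum_eq_single i]
  · rw [codiag_self]
  · intro j _ hj
    rw [codiag_ne _ _ (fun h => hj (e.injective h)), Limits.zero_comp]
  · simp

/-- The isomorphism given by a generalized diagonal matrix of isomorphisms. -/
noncomputable def diagIso {M N : Mat_ C} (e : M.ι ≃ N.ι) (f : ∀ i, M.X i ≅ N.X (e i)) :
    M ≅ N where
  hom := diag e (fun i => (f i).hom)
  inv := codiag e (fun i => (f i).inv)
  hom_inv_id := by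
    ext i j
    rw [diag_comp_apply]
    by_cases h : i = j
    · subst h
      rw [codiag_self, Iso.hom_inv_id, id_apply_self]
    · rw [codiag_ne _ _ (fun h' => h (e.injective h').symm), Limits.comp_zero,
        id_apply_of_ne _ _ _ h]
  inv_hom_id := by
    ext i j
    obtain ⟨i, rfl⟩ := e.surjective i
    rw [codiag_comp_apply]
    by_cases h : e i = j
    · subst h
      rw [diag_self, Iso.inv_hom_id, id_apply_self]
    · rw [diag_ne _ _ h, Limits.comp_zero, id_apply_of_ne _ _ _ h]

section Monoidal

variable [MonoidalCategory C]

/-- The tuple of the pairwise tensor products. -/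
abbrev tensorObj (M N : Mat_ C) : Mat_ C := ⟨M.ι × N.ι, fun p => M.X p.1 ⊗ N.X p.2⟩

/-- The Kronecker product of matrices of morphisms. -/
def tensorHom {M N M' N' : Mat_ C} (f : M ⟶ N) (g : M' ⟶ N') : tensorObj M M' ⟶ tensorObj N N' :=
  fun p r => f p.1 r.1 ⊗ₘ g p.2 r.2

theorem tensorHom_apply {M N M' N' : Mat_ C} (f : M ⟶ N) (g : M' ⟶ N') (p r) :
    tensorHom f g p r = f p.1 r.1 ⊗ₘ g p.2 r.2 := rfl

variable [MonoidalPreadditive C]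

theorem tensorHom_diag {M N M' N' : Mat_ C} (e : M.ι ≃ N.ι) (f : ∀ i, M.X i ⟶ N.X (e i))
    (e' : M'.ι ≃ N'.ι) (f' : ∀ i, M'.X i ⟶ N'.X (e' i)) :
    tensorHom (diag e f) (diag e' f') =
      diag (M := tensorObj M M') (N := tensorObj N N') (e.prodCongr e')
        (fun p => f p.1 ⊗ₘ f' p.2) := by
  refine ext_equiv (N := tensorObj N N') (e.prodCongr e') ?_
  rintro ⟨i, i'⟩ ⟨j, j'⟩
  rw [tensorHom_apply]
  by_cases h : i = j
  · by_cases h' : i' = j'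
    · subst h h'
      refine Eq.trans ?_ (diag_self (M := tensorObj M M') (N := tensorObj N N')
        (e.prodCongr e') (fun p => f p.1 ⊗ₘ f' p.2) (i, i')).symm
      exact congrArg₂ _ (diag_self e f i) (diag_self e' f' i')
    · rw [diag_ne (M := tensorObj M M')]
      · have := diag_ne e' f' (i := i') (j := e' j') (fun h => h' (e'.injective h))
        show _ ⊗ₘ diag e' f' i' (e' j') = 0
        rw [this]; simp
      · exact fun H => h' (e'.injective (Prod.ext_iff.1 H).2)
  · rw [diag_ne (M := tensorObj M M')]
    · have := diag_ne e f (i := i) (j := e j) (fun h' => h (e.injective h'))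
      show diag e f i (e j) ⊗ₘ _ = 0
      rw [this]; simp
    · exact fun H => h (e.injective (Prod.ext_iff.1 H).1)

theorem id_tensorHom_id (M N : Mat_ C) : tensorHom (𝟙 M) (𝟙 N) = 𝟙 (tensorObj M N) := by
  ext ⟨i, i'⟩ ⟨j, j'⟩
  rw [tensorHom_apply]
  by_cases h : i = j
  · subst h
    by_cases h' : i' = j'
    · subst h'
      rw [id_apply_self, id_apply_self, id_apply_self, MonoidalCategory.id_tensorHom_id]
    · rw [id_apply_of_ne N _ _ h', id_apply_of_ne (tensorObj M N) (i, i') (i, j')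
        (fun H => h' (Prod.ext_iff.1 H).2)]
      simp
  · rw [id_apply_of_ne M _ _ h, id_apply_of_ne (tensorObj M N) (i, i') (j, j')
      (fun H => h (Prod.ext_iff.1 H).1)]
    simp

theorem id_tensorHom_diag (K : Mat_ C) {M N : Mat_ C} (e : M.ι ≃ N.ι)
    (f : ∀ i, M.X i ⟶ N.X (e i)) :
    tensorHom (𝟙 K) (diag e f) = diag (M := tensorObj K M) (N := tensorObj K N)
      ((Equiv.refl _).prodCongr e) (fun p => K.X p.1 ◁ f p.2) := by
  rw [id_eq_diag]
  refine (tensorHom_diag _ _ _ _).trans (congrArg _ ?_)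
  funext p
  exact id_tensorHom _ _

theorem diag_tensorHom_id (K : Mat_ C) {M N : Mat_ C} (e : M.ι ≃ N.ι)
    (f : ∀ i, M.X i ⟶ N.X (e i)) :
    tensorHom (diag e f) (𝟙 K) = diag (M := tensorObj M K) (N := tensorObj N K)
      (e.prodCongr (Equiv.refl _)) (fun p => f p.1 ▷ K.X p.2) := by
  rw [id_eq_diag]
  refine (tensorHom_diag _ _ _ _).trans (congrArg _ ?_)
  funext p
  exact tensorHom_id _ _

theorem tensorHom_comp {M N K M' N' K' : Mat_ C} (f : M ⟶ N) (f' : M' ⟶ N') (g : N ⟶ K)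
    (g' : N' ⟶ K') : tensorHom f f' ≫ tensorHom g g' = tensorHom (f ≫ g) (f' ≫ g') := by
  ext p r
  rw [comp_apply, tensorHom_apply, comp_apply, comp_apply, sum_tensor]
  simp only [tensor_sum]
  rw [Fintype.sum_prod_type]
  refine Finset.sum_congr rfl fun j _ => Finset.sum_congr rfl fun j' _ => ?_
  simp [tensorHom_apply]

noncomputable instance : MonoidalCategoryStruct (Mat_ C) where
  tensorObj := tensorObj
  tensorHom := tensorHom
  whiskerLeft M _ _ f := tensorHom (𝟙 M) f
  whiskerRight f M := tensorHom f (𝟙 M)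
  tensorUnit := ⟨PUnit, fun _ => 𝟙_ C⟩
  associator M N K := diagIso (M := tensorObj (tensorObj M N) K) (N := tensorObj M (tensorObj N K))
    (Equiv.prodAssoc _ _ _) (fun p => α_ (M.X p.1.1) (N.X p.1.2) (K.X p.2))
  leftUnitor M := diagIso (M := tensorObj ⟨PUnit, fun _ => 𝟙_ C⟩ M) (N := M)
    (Equiv.punitProd _) (fun p => λ_ (M.X p.2))
  rightUnitor M := diagIso (M := tensorObj M ⟨PUnit, fun _ => 𝟙_ C⟩) (N := M)
    (Equiv.prodPUnit _) (fun p => ρ_ (M.X p.1))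

noncomputable instance : MonoidalCategory (Mat_ C) :=
  MonoidalCategory.ofTensorHom
    (id_tensorHom_id := id_tensorHom_id)
    (tensorHom_comp_tensorHom := tensorHom_comp)
    (associator_naturality := by
      intro X₁ X₂ X₃ Y₁ Y₂ Y₃ f₁ f₂ f₃
      refine ext_equiv (N := tensorObj Y₁ (tensorObj Y₂ Y₃))
        (Equiv.prodAssoc Y₁.ι Y₂.ι Y₃.ι) ?_
      rintro p r
      refine (comp_diag_apply (M := tensorObj (tensorObj Y₁ Y₂) Y₃)
        (N := tensorObj Y₁ (tensorObj Y₂ Y₃)) _ _ _ p r).trans ?_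
      refine Eq.trans ?_ (diag_comp_apply (M := tensorObj (tensorObj X₁ X₂) X₃)
        (N := tensorObj X₁ (tensorObj X₂ X₃)) _ _ _ p _).symm
      exact MonoidalCategory.associator_naturality _ _ _)
    (leftUnitor_naturality := by
      intro X Y f
      refine ext_equiv (Equiv.punitProd Y.ι) fun p r => ?_
      refine (comp_diag_apply (M := tensorObj ⟨PUnit, fun _ => 𝟙_ C⟩ Y) (N := Y)
        _ _ _ p r).trans ?_
      refine Eq.trans ?_ (diag_comp_apply (M := tensorObj ⟨PUnit, fun _ => 𝟙_ C⟩ X) (N := X)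
        _ _ _ p _).symm
      refine Eq.trans ?_ (MonoidalCategory.leftUnitor_naturality (f p.2 r.2))
      refine congrArg (· ≫ (λ_ (Y.X r.2)).hom) ?_
      refine Eq.trans ?_ (id_tensorHom _ _)
      exact congrArg (· ⊗ₘ f p.2 r.2) (id_apply_self (⟨PUnit, fun _ => 𝟙_ C⟩ : Mat_ C) _))
    (rightUnitor_naturality := by
      intro X Y f
      refine ext_equiv (Equiv.prodPUnit Y.ι) fun p r => ?_
      refine (comp_diag_apply (M := tensorObj Y ⟨PUnit, fun _ => 𝟙_ C⟩) (N := Y)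
        _ _ _ p r).trans ?_
      refine Eq.trans ?_ (diag_comp_apply (M := tensorObj X ⟨PUnit, fun _ => 𝟙_ C⟩) (N := X)
        _ _ _ p _).symm
      refine Eq.trans ?_ (MonoidalCategory.rightUnitor_naturality (f p.1 r.1))
      refine congrArg (· ≫ (ρ_ (Y.X r.1)).hom) ?_
      refine Eq.trans ?_ (tensorHom_id _ _)
      exact congrArg (f p.1 r.1 ⊗ₘ ·) (id_apply_self (⟨PUnit, fun _ => 𝟙_ C⟩ : Mat_ C) _))
    (pentagon := by
      intro W X Y Z
      show tensorHom (diag _ _) (𝟙 Z) ≫ diag _ _ ≫ tensorHom (𝟙 W) (diag _ _) =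
        diag _ _ ≫ diag _ _
      erw [diag_tensorHom_id, id_tensorHom_diag, diag_comp_diag, diag_comp_diag, diag_comp_diag]
      refine congrArg (diag _) (funext fun i => ?_)
      exact MonoidalCategory.pentagon _ _ _ _)
    (triangle := by
      intro X Y
      show diag _ _ ≫ tensorHom (𝟙 X) (diag _ _) = tensorHom (diag _ _) (𝟙 Y)
      erw [diag_tensorHom_id, id_tensorHom_diag, diag_comp_diag]
      refine congrArg (diag _) (funext fun i => ?_)
      exact MonoidalCategory.triangle _ _)

theorem associator_inv_eq (M N K : Mat_ C) :
    (α_ M N K).inv = diag (M := tensorObj M (tensorObj N K)) (N := tensorObj (tensorObj M N) K)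
      (Equiv.prodAssoc _ _ _).symm (fun p => (α_ (M.X p.1) (N.X p.2.1) (K.X p.2.2)).inv) := by
  refine (cancel_epi (α_ M N K).hom).1 ?_
  rw [Iso.hom_inv_id]
  show _ = diag _ _ ≫ diag _ _
  erw [diag_comp_diag]
  rw [id_eq_diag]
  refine congrArg (diag _) (funext fun i => ?_)
  exact (Iso.hom_inv_id _).symm

theorem id_whiskerLeft_apply (K : Mat_ C) {M N : Mat_ C} (f : M ⟶ N) (k : K.ι) (i : M.ι)
    (j : N.ι) : (K ◁ f) (k, i) (k, j) = K.X k ◁ f i j := by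
  show (𝟙 K : K ⟶ K) k k ⊗ₘ f i j = _
  rw [id_apply_self, id_tensorHom]

theorem id_whiskerLeft_ne (K : Mat_ C) {M N : Mat_ C} (f : M ⟶ N) {k k' : K.ι} (h : k ≠ k')
    (i : M.ι) (j : N.ι) : (K ◁ f) (k, i) (k', j) = 0 := by
  show (𝟙 K : K ⟶ K) k k' ⊗ₘ f i j = _
  rw [id_apply_of_ne _ _ _ h]; simp

theorem whiskerRight_id_apply (K : Mat_ C) {M N : Mat_ C} (f : M ⟶ N) (k : K.ι) (i : M.ι)
    (j : N.ι) : (f ▷ K) (i, k) (j, k) = f i j ▷ K.X k := by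
  show f i j ⊗ₘ (𝟙 K : K ⟶ K) k k = _
  rw [id_apply_self, tensorHom_id]

theorem whiskerRight_id_ne (K : Mat_ C) {M N : Mat_ C} (f : M ⟶ N) {k k' : K.ι} (h : k ≠ k')
    (i : M.ι) (j : N.ι) : (f ▷ K) (i, k) (j, k') = 0 := by
  show f i j ⊗ₘ (𝟙 K : K ⟶ K) k k' = _
  rw [id_apply_of_ne _ _ _ h]; simp

noncomputable instance [BraidedCategory C] : BraidedCategory (Mat_ C) where
  braiding M N := diagIso (M := tensorObj M N) (N := tensorObj N M) (Equiv.prodComm _ _)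
    (fun p => β_ (M.X p.1) (N.X p.2))
  braiding_naturality_right X Y Z f := by
    refine ext_equiv (N := tensorObj Z X) (Equiv.prodComm X.ι Z.ι) ?_
    rintro p r
    refine (comp_diag_apply (M := tensorObj X Z) (N := tensorObj Z X) _ _ _ p r).trans ?_
    refine Eq.trans ?_ (diag_comp_apply (M := tensorObj X Y) (N := tensorObj Y X) _ _ _ p _).symm
    exact BraidedCategory.braiding_naturality _ _
  braiding_naturality_left {X Y} f Z := by
    refine ext_equiv (N := tensorObj Z Y) (Equiv.prodComm Y.ι Z.ι) ?_
    rintro p r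
    refine (comp_diag_apply (M := tensorObj Y Z) (N := tensorObj Z Y) _ _ _ p r).trans ?_
    refine Eq.trans ?_ (diag_comp_apply (M := tensorObj X Z) (N := tensorObj Z X) _ _ _ p _).symm
    exact BraidedCategory.braiding_naturality _ _
  hexagon_forward X Y Z := by
    show diag _ _ ≫ diag _ _ ≫ diag _ _ =
      tensorHom (diag _ _) (𝟙 Z) ≫ diag _ _ ≫ tensorHom (𝟙 Y) (diag _ _)
    erw [diag_tensorHom_id, id_tensorHom_diag, diag_comp_diag, diag_comp_diag, diag_comp_diag,
      diag_comp_diag]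
    refine congrArg (diag _) (funext fun i => ?_)
    exact BraidedCategory.hexagon_forward _ _ _
  hexagon_reverse X Y Z := by
    rw [associator_inv_eq, associator_inv_eq, associator_inv_eq]
    show diag _ _ ≫ diag _ _ ≫ diag _ _ =
      tensorHom (𝟙 X) (diag _ _) ≫ diag _ _ ≫ tensorHom (diag _ _) (𝟙 Y)
    erw [diag_tensorHom_id, id_tensorHom_diag, diag_comp_diag, diag_comp_diag, diag_comp_diag,
      diag_comp_diag]
    refine congrArg (diag _) (funext fun i => ?_)
    exact BraidedCategory.hexagon_reverse _ _ _

section Rigid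

variable [RightRigidCategory C]

/-- The dual of a tuple of objects is the tuple of the duals. -/
abbrev dual (M : Mat_ C) : Mat_ C := ⟨M.ι, fun i => (M.X i)ᘁ⟩

open Classical in
/-- The coevaluation: only the components `𝟙 ⟶ X_i ⊗ X_i*` are nonzero. -/
noncomputable def coev (M : Mat_ C) : 𝟙_ (Mat_ C) ⟶ M ⊗ M.dual :=
  fun _ p => if h : p.1 = p.2 then
    η_ (M.X p.1) ((M.X p.1)ᘁ) ≫ M.X p.1 ◁ eqToHom (congrArg M.dual.X h) else 0

open Classical in
/-- The evaluation: only the components `X_i* ⊗ X_i ⟶ 𝟙` are nonzero. -/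
noncomputable def ev (M : Mat_ C) : M.dual ⊗ M ⟶ 𝟙_ (Mat_ C) :=
  fun p _ => if h : p.1 = p.2 then
    eqToHom (congrArg M.dual.X h) ▷ M.X p.2 ≫ ε_ (M.X p.2) ((M.X p.2)ᘁ) else 0

theorem coev_self (M : Mat_ C) (u : PUnit) (i : M.ι) :
    coev M u (i, i) = η_ (M.X i) ((M.X i)ᘁ) := by
  simp [coev]

theorem coev_ne (M : Mat_ C) (u : PUnit) {i j : M.ι} (h : i ≠ j) : coev M u (i, j) = 0 := by
  simp [coev, h]

theorem ev_self (M : Mat_ C) (u : PUnit) (i : M.ι) :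
    ev M (i, i) u = ε_ (M.X i) ((M.X i)ᘁ) := by
  simp only [ev, dite_true, eqToHom_refl]
  erw [id_whiskerRight]
  exact Category.id_comp _

theorem ev_ne (M : Mat_ C) (u : PUnit) {i j : M.ι} (h : i ≠ j) : ev M (i, j) u = 0 := by
  simp [ev, h]

theorem ev_whiskerRight_self (M K : Mat_ C) (v : PUnit) (k : M.ι) (j : K.ι) :
    (ev M ▷ K) ((k, k), j) (v, j) = ε_ (M.X k) ((M.X k)ᘁ) ▷ K.X j :=
  (whiskerRight_id_apply K (ev M) j (k, k) v).trans (congrArg (· ▷ K.X j) (ev_self M v k))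

theorem ev_whiskerRight_zero (M K : Mat_ C) (v : PUnit) {k l : M.ι} {m j : K.ι}
    (h : ¬ (k = l ∧ m = j)) : (ev M ▷ K) ((k, l), m) (v, j) = 0 := by
  by_cases h₁ : m = j
  · subst h₁
    refine (whiskerRight_id_apply K (ev M) m (k, l) v).trans ?_
    refine (congrArg (· ▷ K.X m) (ev_ne M v fun h₂ => h ⟨h₂, rfl⟩)).trans ?_
    exact MonoidalPreadditive.zero_whiskerRight
  · exact whiskerRight_id_ne K (ev M) h₁ (k, l) v

theorem whiskerLeft_ev_self (M K : Mat_ C) (v : PUnit) (k : M.ι) (j : K.ι) :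
    (K ◁ ev M) (j, (k, k)) (j, v) = K.X j ◁ ε_ (M.X k) ((M.X k)ᘁ) :=
  (id_whiskerLeft_apply K (ev M) j (k, k) v).trans (congrArg (K.X j ◁ ·) (ev_self M v k))

theorem whiskerLeft_ev_zero (M K : Mat_ C) (v : PUnit) {k l : M.ι} {m j : K.ι}
    (h : ¬ (k = l ∧ m = j)) : (K ◁ ev M) (m, (k, l)) (j, v) = 0 := by
  by_cases h₁ : m = j
  · subst h₁
    refine (id_whiskerLeft_apply K (ev M) m (k, l) v).trans ?_
    refine (congrArg (K.X m ◁ ·) (ev_ne M v fun h₂ => h ⟨h₂, rfl⟩)).trans ?_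
    exact MonoidalPreadditive.whiskerLeft_zero
  · exact id_whiskerLeft_ne K (ev M) h₁ (k, l) v

theorem coev_whiskerRight_self (M K : Mat_ C) (v : PUnit) (k : M.ι) (j : K.ι) :
    (coev M ▷ K) (v, j) ((k, k), j) = η_ (M.X k) ((M.X k)ᘁ) ▷ K.X j :=
  (whiskerRight_id_apply K (coev M) j v (k, k)).trans (congrArg (· ▷ K.X j) (coev_self M v k))

theorem coev_whiskerRight_zero (M K : Mat_ C) (v : PUnit) {k l : M.ι} {m j : K.ι}
    (h : ¬ (k = l ∧ j = m)) : (coev M ▷ K) (v, j) ((k, l), m) = 0 := by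
  by_cases h₁ : j = m
  · subst h₁
    refine (whiskerRight_id_apply K (coev M) j v (k, l)).trans ?_
    refine (congrArg (· ▷ K.X j) (coev_ne M v fun h₂ => h ⟨h₂, rfl⟩)).trans ?_
    exact MonoidalPreadditive.zero_whiskerRight
  · exact whiskerRight_id_ne K (coev M) h₁ v (k, l)

theorem whiskerLeft_coev_self (M K : Mat_ C) (v : PUnit) (k : M.ι) (j : K.ι) :
    (K ◁ coev M) (j, v) (j, (k, k)) = K.X j ◁ η_ (M.X k) ((M.X k)ᘁ) :=
  (id_whiskerLeft_apply K (coev M) j v (k, k)).trans (congrArg (K.X j ◁ ·) (coev_self M v k))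

theorem whiskerLeft_coev_zero (M K : Mat_ C) (v : PUnit) {k l : M.ι} {m j : K.ι}
    (h : ¬ (k = l ∧ j = m)) : (K ◁ coev M) (j, v) (m, (k, l)) = 0 := by
  by_cases h₁ : j = m
  · subst h₁
    refine (id_whiskerLeft_apply K (coev M) j v (k, l)).trans ?_
    refine (congrArg (K.X j ◁ ·) (coev_ne M v fun h₂ => h ⟨h₂, rfl⟩)).trans ?_
    exact MonoidalPreadditive.whiskerLeft_zero
  · exact id_whiskerLeft_ne K (coev M) h₁ v (k, l)

noncomputable instance (M : Mat_ C) : ExactPairing M M.dual where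
  coevaluation' := coev M
  evaluation' := ev M
  coevaluation_evaluation' := by
    rw [associator_inv_eq]
    refine Mat_.hom_ext _ _ ?_
    rintro ⟨i, u⟩ ⟨v, j⟩
    refine Eq.trans ?_ (diag_comp_apply (M := tensorObj M.dual ⟨PUnit, fun _ => 𝟙_ C⟩)
        (N := M.dual) _ _ (λ_ M.dual).inv _ _).symm
    rw [comp_apply]
    refine (Finset.sum_congr rfl fun p _ => congrArg ((M.dual ◁ coev M) (i, u) p ≫ ·)
      (diag_comp_apply (M := tensorObj M.dual (tensorObj M M.dual))
          (N := tensorObj (tensorObj M.dual M) M.dual)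
          (Equiv.prodAssoc _ _ _).symm (fun p => (α_ (M.dual.X p.1) (M.X p.2.1)
            (M.dual.X p.2.2)).inv) (ev M ▷ M.dual) p (v, j))).trans ?_
    have zero : ∀ p : M.ι × M.ι × M.ι, ¬ (p = (i, i, i) ∧ i = j) →
        (M.dual ◁ coev M) (i, u) p ≫ (α_ (M.dual.X p.1) (M.X p.2.1) (M.dual.X p.2.2)).inv ≫
          (ev M ▷ M.dual) ((p.1, p.2.1), p.2.2) (v, j) = 0 := by
      rintro ⟨k, l, m⟩ hne
      by_cases h₁ : l = m ∧ i = k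
      · have h₂ : ¬ (k = l ∧ m = j) := by
          rintro ⟨h, h'⟩
          obtain ⟨h₃, h₄⟩ := h₁
          subst h h' h₃ h₄
          exact hne ⟨rfl, rfl⟩
        refine (congrArg (fun x => _ ≫ _ ≫ x) (ev_whiskerRight_zero M M.dual v h₂)).trans ?_
        exact (congrArg (_ ≫ ·) Limits.comp_zero).trans Limits.comp_zero
      · exact (congrArg (· ≫ _) (whiskerLeft_coev_zero M M.dual u h₁)).trans Limits.zero_comp
    by_cases h : i = j
    · subst h
      refine (Finset.sum_eq_single (i, i, i) (fun p _ hp => zero p fun h => hp h.1)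
        (fun h => absurd (Finset.mem_univ _) h)).trans ?_
      refine (congrArg₂ (fun x y => x ≫ _ ≫ y) (whiskerLeft_coev_self M M.dual u i i)
        (ev_whiskerRight_self M M.dual v i i)).trans ?_
      refine (ExactPairing.coevaluation_evaluation (M.X i) ((M.X i)ᘁ)).trans ?_
      exact congrArg (_ ≫ ·) (codiag_self (M := tensorObj ⟨PUnit, fun _ => 𝟙_ C⟩ M.dual)
        (N := M.dual) (Equiv.punitProd _) (fun p => (λ_ (M.dual.X p.2)).inv) (v, i)).symm
    · refine (Finset.sum_eq_zero fun p _ => zero p fun h' => h h'.2).trans ?_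
      refine Eq.trans ?_ (congrArg (_ ≫ ·) (codiag_ne
        (M := tensorObj ⟨PUnit, fun _ => 𝟙_ C⟩ M.dual)
        (N := M.dual) (Equiv.punitProd _) (fun p => (λ_ (M.dual.X p.2)).inv) (i := (v, j))
        (j := i) fun h' => h h'.symm).symm)
      exact Limits.comp_zero.symm
  evaluation_coevaluation' := by
    refine Mat_.hom_ext _ _ ?_
    rintro ⟨u, i⟩ ⟨j, v⟩
    refine Eq.trans ?_ (diag_comp_apply (M := tensorObj ⟨PUnit, fun _ => 𝟙_ C⟩ M)
        (N := M) _ _ (ρ_ M).inv _ _).symm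
    rw [comp_apply]
    refine (Equiv.sum_comp (Equiv.prodAssoc M.ι M.ι M.ι).symm (fun p => (coev M ▷ M) (u, i) p ≫
      ((α_ M M.dual M).hom ≫ M ◁ ev M) p (j, v))).symm.trans ?_
    refine (Finset.sum_congr rfl fun p _ => congrArg ((coev M ▷ M) (u, i)
      ((Equiv.prodAssoc M.ι M.ι M.ι).symm p) ≫ ·)
      (diag_comp_apply (M := tensorObj (tensorObj M M.dual) M)
          (N := tensorObj M (tensorObj M.dual M))
          (Equiv.prodAssoc _ _ _) (fun p => (α_ (M.X p.1.1) (M.dual.X p.1.2)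
            (M.X p.2)).hom) (M ◁ ev M) ((Equiv.prodAssoc M.ι M.ι M.ι).symm p) (j, v))).trans ?_
    have zero : ∀ p : M.ι × M.ι × M.ι, ¬ (p = (i, i, i) ∧ i = j) →
        (coev M ▷ M) (u, i) ((p.1, p.2.1), p.2.2) ≫
          (α_ (M.X p.1) (M.dual.X p.2.1) (M.X p.2.2)).hom ≫ (M ◁ ev M) p (j, v) = 0 := by
      rintro ⟨k, l, m⟩ hne
      by_cases h₁ : k = l ∧ i = m
      · have h₂ : ¬ (l = m ∧ k = j) := by
          rintro ⟨h, h'⟩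
          obtain ⟨h₃, h₄⟩ := h₁
          subst h h' h₃ h₄
          exact hne ⟨rfl, rfl⟩
        refine (congrArg (fun x => _ ≫ _ ≫ x) (whiskerLeft_ev_zero M M v h₂)).trans ?_
        exact (congrArg (_ ≫ ·) Limits.comp_zero).trans Limits.comp_zero
      · exact (congrArg (· ≫ _) (coev_whiskerRight_zero M M u h₁)).trans Limits.zero_comp
    by_cases h : i = j
    · subst h
      refine (Finset.sum_eq_single (i, i, i) (fun p _ hp => zero p fun h => hp h.1)
        (fun h => absurd (Finset.mem_univ _) h)).trans ?_
      refine (congrArg₂ (fun x y => x ≫ _ ≫ y) (coev_whiskerRight_self M M u i i)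
        (whiskerLeft_ev_self M M v i i)).trans ?_
      refine (ExactPairing.evaluation_coevaluation (M.X i) ((M.X i)ᘁ)).trans ?_
      exact congrArg (_ ≫ ·) (codiag_self (M := tensorObj M ⟨PUnit, fun _ => 𝟙_ C⟩)
        (N := M) (Equiv.prodPUnit _) (fun p => (ρ_ (M.X p.1)).inv) (i, v)).symm
    · refine (Finset.sum_eq_zero fun p _ => zero p fun h' => h h'.2).trans ?_
      refine Eq.trans ?_ (congrArg (_ ≫ ·) (codiag_ne
        (M := tensorObj M ⟨PUnit, fun _ => 𝟙_ C⟩)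
        (N := M) (Equiv.prodPUnit _) (fun p => (ρ_ (M.X p.1)).inv) (i := (j, v))
        (j := i) fun h' => h h'.symm).symm)
      exact Limits.comp_zero.symm

noncomputable instance : RightRigidCategory (Mat_ C) where
  rightDual M := { rightDual := M.dual }

end Rigid

/-- The twist is given by the diagonal matrix of the twists. -/
noncomputable instance [BraidedCategory C] [RightRigidCategory C] [RibbonCategory C] :
    RibbonCategory (Mat_ C) where
  twist M := diagIso (Equiv.refl M.ι) (fun i => RibbonCategory.twist (M.X i))
  twist_naturality {M N} f := by
    refine ext_equiv (Equiv.refl N.ι) fun i j => ?_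
    refine (comp_diag_apply f (Equiv.refl N.ι) _ i j).trans ?_
    refine Eq.trans ?_ (diag_comp_apply (N := M) _ _ _ i _).symm
    exact RibbonCategory.twist_naturality _
  twist_tensor M N := by
    show diag _ _ = diag _ _ ≫ diag _ _ ≫ tensorHom (diag _ _) (diag _ _)
    erw [tensorHom_diag, diag_comp_diag, diag_comp_diag]
    refine congrArg (diag _) (funext fun i => ?_)
    exact RibbonCategory.twist_tensor _ _
  twist_dual M := by
    refine RibbonCategory.eq_rightAdjointMate _ _ ?_
    show tensorHom (diag _ _) (𝟙 M) ≫ ev M = tensorHom (𝟙 M.dual) (diag _ _) ≫ ev M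
    erw [diag_tensorHom_id, id_tensorHom_diag]
    refine Mat_.hom_ext _ _ ?_
    rintro ⟨i, j⟩ v
    refine (diag_comp_apply (M := tensorObj M.dual M) (N := tensorObj M.dual M) _ _ (ev M)
      (i, j) v).trans ?_
    refine Eq.trans ?_ (diag_comp_apply (M := tensorObj M.dual M) (N := tensorObj M.dual M) _ _
      (ev M) (i, j) v).symm
    by_cases h : i = j
    · subst h
      refine (congrArg (_ ≫ ·) (ev_self M v i)).trans ?_
      refine Eq.trans ?_ (congrArg (_ ≫ ·) (ev_self M v i)).symm
      show (RibbonCategory.twist ((M.X i)ᘁ)).hom ▷ M.X i ≫ ε_ (M.X i) ((M.X i)ᘁ) =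
        ((M.X i)ᘁ : C) ◁ (RibbonCategory.twist (M.X i)).hom ≫ ε_ (M.X i) ((M.X i)ᘁ)
      rw [RibbonCategory.twist_dual, rightAdjointMate_comp_evaluation]
    · refine (congrArg (_ ≫ ·) (ev_ne M v h)).trans ?_
      refine Eq.trans ?_ (congrArg (_ ≫ ·) (ev_ne M v h)).symm
      exact Limits.comp_zero.trans Limits.comp_zero.symm
end Monoidal

end CategoryTheory.Mat_

/-! ### The Karoubi envelope -/

namespace CategoryTheory.Idempotents.Karoubi

noncomputable instance {C : Type*} [Category* C] [Preadditive C] {R : Type*} [CommSemiring R]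
    [Linear R C] : Linear R (Karoubi C) where
  homModule P Q :=
    { smul := fun r f => ⟨r • f.f, by rw [Linear.smul_comp, Linear.comp_smul, f.comm]⟩
      one_smul := fun f => Karoubi.hom_ext _ _ (one_smul R f.f)
      mul_smul := fun r s f => Karoubi.hom_ext _ _ (mul_smul r s f.f)
      smul_zero := fun r => Karoubi.hom_ext _ _ (smul_zero r)
      smul_add := fun r f g => Karoubi.hom_ext _ _ (smul_add r f.f g.f)
      add_smul := fun r s f => Karoubi.hom_ext _ _ (add_smul r s f.f)
      zero_smul := fun f => Karoubi.hom_ext _ _ (zero_smul R f.f) }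
  smul_comp _ _ _ r f g := Karoubi.hom_ext _ _ (Linear.smul_comp _ _ _ r f.f g.f)
  comp_smul _ _ _ f r g := Karoubi.hom_ext _ _ (Linear.comp_smul _ _ _ f.f r g.f)

variable {C : Type*} [Category* C] [MonoidalCategory C]

/-- `(X, p) ⊗ (Y, q) = (X ⊗ Y, p ⊗ q)`. -/
@[simps]
def tensorObj (P Q : Karoubi C) : Karoubi C where
  X := P.X ⊗ Q.X
  p := P.p ⊗ₘ Q.p
  idem := by rw [tensorHom_comp_tensorHom, P.idem, Q.idem]

/-- The tensor product of morphisms is the one of the underlying category. -/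
@[simps]
def tensorHom {P Q P' Q' : Karoubi C} (f : P ⟶ Q) (g : P' ⟶ Q') :
    tensorObj P P' ⟶ tensorObj Q Q' where
  f := f.f ⊗ₘ g.f
  comm := by
    show (P.p ⊗ₘ P'.p) ≫ (f.f ⊗ₘ g.f) ≫ (Q.p ⊗ₘ Q'.p) = f.f ⊗ₘ g.f
    rw [tensorHom_comp_tensorHom, tensorHom_comp_tensorHom, f.comm, g.comm]

/-- An isomorphism compatible with the idempotents. -/
@[simps]
def isoOfComm {P Q : Karoubi C} (e : P.X ≅ Q.X) (h : P.p ≫ e.hom = e.hom ≫ Q.p) : P ≅ Q where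
  hom := ⟨P.p ≫ e.hom, by
    rw [Category.assoc, ← h, P.idem_assoc, P.idem_assoc]⟩
  inv := ⟨e.inv ≫ P.p, by
    have h' : e.inv ≫ P.p = Q.p ≫ e.inv := by
      rw [Iso.inv_comp_eq, ← Category.assoc, ← h, Category.assoc, Iso.hom_inv_id, Category.comp_id]
    rw [Category.assoc, P.idem, h', ← Category.assoc, Q.idem]⟩
  hom_inv_id := by ext; simp
  inv_hom_id := by
    ext
    have h' : e.inv ≫ P.p = Q.p ≫ e.inv := by
      rw [Iso.inv_comp_eq, ← Category.assoc, ← h, Category.assoc, Iso.hom_inv_id, Category.comp_id]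
    show (e.inv ≫ P.p) ≫ P.p ≫ e.hom = Q.p
    rw [Category.assoc, P.idem_assoc, ← Category.assoc, h', Category.assoc, Iso.inv_hom_id,
      Category.comp_id]

noncomputable instance : MonoidalCategoryStruct (Karoubi C) where
  tensorObj := tensorObj
  tensorHom := tensorHom
  whiskerLeft P _ _ f := tensorHom (𝟙 P) f
  whiskerRight f P := tensorHom f (𝟙 P)
  tensorUnit := ⟨𝟙_ C, 𝟙 _, Category.id_comp _⟩
  associator P Q R := isoOfComm (P := tensorObj (tensorObj P Q) R)
    (Q := tensorObj P (tensorObj Q R)) (α_ P.X Q.X R.X) (associator_naturality _ _ _)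
  leftUnitor P := isoOfComm (P := tensorObj ⟨𝟙_ C, 𝟙 _, Category.id_comp _⟩ P) (Q := P)
    (λ_ P.X) (leftUnitor_naturality _ |> fun h => by
      show (𝟙 _ ⊗ₘ P.p) ≫ _ = _
      rw [id_tensorHom]; exact h)
  rightUnitor P := isoOfComm (P := tensorObj P ⟨𝟙_ C, 𝟙 _, Category.id_comp _⟩) (Q := P)
    (ρ_ P.X) (rightUnitor_naturality _ |> fun h => by
      show (P.p ⊗ₘ 𝟙 _) ≫ _ = _
      rw [tensorHom_id]; exact h)

@[simp] theorem tensor_X (P Q : Karoubi C) : (P ⊗ Q).X = P.X ⊗ Q.X := rfl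
@[simp] theorem tensor_p (P Q : Karoubi C) : (P ⊗ Q).p = P.p ⊗ₘ Q.p := rfl
@[simp] theorem unit_X : (𝟙_ (Karoubi C)).X = 𝟙_ C := rfl
@[simp] theorem unit_p : (𝟙_ (Karoubi C)).p = 𝟙 (𝟙_ C) := rfl
@[simp] theorem tensor_f {P Q P' Q' : Karoubi C} (f : P ⟶ Q) (g : P' ⟶ Q') :
    (f ⊗ₘ g).f = f.f ⊗ₘ g.f := rfl
@[simp] theorem whiskerLeft_f (K : Karoubi C) {P Q : Karoubi C} (f : P ⟶ Q) :
    (K ◁ f).f = K.p ⊗ₘ f.f := rfl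
@[simp] theorem whiskerRight_f (K : Karoubi C) {P Q : Karoubi C} (f : P ⟶ Q) :
    (f ▷ K).f = f.f ⊗ₘ K.p := rfl
@[simp] theorem associator_hom_f (P Q R : Karoubi C) :
    (α_ P Q R).hom.f = ((P.p ⊗ₘ Q.p) ⊗ₘ R.p) ≫ (α_ P.X Q.X R.X).hom := rfl
@[simp] theorem associator_inv_f (P Q R : Karoubi C) :
    (α_ P Q R).inv.f = (α_ P.X Q.X R.X).inv ≫ ((P.p ⊗ₘ Q.p) ⊗ₘ R.p) := rfl
@[simp] theorem leftUnitor_hom_f (P : Karoubi C) :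
    (λ_ P).hom.f = (𝟙 (𝟙_ C) ⊗ₘ P.p) ≫ (λ_ P.X).hom := rfl
@[simp] theorem leftUnitor_inv_f (P : Karoubi C) :
    (λ_ P).inv.f = (λ_ P.X).inv ≫ (𝟙 (𝟙_ C) ⊗ₘ P.p) := rfl
@[simp] theorem rightUnitor_hom_f (P : Karoubi C) :
    (ρ_ P).hom.f = (P.p ⊗ₘ 𝟙 (𝟙_ C)) ≫ (ρ_ P.X).hom := rfl
@[simp] theorem rightUnitor_inv_f (P : Karoubi C) :
    (ρ_ P).inv.f = (ρ_ P.X).inv ≫ (P.p ⊗ₘ 𝟙 (𝟙_ C)) := rfl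

noncomputable instance : MonoidalCategory (Karoubi C) :=
  MonoidalCategory.ofTensorHom
    (id_tensorHom_id := fun P Q => rfl)
    (tensorHom_comp_tensorHom := fun f g f' g' => by ext; simp)
    (associator_naturality := fun f g h => by
      ext
      simp)
    (leftUnitor_naturality := fun f => by
      ext
      simp)
    (rightUnitor_naturality := fun f => by
      ext
      simp)
    (pentagon := fun W X Y Z => by
      ext
      simp only [comp_f, tensor_f, associator_hom_f, id_f, tensor_p, tensor_X]
      have h1 : ((W.p ⊗ₘ X.p) ⊗ₘ Y.p) ≫ (α_ W.X X.X Y.X).hom ⊗ₘ Z.p =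
          (((W.p ⊗ₘ X.p) ⊗ₘ Y.p) ⊗ₘ Z.p) ≫ (α_ W.X X.X Y.X).hom ▷ Z.X := by
        rw [← tensorHom_id, tensorHom_comp_tensorHom, Category.comp_id]
      have h1' : (α_ W.X X.X Y.X).hom ▷ Z.X ≫ ((W.p ⊗ₘ X.p ⊗ₘ Y.p) ⊗ₘ Z.p) =
          (((W.p ⊗ₘ X.p) ⊗ₘ Y.p) ⊗ₘ Z.p) ≫ (α_ W.X X.X Y.X).hom ▷ Z.X := by
        rw [← tensorHom_id, tensorHom_comp_tensorHom, tensorHom_comp_tensorHom,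
          Category.comp_id, Category.id_comp, associator_naturality]
      have h2 : W.p ⊗ₘ ((X.p ⊗ₘ Y.p) ⊗ₘ Z.p) ≫ (α_ X.X Y.X Z.X).hom =
          (W.p ⊗ₘ (X.p ⊗ₘ Y.p) ⊗ₘ Z.p) ≫ W.X ◁ (α_ X.X Y.X Z.X).hom := by
        rw [← id_tensorHom, tensorHom_comp_tensorHom, Category.comp_id]
      have h3 : (α_ (W.X ⊗ X.X) Y.X Z.X).hom ≫ ((W.p ⊗ₘ X.p) ⊗ₘ Y.p ⊗ₘ Z.p) =
          (((W.p ⊗ₘ X.p) ⊗ₘ Y.p) ⊗ₘ Z.p) ≫ (α_ (W.X ⊗ X.X) Y.X Z.X).hom :=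
        (associator_naturality _ _ _).symm
      have h4 : (α_ W.X (X.X ⊗ Y.X) Z.X).hom ≫ (W.p ⊗ₘ (X.p ⊗ₘ Y.p) ⊗ₘ Z.p) =
          ((W.p ⊗ₘ X.p ⊗ₘ Y.p) ⊗ₘ Z.p) ≫ (α_ W.X (X.X ⊗ Y.X) Z.X).hom :=
        (associator_naturality _ _ _).symm
      have h5 : (((W.p ⊗ₘ X.p) ⊗ₘ Y.p) ⊗ₘ Z.p) ≫ (((W.p ⊗ₘ X.p) ⊗ₘ Y.p) ⊗ₘ Z.p) =
          (((W.p ⊗ₘ X.p) ⊗ₘ Y.p) ⊗ₘ Z.p) := by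
        simp only [tensorHom_comp_tensorHom, idem]
      rw [h1, h2]
      simp only [Category.assoc]
      rw [reassoc_of% h4, reassoc_of% h1', reassoc_of% h1', reassoc_of% h5, reassoc_of% h5,
        reassoc_of% h3, reassoc_of% h5, MonoidalCategory.pentagon])
    (triangle := fun X Y => by
      ext
      simp only [comp_f, tensor_f, associator_hom_f, id_f, tensor_X, unit_p, unit_X,
        leftUnitor_hom_f, rightUnitor_hom_f]
      have h1 : (X.p ⊗ₘ 𝟙 (𝟙_ C)) ≫ (ρ_ X.X).hom ⊗ₘ Y.p =
          ((X.p ⊗ₘ 𝟙 (𝟙_ C)) ⊗ₘ Y.p) ≫ (ρ_ X.X).hom ▷ Y.X := by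
        rw [← tensorHom_id, tensorHom_comp_tensorHom, Category.comp_id]
      have h2 : X.p ⊗ₘ (𝟙 (𝟙_ C) ⊗ₘ Y.p) ≫ (λ_ Y.X).hom =
          (X.p ⊗ₘ 𝟙 (𝟙_ C) ⊗ₘ Y.p) ≫ X.X ◁ (λ_ Y.X).hom := by
        rw [← id_tensorHom, tensorHom_comp_tensorHom, Category.comp_id]
      have h3 : (α_ X.X (𝟙_ C) Y.X).hom ≫ (X.p ⊗ₘ 𝟙 (𝟙_ C) ⊗ₘ Y.p) =
          ((X.p ⊗ₘ 𝟙 (𝟙_ C)) ⊗ₘ Y.p) ≫ (α_ X.X (𝟙_ C) Y.X).hom :=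
        (associator_naturality _ _ _).symm
      have h4 : ((X.p ⊗ₘ 𝟙 (𝟙_ C)) ⊗ₘ Y.p) ≫ ((X.p ⊗ₘ 𝟙 (𝟙_ C)) ⊗ₘ Y.p) =
          ((X.p ⊗ₘ 𝟙 (𝟙_ C)) ⊗ₘ Y.p) := by
        simp only [tensorHom_comp_tensorHom, idem, Category.comp_id]
      rw [h1, h2]
      simp only [Category.assoc]
      rw [reassoc_of% h3, reassoc_of% h4, MonoidalCategory.triangle])

/-- `f` is the cut down of a morphism `φ` of the underlying category that is compatible with the
idempotents. -/
def IsOf {P Q : Karoubi C} (f : P ⟶ Q) (φ : P.X ⟶ Q.X) : Prop :=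
  f.f = P.p ≫ φ ∧ P.p ≫ φ = φ ≫ Q.p

theorem IsOf.eq {P Q : Karoubi C} {f g : P ⟶ Q} {φ ψ : P.X ⟶ Q.X} (hf : IsOf f φ)
    (hg : IsOf g ψ) (h : φ = ψ) : f = g :=
  Karoubi.hom_ext _ _ (by rw [hf.1, hg.1, h])

theorem IsOf.comp {P Q R : Karoubi C} {f : P ⟶ Q} {g : Q ⟶ R} {φ : P.X ⟶ Q.X} {ψ : Q.X ⟶ R.X}
    (hf : IsOf f φ) (hg : IsOf g ψ) : IsOf (f ≫ g) (φ ≫ ψ) := by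
  refine ⟨?_, ?_⟩
  · rw [comp_f, hf.1, hg.1, Category.assoc, ← reassoc_of% hf.2, P.idem_assoc]
  · rw [← Category.assoc, hf.2, Category.assoc, hg.2, Category.assoc]

theorem IsOf.whiskerLeft (K : Karoubi C) {P Q : Karoubi C} {f : P ⟶ Q} {φ : P.X ⟶ Q.X}
    (hf : IsOf f φ) : IsOf (K ◁ f) (K.X ◁ φ) := by
  refine ⟨?_, ?_⟩
  · show (K.p ⊗ₘ f.f) = (K.p ⊗ₘ P.p) ≫ K.X ◁ φ
    rw [← id_tensorHom, tensorHom_comp_tensorHom, Category.comp_id, hf.1]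
  · show (K.p ⊗ₘ P.p) ≫ K.X ◁ φ = K.X ◁ φ ≫ (K.p ⊗ₘ Q.p)
    rw [← id_tensorHom, tensorHom_comp_tensorHom,
      tensorHom_comp_tensorHom, hf.2, Category.comp_id, Category.id_comp]

theorem IsOf.whiskerRight (K : Karoubi C) {P Q : Karoubi C} {f : P ⟶ Q} {φ : P.X ⟶ Q.X}
    (hf : IsOf f φ) : IsOf (f ▷ K) (φ ▷ K.X) := by
  refine ⟨?_, ?_⟩
  · show (f.f ⊗ₘ K.p) = (P.p ⊗ₘ K.p) ≫ φ ▷ K.X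
    rw [← tensorHom_id, tensorHom_comp_tensorHom, Category.comp_id, hf.1]
  · show (P.p ⊗ₘ K.p) ≫ φ ▷ K.X = φ ▷ K.X ≫ (Q.p ⊗ₘ K.p)
    rw [← tensorHom_id, tensorHom_comp_tensorHom,
      tensorHom_comp_tensorHom, hf.2, Category.comp_id, Category.id_comp]

theorem isOf_isoOfComm {P Q : Karoubi C} (e : P.X ≅ Q.X) (h : P.p ≫ e.hom = e.hom ≫ Q.p) :
    IsOf (isoOfComm e h).hom e.hom := ⟨rfl, h⟩

theorem isOf_associator_hom (P Q R : Karoubi C) :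
    IsOf (α_ P Q R).hom (α_ P.X Q.X R.X).hom := ⟨rfl, associator_naturality _ _ _⟩

theorem isOf_associator_inv (P Q R : Karoubi C) :
    IsOf (α_ P Q R).inv (α_ P.X Q.X R.X).inv :=
  ⟨(associator_inv_naturality _ _ _).symm, associator_inv_naturality _ _ _⟩

/-- The braiding is the one of the underlying category, cut down by the idempotents. -/
noncomputable instance [BraidedCategory C] : BraidedCategory (Karoubi C) where
  braiding P Q := isoOfComm (P := P ⊗ Q) (Q := Q ⊗ P) (β_ P.X Q.X)
    (BraidedCategory.braiding_naturality P.p Q.p)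
  braiding_naturality_right P Q R f := by
    ext
    show (P.p ⊗ₘ f.f) ≫ (P.p ⊗ₘ R.p) ≫ (β_ P.X R.X).hom =
      ((P.p ⊗ₘ Q.p) ≫ (β_ P.X Q.X).hom) ≫ (f.f ⊗ₘ P.p)
    rw [Category.assoc, ← BraidedCategory.braiding_naturality, tensorHom_comp_tensorHom_assoc,
      tensorHom_comp_tensorHom_assoc, comp_p, p_comp]
  braiding_naturality_left {P Q} f R := by
    ext
    show (f.f ⊗ₘ R.p) ≫ (Q.p ⊗ₘ R.p) ≫ (β_ Q.X R.X).hom =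
      ((P.p ⊗ₘ R.p) ≫ (β_ P.X R.X).hom) ≫ (R.p ⊗ₘ f.f)
    rw [Category.assoc, ← BraidedCategory.braiding_naturality, tensorHom_comp_tensorHom_assoc,
      tensorHom_comp_tensorHom_assoc, comp_p, p_comp]
  hexagon_forward P Q R :=
    ((isOf_associator_hom P Q R).comp ((isOf_isoOfComm (P := P ⊗ Q ⊗ R) (Q := (Q ⊗ R) ⊗ P) _
      _).comp (isOf_associator_hom Q R P))).eq
      (((isOf_isoOfComm (P := P ⊗ Q) (Q := Q ⊗ P) _ _).whiskerRight R).comp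
        ((isOf_associator_hom Q P R).comp
          ((isOf_isoOfComm (P := P ⊗ R) (Q := R ⊗ P) _ _).whiskerLeft Q)))
      (BraidedCategory.hexagon_forward P.X Q.X R.X)
  hexagon_reverse P Q R :=
    ((isOf_associator_inv P Q R).comp ((isOf_isoOfComm (P := (P ⊗ Q) ⊗ R) (Q := R ⊗ P ⊗ Q) _
      _).comp (isOf_associator_inv R P Q))).eq
      (((isOf_isoOfComm (P := Q ⊗ R) (Q := R ⊗ Q) _ _).whiskerLeft P).comp
        ((isOf_associator_inv P R Q).comp
          ((isOf_isoOfComm (P := P ⊗ R) (Q := R ⊗ P) _ _).whiskerRight Q)))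
      (BraidedCategory.hexagon_reverse P.X Q.X R.X)

section Rigid

variable [RightRigidCategory C]

/-- The dual of `(X, p)` is `(X*, p*)`. -/
@[simps]
noncomputable def dual (P : Karoubi C) : Karoubi C where
  X := (P.X)ᘁ
  p := (P.p)ᘁ
  idem := by rw [← comp_rightAdjointMate, P.idem]

theorem coev_aux {X : C} {p : X ⟶ X} (hp : p ≫ p = p) : η_ X (Xᘁ) ≫ (p ⊗ₘ pᘁ) =
    η_ X (Xᘁ) ≫ p ▷ Xᘁ := by
  rw [tensorHom_def', coevaluation_comp_rightAdjointMate_assoc, ← comp_whiskerRight, hp]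

theorem ev_aux {X : C} {p : X ⟶ X} (hp : p ≫ p = p) : (pᘁ ⊗ₘ p) ≫ ε_ X (Xᘁ) =
    Xᘁ ◁ p ≫ ε_ X (Xᘁ) := by
  rw [tensorHom_def', Category.assoc, rightAdjointMate_comp_evaluation,
    ← whiskerLeft_comp_assoc, hp]

theorem zigzag₁ {X : C} {p : X ⟶ X} (hp : p ≫ p = p) :
    (pᘁ ⊗ₘ η_ X (Xᘁ) ≫ (p ⊗ₘ pᘁ)) ≫ ((α_ Xᘁ X Xᘁ).inv ≫ ((pᘁ ⊗ₘ p) ⊗ₘ pᘁ)) ≫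
      ((pᘁ ⊗ₘ p) ≫ ε_ X (Xᘁ) ⊗ₘ pᘁ) =
      ((pᘁ ⊗ₘ 𝟙 _) ≫ (ρ_ _).hom) ≫ (λ_ _).inv ≫ (𝟙 _ ⊗ₘ pᘁ) := by
  have h : pᘁ ≫ pᘁ = pᘁ := by rw [← comp_rightAdjointMate, hp]
  have e1 : (pᘁ ⊗ₘ η_ X (Xᘁ) ≫ (p ⊗ₘ pᘁ)) = Xᘁ ◁ η_ X (Xᘁ) ≫ (pᘁ ⊗ₘ p ⊗ₘ pᘁ) := by
    rw [← id_tensorHom, tensorHom_comp_tensorHom, Category.id_comp]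
  have e3 : ((pᘁ ⊗ₘ p) ⊗ₘ pᘁ) ≫ ((pᘁ ⊗ₘ p) ≫ ε_ X (Xᘁ) ⊗ₘ pᘁ) =
      ((𝟙 _ ⊗ₘ p) ⊗ₘ pᘁ) ≫ ε_ X (Xᘁ) ▷ Xᘁ := by
    rw [tensorHom_comp_tensorHom, tensorHom_comp_tensorHom_assoc, hp, h, ev_aux hp,
      ← tensorHom_id, tensorHom_comp_tensorHom, Category.comp_id, id_tensorHom]
  have e5 : (pᘁ ⊗ₘ p ⊗ₘ pᘁ) ≫ (α_ Xᘁ X Xᘁ).inv = (α_ Xᘁ X Xᘁ).inv ≫ ((pᘁ ⊗ₘ p) ⊗ₘ pᘁ) :=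
    associator_inv_naturality _ _ _
  have e6 : ((pᘁ ⊗ₘ p) ⊗ₘ pᘁ) ≫ ((𝟙 _ ⊗ₘ p) ⊗ₘ pᘁ) ≫ ε_ X (Xᘁ) ▷ Xᘁ =
      ((𝟙 _ ⊗ₘ p) ⊗ₘ pᘁ) ≫ ε_ X (Xᘁ) ▷ Xᘁ := by
    rw [tensorHom_comp_tensorHom_assoc, tensorHom_comp_tensorHom, hp, h, Category.comp_id,
      ← tensorHom_id, tensorHom_comp_tensorHom, tensorHom_comp_tensorHom, ev_aux hp, id_tensorHom]
  have e7 : (𝟙 Xᘁ ⊗ₘ p ⊗ₘ pᘁ) ≫ (α_ Xᘁ X Xᘁ).inv = (α_ Xᘁ X Xᘁ).inv ≫ ((𝟙 _ ⊗ₘ p) ⊗ₘ pᘁ) :=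
    associator_inv_naturality _ _ _
  rw [e1]
  simp only [Category.assoc]
  rw [e3, reassoc_of% e5, e6, ← reassoc_of% e7, id_tensorHom, ← whiskerLeft_comp_assoc,
    coev_aux hp, ← coevaluation_comp_rightAdjointMate, whiskerLeft_comp_assoc]
  have e8 : Xᘁ ◁ X ◁ pᘁ ≫ (α_ Xᘁ X Xᘁ).inv ≫ ε_ X (Xᘁ) ▷ Xᘁ =
      (α_ Xᘁ X Xᘁ).inv ≫ ε_ X (Xᘁ) ▷ Xᘁ ≫ 𝟙_ C ◁ pᘁ := by
    rw [← whisker_exchange]; simp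
  rw [e8, ExactPairing.coevaluation_evaluation_assoc]
  simp [reassoc_of% h]

theorem zigzag₂ {X : C} {p : X ⟶ X} (hp : p ≫ p = p) :
    (η_ X (Xᘁ) ≫ (p ⊗ₘ pᘁ) ⊗ₘ p) ≫ (((p ⊗ₘ pᘁ) ⊗ₘ p) ≫ (α_ X Xᘁ X).hom) ≫
      (p ⊗ₘ (pᘁ ⊗ₘ p) ≫ ε_ X (Xᘁ)) =
      ((𝟙 _ ⊗ₘ p) ≫ (λ_ _).hom) ≫ (ρ_ _).inv ≫ (p ⊗ₘ 𝟙 _) := by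
  have h : pᘁ ≫ pᘁ = pᘁ := by rw [← comp_rightAdjointMate, hp]
  have e1 : (η_ X (Xᘁ) ≫ (p ⊗ₘ pᘁ) ⊗ₘ p) = η_ X (Xᘁ) ▷ X ≫ ((p ⊗ₘ pᘁ) ⊗ₘ p) := by
    rw [← tensorHom_id, tensorHom_comp_tensorHom, Category.id_comp]
  have e3 : (p ⊗ₘ (pᘁ ⊗ₘ p)) ≫ (p ⊗ₘ (pᘁ ⊗ₘ p) ≫ ε_ X (Xᘁ)) =
      (p ⊗ₘ (𝟙 _ ⊗ₘ p)) ≫ X ◁ ε_ X (Xᘁ) := by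
    rw [tensorHom_comp_tensorHom, tensorHom_comp_tensorHom_assoc, hp, h, ev_aux hp,
      ← id_tensorHom X, tensorHom_comp_tensorHom, Category.comp_id, id_tensorHom]
  have e5 : ((p ⊗ₘ pᘁ) ⊗ₘ p) ≫ (α_ X Xᘁ X).hom = (α_ X Xᘁ X).hom ≫ (p ⊗ₘ (pᘁ ⊗ₘ p)) :=
    associator_naturality _ _ _
  have e7 : ((p ⊗ₘ 𝟙 Xᘁ) ⊗ₘ p) ≫ (α_ X Xᘁ X).hom = (α_ X Xᘁ X).hom ≫ (p ⊗ₘ (𝟙 _ ⊗ₘ p)) :=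
    associator_naturality _ _ _
  have e9 : η_ X (Xᘁ) ▷ X ≫ ((p ⊗ₘ pᘁ) ⊗ₘ p) = η_ X (Xᘁ) ▷ X ≫ ((p ⊗ₘ 𝟙 Xᘁ) ⊗ₘ p) := by
    rw [← tensorHom_id, tensorHom_comp_tensorHom, tensorHom_comp_tensorHom, coev_aux hp,
      tensorHom_id]
  have e10 : ((p ⊗ₘ 𝟙 Xᘁ) ⊗ₘ p) ≫ ((p ⊗ₘ pᘁ) ⊗ₘ p) = ((p ⊗ₘ pᘁ) ⊗ₘ p) := by
    rw [tensorHom_comp_tensorHom, tensorHom_comp_tensorHom, hp, Category.id_comp]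
  rw [e1]
  simp only [Category.assoc]
  rw [reassoc_of% e9, reassoc_of% e10, reassoc_of% e5, e3, ← reassoc_of% e7]
  have e11 : ((p ⊗ₘ 𝟙 Xᘁ) ⊗ₘ p) = (X ⊗ Xᘁ) ◁ p ≫ (p ▷ Xᘁ) ▷ X := by
    rw [tensorHom_id, tensorHom_def']
  have e12 : (p ▷ Xᘁ) ▷ X ≫ (α_ X Xᘁ X).hom ≫ X ◁ ε_ X (Xᘁ) =
      (α_ X Xᘁ X).hom ≫ X ◁ ε_ X (Xᘁ) ≫ p ▷ 𝟙_ C := by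
    rw [whisker_exchange]; simp
  rw [e11, Category.assoc, ← whisker_exchange_assoc, e12,
    ExactPairing.evaluation_coevaluation_assoc]
  simp

/-- The coevaluation of `(X, p)`. -/
noncomputable def coev (P : Karoubi C) : 𝟙_ (Karoubi C) ⟶ P ⊗ P.dual where
  f := η_ P.X ((P.X)ᘁ) ≫ (P.p ⊗ₘ (P.p)ᘁ)
  comm := by
    show 𝟙 _ ≫ (_ ≫ (P.p ⊗ₘ (P.p)ᘁ)) ≫ (P.p ⊗ₘ (P.p)ᘁ) = _
    rw [Category.id_comp, Category.assoc, tensorHom_comp_tensorHom, P.idem,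
      ← comp_rightAdjointMate, P.idem]
    rfl

/-- The evaluation of `(X, p)`. -/
noncomputable def ev (P : Karoubi C) : P.dual ⊗ P ⟶ 𝟙_ (Karoubi C) where
  f := ((P.p)ᘁ ⊗ₘ P.p) ≫ ε_ P.X ((P.X)ᘁ)
  comm := by
    show ((P.p)ᘁ ⊗ₘ P.p) ≫ (((P.p)ᘁ ⊗ₘ P.p) ≫ ε_ P.X ((P.X)ᘁ)) ≫ 𝟙 _ = _
    rw [Category.comp_id, tensorHom_comp_tensorHom_assoc, P.idem,
      ← comp_rightAdjointMate, P.idem]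
    rfl

noncomputable instance (P : Karoubi C) : ExactPairing P P.dual where
  coevaluation' := coev P
  evaluation' := ev P
  coevaluation_evaluation' := by
    ext
    exact zigzag₁ P.idem
  evaluation_coevaluation' := by
    ext
    exact zigzag₂ P.idem

noncomputable instance : RightRigidCategory (Karoubi C) where
  rightDual P := { rightDual := P.dual }

end Rigid

/-- The twist is the one of the underlying category, cut down by the idempotents. -/
noncomputable instance [BraidedCategory C] [RightRigidCategory C] [RibbonCategory C] :
    RibbonCategory (Karoubi C) where
  twist P := isoOfComm (RibbonCategory.twist P.X) (RibbonCategory.twist_naturality P.p)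
  twist_naturality {P Q} f := by
    ext
    show f.f ≫ Q.p ≫ (RibbonCategory.twist Q.X).hom =
      (P.p ≫ (RibbonCategory.twist P.X).hom) ≫ f.f
    rw [comp_p_assoc, Category.assoc, ← RibbonCategory.twist_naturality, p_comp_assoc]
  twist_tensor P Q := by
    ext
    show (P.p ⊗ₘ Q.p) ≫ (RibbonCategory.twist (P.X ⊗ Q.X)).hom =
      ((P.p ⊗ₘ Q.p) ≫ (β_ P.X Q.X).hom) ≫ ((Q.p ⊗ₘ P.p) ≫ (β_ Q.X P.X).hom) ≫
        (P.p ≫ (RibbonCategory.twist P.X).hom ⊗ₘ Q.p ≫ (RibbonCategory.twist Q.X).hom)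
    rw [← tensorHom_comp_tensorHom, RibbonCategory.twist_tensor]
    simp only [Category.assoc, ← BraidedCategory.braiding_naturality_assoc,
      tensorHom_comp_tensorHom_assoc, idem]
  twist_dual P := by
    refine RibbonCategory.eq_rightAdjointMate _ _ ?_
    ext
    show ((P.p)ᘁ ≫ (RibbonCategory.twist ((P.X)ᘁ)).hom ⊗ₘ P.p) ≫
        ((P.p)ᘁ ⊗ₘ P.p) ≫ ε_ P.X ((P.X)ᘁ) =
      ((P.p)ᘁ ⊗ₘ P.p ≫ (RibbonCategory.twist P.X).hom) ≫ ((P.p)ᘁ ⊗ₘ P.p) ≫ ε_ P.X ((P.X)ᘁ)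
    have h : (P.p)ᘁ ≫ (P.p)ᘁ = (P.p)ᘁ := by rw [← comp_rightAdjointMate, P.idem]
    rw [tensorHom_comp_tensorHom_assoc, tensorHom_comp_tensorHom_assoc, Category.assoc,
      Category.assoc, ← RibbonCategory.twist_naturality, ← RibbonCategory.twist_naturality,
      P.idem_assoc, reassoc_of% h, h, P.idem, RibbonCategory.twist_dual]
    rw [tensorHom_def', tensorHom_def', ← comp_rightAdjointMate, Category.assoc, Category.assoc,
      rightAdjointMate_comp_evaluation, rightAdjointMate_comp_evaluation,
      ← whiskerLeft_comp_assoc, ← whiskerLeft_comp_assoc, Category.assoc]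

end CategoryTheory.Idempotents.Karoubi

/-! ### Deligne's category, its graded variation and the degrading functor -/

/-- Deligne's category `Rep(S_t)`: the idempotent completion of the additive envelope of `Rep₀`. -/
abbrev RepS (F : Type u) [Field F] (t : F) : Type _ := Idempotents.Karoubi (Mat_ (Rep₀ F t))

/-- The graded variation `gRep(S_t)_q` of Deligne's category: the idempotent completion of the
additive envelope of `GrRep₀`. -/
abbrev gRepS (F : Type u) [Field F] (t : F) (q : Fˣ) : Type _ :=
  Idempotents.Karoubi (Mat_ (GrRep₀ F t q))

/-- The degrading functor, induced by `[a, b] ↦ [a + b]` on the envelopes. -/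
noncomputable def degrade (F : Type u) [Field F] (t : F) (q : Fˣ) : gRepS F t q ⥤ RepS F t :=
  (Idempotents.functorExtension₂ _ _).obj (GrRep₀.degrade₀ F t q).mapMat_

instance (F : Type u) [Field F] (t : F) (q : Fˣ) : (degrade F t q).Additive where
  map_add {P Q f g} := by
    refine Idempotents.Karoubi.hom_ext _ _ ?_
    refine Mat_.hom_ext _ _ fun i j => ?_
    rfl

instance (F : Type u) [Field F] (t : F) (q : Fˣ) : (degrade F t q).Linear F where
  map_smul f r := by
    refine Idempotents.Karoubi.hom_ext _ _ ?_
    refine Mat_.hom_ext _ _ fun i j => ?_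
    rfl

/-! The obstacle is that the degrading functor $\mathcal F$ is not braided: in the graded category
the braiding of objects of degrees $m$ and $n$ carries the scalar $q^{mn}$. A partial trace,
however, uses the braiding only between an object and its own dual, and always together with a
twist. If $X=[a,b]$ has degree $n=a-b$, then $X^*$ has degree $-n$, so the braiding contributes
$q^{-n^2}$ and the twist $q^{n^2}$. The two cancel in $\operatorname{coev}'_X$ and in
$\operatorname{ev}'_X$ (`GrRep₀.coev'_eq`, `GrRep₀.ev'_eq`). What remains is built from the plain
block transposition and the plain duality diagrams, and these do degrade to their counterparts in
Deligne's category.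

Hence degrading commutes with both partial traces. If $\tilde h$ denotes $\mathcal F(h)$ read as an
endomorphism of $\mathcal F(V)\otimes\mathcal F(V)$, then $\mathcal F(\operatorname{tr}_L
h)=\operatorname{tr}_L\tilde h$ and $\mathcal F(\operatorname{tr}_R h)=\operatorname{tr}_R\tilde h$
(`gRepS.degrade_trL`, `gRepS.degrade_trR`). The ambidexterity of the given functional at $\tilde h$
is then the claim.

A general $V$ is a summand of a direct sum of objects $[a,b]$ of possibly different degrees, so the
cancellation has to survive both envelopes. In the additive envelope a partial trace is computed
entry by entry: its $(i,j)$ entry is the sum over the summands $X_k$ in the loop of partial traces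
along $X_k$ (`Mat_.trL_apply`, `Mat_.trR_apply`). Each loop pairs $X_k$ with its own dual only, so
mixed degrees do no harm. In the Karoubi envelope the partial trace of a morphism is the partial
trace of its underlying morphism, because that morphism already absorbs the idempotents
(`Karoubi.trL_f`, `Karoubi.trR_f`).

The comparison uses the monoidal structure of the degrading functor only before the envelopes are
taken. On tuples, $\tilde h$ is defined entrywise by `tensorMapMat`, so no tensor constraints for
the functor between the envelopes are needed. The entries of a matrix of endomorphisms are in
general not endomorphisms; this is why `traceLeft` and `traceRight` allow the strand outside the
loop to change its object. -/

namespace RibbonCategory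

/-! ### Partial traces along arbitrary cups and caps -/

section PartialTraces

variable {C : Type*} [Category* C] [MonoidalCategory C]

/-- The left partial trace of a morphism `V ⊗ W ⟶ V ⊗ W'` along `c : 𝟙 ⟶ D ⊗ V` and
`e : D ⊗ V ⟶ 𝟙`. -/
def traceLeft {V D W W' : C} (c : 𝟙_ C ⟶ D ⊗ V) (e : D ⊗ V ⟶ 𝟙_ C) (f : V ⊗ W ⟶ V ⊗ W') :
    W ⟶ W' :=
  (λ_ W).inv ≫ c ▷ W ≫ (α_ D V W).hom ≫ D ◁ f ≫ (α_ D V W').inv ≫ e ▷ W' ≫ (λ_ W').hom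

/-- The right partial trace of a morphism `V ⊗ W ⟶ V' ⊗ W` along `c : 𝟙 ⟶ W ⊗ D` and
`e : W ⊗ D ⟶ 𝟙`. -/
def traceRight {V V' W D : C} (c : 𝟙_ C ⟶ W ⊗ D) (e : W ⊗ D ⟶ 𝟙_ C) (f : V ⊗ W ⟶ V' ⊗ W) :
    V ⟶ V' :=
  (ρ_ V).inv ≫ V ◁ c ≫ (α_ V W D).inv ≫ f ▷ D ≫ (α_ V' W D).hom ≫ V' ◁ e ≫ (ρ_ V').hom

/-- The strand carrying `s` is disjoint from the loop, so `s` moves past the cup by the interchange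
law. -/
theorem comp_traceLeft {V D W W' W'' : C} (c : 𝟙_ C ⟶ D ⊗ V) (e : D ⊗ V ⟶ 𝟙_ C)
    (s : W'' ⟶ W) (f : V ⊗ W ⟶ V ⊗ W') :
    s ≫ traceLeft c e f = traceLeft c e (V ◁ s ≫ f) := by
  simp only [traceLeft, leftUnitor_inv_naturality_assoc, whisker_exchange_assoc,
    MonoidalCategory.whiskerLeft_comp, Category.assoc, associator_naturality_right_assoc]

theorem comp_traceRight {V V' V'' W D : C} (c : 𝟙_ C ⟶ W ⊗ D) (e : W ⊗ D ⟶ 𝟙_ C)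
    (s : V'' ⟶ V) (f : V ⊗ W ⟶ V' ⊗ W) :
    s ≫ traceRight c e f = traceRight c e (s ▷ W ≫ f) := by
  simp only [traceRight, rightUnitor_inv_naturality_assoc, ← whisker_exchange_assoc]
  simp

/-- Endomorphisms of the strand `V` placed just after the cup or just before the cap are adjacent to
the traced morphism and can be absorbed into it. In the Karoubi envelope `p` and `r` will be the
idempotent of the object in the loop. -/
theorem traceLeft_comp {V D W W' : C} (c : 𝟙_ C ⟶ D ⊗ V) (e : D ⊗ V ⟶ 𝟙_ C) (p r : V ⟶ V)
    (f : V ⊗ W ⟶ V ⊗ W') :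
    traceLeft (c ≫ D ◁ p) (D ◁ r ≫ e) f = traceLeft c e (p ▷ W ≫ f ≫ r ▷ W') := by
  simp [traceLeft]

theorem traceRight_comp {V V' W D : C} (c : 𝟙_ C ⟶ W ⊗ D) (e : W ⊗ D ⟶ 𝟙_ C) (p r : W ⟶ W)
    (f : V ⊗ W ⟶ V' ⊗ W) :
    traceRight (c ≫ p ▷ D) (r ▷ D ≫ e) f = traceRight c e (V ◁ p ≫ f ≫ V' ◁ r) := by
  simp [traceRight]

/-- The traced morphism does not touch the dual strand, so `φ` slides along it from the cup to the
cap. This makes a partial trace independent of the model chosen for the dual: an isomorphism at the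
cup meets its inverse at the cap. -/
theorem traceLeft_slide {V D D' W W' : C} (c : 𝟙_ C ⟶ D' ⊗ V) (φ : D' ⟶ D)
    (e : D ⊗ V ⟶ 𝟙_ C) (f : V ⊗ W ⟶ V ⊗ W') :
    traceLeft (c ≫ φ ▷ V) e f = traceLeft c (φ ▷ V ≫ e) f := by
  simp only [traceLeft, comp_whiskerRight, Category.assoc, associator_naturality_left_assoc,
    ← whisker_exchange_assoc, associator_inv_naturality_left_assoc]

theorem traceRight_slide {V V' W D D' : C} (c : 𝟙_ C ⟶ W ⊗ D') (φ : D' ⟶ D)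
    (e : W ⊗ D ⟶ 𝟙_ C) (f : V ⊗ W ⟶ V' ⊗ W) :
    traceRight (c ≫ W ◁ φ) e f = traceRight c (W ◁ φ ≫ e) f := by
  simp only [traceRight, MonoidalCategory.whiskerLeft_comp, Category.assoc,
    associator_inv_naturality_right_assoc, whisker_exchange_assoc,
    associator_naturality_right_assoc]

/-! ### Partial traces under a monoidal functor -/

section Functor

open Functor.LaxMonoidal Functor.OplaxMonoidal

variable {D : Type*} [Category* D] [MonoidalCategory D] (G : C ⥤ D) [G.Monoidal]

/-- The morphism between tensor products of the images under a monoidal functor induced by a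
morphism between tensor products. -/
def tensorMap {X Y X' Y' : C} (f : X ⊗ Y ⟶ X' ⊗ Y') :
    G.obj X ⊗ G.obj Y ⟶ G.obj X' ⊗ G.obj Y' :=
  μ G X Y ≫ G.map f ≫ δ G X' Y'

theorem tensorMap_tensorHom {X Y X' Y' : C} (f : X ⟶ X') (g : Y ⟶ Y') :
    tensorMap G (f ⊗ₘ g) = G.map f ⊗ₘ G.map g := by
  rw [tensorMap, Functor.Monoidal.map_tensor]
  simp only [Category.assoc, Functor.Monoidal.μ_δ, Category.comp_id,
    Functor.Monoidal.μ_δ_assoc]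

/-- The inner pair `δ ≫ μ` cancels. With `tensorMap_tensorHom`, this lets idempotents of the form `p
⊗ p'` be transported along the functor. -/
theorem tensorMap_comp {X Y X' Y' X'' Y'' : C} (f : X ⊗ Y ⟶ X' ⊗ Y') (g : X' ⊗ Y' ⟶ X'' ⊗ Y'') :
    tensorMap G (f ≫ g) = tensorMap G f ≫ tensorMap G g := by
  simp [tensorMap]

theorem tensorMap_sum [Preadditive C] [Preadditive D] [G.Additive] {X Y X' Y' : C} {ι : Type*}
    (s : Finset ι) (f : ι → (X ⊗ Y ⟶ X' ⊗ Y')) :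
    tensorMap G (∑ i ∈ s, f i) = ∑ i ∈ s, tensorMap G (f i) := by
  simp only [tensorMap, Functor.map_sum, Preadditive.sum_comp, Preadditive.comp_sum]

/-- The images of whiskerings, associators and unitors are the same morphisms of the target up to
`μ`, `δ`, `ε` and `η`. Between consecutive factors these constraints cancel, and only those around
the cup, the cap and `f` survive. No compatibility with braidings is involved. -/
theorem map_traceLeft {V E W W' : C} (c : 𝟙_ C ⟶ E ⊗ V) (e : E ⊗ V ⟶ 𝟙_ C)
    (f : V ⊗ W ⟶ V ⊗ W') :
    G.map (traceLeft c e f) = traceLeft (ε G ≫ G.map c ≫ δ G E V) (μ G E V ≫ G.map e ≫ η G)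
      (tensorMap G f) := by
  simp only [traceLeft, tensorMap, Functor.map_comp, Functor.Monoidal.map_whiskerRight,
    Functor.Monoidal.map_whiskerLeft, Functor.Monoidal.map_associator,
    Functor.Monoidal.map_associator_inv, Functor.Monoidal.map_leftUnitor,
    Functor.Monoidal.map_leftUnitor_inv, Category.assoc, comp_whiskerRight,
    MonoidalCategory.whiskerLeft_comp, Functor.Monoidal.μ_δ_assoc]

theorem map_traceRight {V V' W E : C} (c : 𝟙_ C ⟶ W ⊗ E) (e : W ⊗ E ⟶ 𝟙_ C)
    (f : V ⊗ W ⟶ V' ⊗ W) :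
    G.map (traceRight c e f) = traceRight (ε G ≫ G.map c ≫ δ G W E) (μ G W E ≫ G.map e ≫ η G)
      (tensorMap G f) := by
  simp only [traceRight, tensorMap, Functor.map_comp, Functor.Monoidal.map_whiskerRight,
    Functor.Monoidal.map_whiskerLeft, Functor.Monoidal.map_associator,
    Functor.Monoidal.map_associator_inv, Functor.Monoidal.map_rightUnitor,
    Functor.Monoidal.map_rightUnitor_inv, Category.assoc, comp_whiskerRight,
    MonoidalCategory.whiskerLeft_comp, Functor.Monoidal.μ_δ_assoc]

end Functor

variable [BraidedCategory C] [RightRigidCategory C] [RibbonCategory C]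

theorem trL_eq_traceLeft {V W : C} (f : V ⊗ W ⟶ V ⊗ W) :
    trL f = traceLeft (coev' V) (ε_ V (Vᘁ)) f := rfl

theorem trR_eq_traceRight {V W : C} (f : V ⊗ W ⟶ V ⊗ W) :
    trR f = traceRight (η_ W (Wᘁ)) (ev' W) f := rfl

end PartialTraces

end RibbonCategory

/-! ### Partial traces in the Karoubi envelope -/

namespace CategoryTheory.Idempotents.Karoubi

open RibbonCategory

variable {C : Type*} [Category* C] [MonoidalCategory C]

/-- This brings arbitrary morphisms into the `IsOf` calculus, alongside the structure morphisms that
are cut down from the underlying category. -/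
theorem isOf_f {P Q : Karoubi C} (f : P ⟶ Q) : IsOf f f.f :=
  ⟨(p_comp f).symm, (p_comp f).trans (comp_p f).symm⟩

theorem isOf_leftUnitor_hom (P : Karoubi C) : IsOf (λ_ P).hom (λ_ P.X).hom :=
  isOf_isoOfComm (P := 𝟙_ (Karoubi C) ⊗ P) _ _

theorem isOf_leftUnitor_inv (P : Karoubi C) : IsOf (λ_ P).inv (λ_ P.X).inv := by
  -- The inverse unitor is cut down at its target, whereas `IsOf` has the idempotent at the source;
  -- naturality moves it across.
  have h : P.p ≫ (λ_ P.X).inv = (λ_ P.X).inv ≫ (𝟙 (𝟙_ C) ⊗ₘ P.p) := by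
    rw [id_tensorHom, leftUnitor_inv_naturality]
  exact ⟨h.symm, h⟩

theorem isOf_rightUnitor_hom (P : Karoubi C) : IsOf (ρ_ P).hom (ρ_ P.X).hom :=
  isOf_isoOfComm (P := P ⊗ 𝟙_ (Karoubi C)) _ _

theorem isOf_rightUnitor_inv (P : Karoubi C) : IsOf (ρ_ P).inv (ρ_ P.X).inv := by
  have h : P.p ≫ (ρ_ P.X).inv = (ρ_ P.X).inv ≫ (P.p ⊗ₘ 𝟙 (𝟙_ C)) := by
    rw [tensorHom_id, rightUnitor_inv_naturality]
  exact ⟨h.symm, h⟩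

/-- Each factor of the partial trace is cut down from a morphism compatible with the idempotents. In
such a composite all intermediate idempotents merge into a single one at the source. -/
theorem traceLeft_f {P D Q Q' : Karoubi C} (c : 𝟙_ (Karoubi C) ⟶ D ⊗ P)
    (e : D ⊗ P ⟶ 𝟙_ (Karoubi C)) (f : P ⊗ Q ⟶ P ⊗ Q') :
    (traceLeft c e f).f = Q.p ≫ traceLeft (V := P.X) (D := D.X) (W := Q.X) (W' := Q'.X)
      c.f e.f f.f :=
  ((isOf_leftUnitor_inv Q).comp (((isOf_f c).whiskerRight Q).comp
    ((isOf_associator_hom D P Q).comp (((isOf_f f).whiskerLeft D).comp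
      ((isOf_associator_inv D P Q').comp (((isOf_f e).whiskerRight Q').comp
        (isOf_leftUnitor_hom Q'))))))).1

theorem traceRight_f {P P' D Q : Karoubi C} (c : 𝟙_ (Karoubi C) ⟶ Q ⊗ D)
    (e : Q ⊗ D ⟶ 𝟙_ (Karoubi C)) (f : P ⊗ Q ⟶ P' ⊗ Q) :
    (traceRight c e f).f = P.p ≫ traceRight (V := P.X) (D := D.X) (W := Q.X) (V' := P'.X)
      c.f e.f f.f :=
  ((isOf_rightUnitor_inv P).comp (((isOf_f c).whiskerLeft P).comp
    ((isOf_associator_inv P Q D).comp (((isOf_f f).whiskerRight D).comp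
      ((isOf_associator_hom P' Q D).comp (((isOf_f e).whiskerLeft P').comp
        (isOf_rightUnitor_hom P'))))))).1

variable [RightRigidCategory C]

/-- The dual idempotent slides around the cup and becomes a second copy of `P.p`, which idempotence
absorbs. The idempotent thus sits on the strand of `P.X` alone, as `traceRight_comp` needs it. -/
theorem coevaluation_f (P : Karoubi C) : (η_ P (Pᘁ)).f = η_ P.X ((P.X)ᘁ) ≫ P.p ▷ (P.X)ᘁ :=
  coev_aux P.idem

theorem evaluation_f (P : Karoubi C) : (ε_ P (Pᘁ)).f = ((P.X)ᘁ : C) ◁ P.p ≫ ε_ P.X ((P.X)ᘁ) :=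
  ev_aux P.idem

variable [BraidedCategory C] [RibbonCategory C]

theorem isOf_twist_hom (P : Karoubi C) : IsOf (twist P).hom (twist P.X).hom :=
  isOf_isoOfComm _ _

theorem isOf_braiding_hom (P Q : Karoubi C) : IsOf (β_ P Q).hom (β_ P.X Q.X).hom :=
  isOf_isoOfComm (P := P ⊗ Q) (Q := Q ⊗ P) _ _

/-- The idempotent left by `coevaluation_f` crosses the braiding and commutes with the twist by
naturality. It comes out on the right-hand strand, in the form required by `traceLeft_comp`. -/
theorem coev'_f (P : Karoubi C) : (coev' P).f = coev' P.X ≫ ((P.X)ᘁ : C) ◁ P.p := by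
  have h := ((isOf_f (η_ P (Pᘁ))).comp ((isOf_braiding_hom P (Pᘁ)).comp
    ((isOf_twist_hom P).whiskerLeft (Pᘁ)))).1
  refine h.trans ?_
  rw [coevaluation_f]
  -- The idempotent that `IsOf` puts in front is that of the unit object, hence an identity.
  change 𝟙 _ ≫ (_ ≫ P.p ▷ (P.X)ᘁ) ≫ (β_ P.X (P.X)ᘁ).hom ≫ (P.X)ᘁ ◁ _ = _
  simp only [coev', Category.id_comp, Category.assoc,
    BraidedCategory.braiding_naturality_left_assoc, ← MonoidalCategory.whiskerLeft_comp,
    twist_naturality]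

theorem ev'_f (P : Karoubi C) : (ev' P).f = P.p ▷ ((P.X)ᘁ : C) ≫ ev' P.X := by
  have h := (((isOf_twist_hom P).whiskerRight (Pᘁ)).comp ((isOf_braiding_hom P (Pᘁ)).comp
    (isOf_f (ε_ P (Pᘁ))))).1
  refine h.trans ?_
  rw [evaluation_f]
  change (P.p ⊗ₘ (P.p)ᘁ) ≫ _ ▷ (P.X)ᘁ ≫ (β_ P.X (P.X)ᘁ).hom ≫ (P.X)ᘁ ◁ P.p ≫ _ = _
  -- The source idempotent contributed by `IsOf` is pushed past the twist and the braiding until it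
  -- meets the evaluation.
  have h₁ : (P.p ⊗ₘ (P.p)ᘁ) ≫ (twist P.X).hom ▷ (P.X)ᘁ =
      (twist P.X).hom ▷ (P.X)ᘁ ≫ (P.p ⊗ₘ (P.p)ᘁ) := by
    rw [tensorHom_def', Category.assoc, ← comp_whiskerRight, twist_naturality, comp_whiskerRight,
      whisker_exchange_assoc]
  -- There it is absorbed: by `ev_aux` the cut-down evaluation already contains a factor `(P.p)ᘁ ⊗ₘ
  -- P.p`. The one remaining copy of `P.p` is then carried back to the front.
  have h₂ : ((P.p)ᘁ ⊗ₘ P.p) ≫ (P.X)ᘁ ◁ P.p ≫ ε_ P.X ((P.X)ᘁ) =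
      (P.X)ᘁ ◁ P.p ≫ ε_ P.X ((P.X)ᘁ) := by
    rw [← ev_aux P.idem, tensorHom_comp_tensorHom_assoc, P.idem, ← comp_rightAdjointMate, P.idem]
  rw [reassoc_of% h₁, BraidedCategory.braiding_naturality_assoc, h₂,
    ← BraidedCategory.braiding_naturality_left_assoc, ev', ← comp_whiskerRight_assoc,
    ← comp_whiskerRight_assoc, twist_naturality]

/-- The idempotents produced by the cup, the cap and the outer strand can all be moved next to
`f.f`. A morphism of the envelope is unchanged by the idempotents of its source and target, so they
disappear without trace. -/
theorem trL_f {P Q : Karoubi C} (f : P ⊗ Q ⟶ P ⊗ Q) :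
    (trL f).f = trL (V := P.X) (W := Q.X) f.f := by
  -- These factors around `g` are the ones produced by `traceLeft_comp`, for the cup and the cap,
  -- followed by `comp_traceLeft`, for the outer strand.
  have h : ∀ g : P.X ⊗ Q.X ⟶ P.X ⊗ Q.X, (P.p ⊗ₘ Q.p) ≫ g = g → g ≫ (P.p ⊗ₘ Q.p) = g →
      P.X ◁ Q.p ≫ P.p ▷ Q.X ≫ g ≫ P.p ▷ Q.X = g := by
    intro g hl hr
    -- Since `g` ends with `P.p ⊗ₘ Q.p`, one more `P.p` on the first strand changes nothing.
    have h' : g ≫ P.p ▷ Q.X = g := by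
      rw [← hr, Category.assoc, ← tensorHom_id, tensorHom_comp_tensorHom, P.idem,
        Category.comp_id]
    rw [h', ← tensorHom_def'_assoc, hl]
  rw [trL_eq_traceLeft, traceLeft_f, coev'_f, evaluation_f]
  refine (congrArg (Q.p ≫ ·) (traceLeft_comp (coev' P.X) (ε_ P.X ((P.X)ᘁ)) P.p P.p f.f)).trans ?_
  exact (comp_traceLeft _ _ _ _).trans (congrArg (traceLeft _ _) (h _ (p_comp f) (comp_p f)))

theorem trR_f {P Q : Karoubi C} (f : P ⊗ Q ⟶ P ⊗ Q) :
    (trR f).f = trR (V := P.X) (W := Q.X) f.f := by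
  have h : ∀ g : P.X ⊗ Q.X ⟶ P.X ⊗ Q.X, (P.p ⊗ₘ Q.p) ≫ g = g → g ≫ (P.p ⊗ₘ Q.p) = g →
      P.p ▷ Q.X ≫ P.X ◁ Q.p ≫ g ≫ P.X ◁ Q.p = g := by
    intro g hl hr
    have h' : g ≫ P.X ◁ Q.p = g := by
      rw [← hr, Category.assoc, ← id_tensorHom, tensorHom_comp_tensorHom, Q.idem,
        Category.comp_id]
    rw [h', ← tensorHom_def_assoc, hl]
  rw [trR_eq_traceRight, traceRight_f, coevaluation_f, ev'_f]
  refine (congrArg (P.p ≫ ·) (traceRight_comp (η_ Q.X ((Q.X)ᘁ)) (ev' Q.X) Q.p Q.p f.f)).trans ?_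
  exact (comp_traceRight _ _ _ _).trans (congrArg (traceRight _ _) (h _ (p_comp f) (comp_p f)))

end CategoryTheory.Idempotents.Karoubi

/-! ### Partial traces in the additive envelope -/

namespace CategoryTheory.Mat_

open RibbonCategory

variable {C : Type*} [Category* C] [Preadditive C] [MonoidalCategory C] [MonoidalPreadditive C]

/-- This is the index pattern of a cup or cap beside an identity strand: the duality morphism forces
`k = l`, and the identity matrix on the strand forces `m = i`. -/
theorem sum_diagonal {ι κ A : Type*} [Fintype ι] [Fintype κ] [AddCommMonoid A]
    (g : ι × ι × κ → A) (i : κ) (h : ∀ k l m, ¬ (k = l ∧ m = i) → g (k, l, m) = 0) :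
    ∑ p, g p = ∑ k, g (k, k, i) := by
  rw [Fintype.sum_prod_type]
  refine Finset.sum_congr rfl fun k _ => ?_
  refine Finset.sum_eq_single (k, i) ?_ (fun h => absurd (Finset.mem_univ _) h)
  rintro ⟨l, m⟩ - hne
  exact h k l m fun ⟨h₁, h₂⟩ => hne (by rw [h₁, h₂])

/-- The entry can vanish because the identity strand changes its index or because `f` vanishes
there. Asking for the second only when `k = k'` treats both reasons at once. -/
theorem whiskerRight_eq_zero (K : Mat_ C) {M N : Mat_ C} (f : M ⟶ N) {k k' : K.ι} (i : M.ι)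
    (j : N.ι) (h : k = k' → f i j = 0) : (f ▷ K) (i, k) (j, k') = 0 := by
  by_cases hk : k = k'
  · subst hk
    refine (whiskerRight_id_apply K f k i j).trans ?_
    rw [h rfl, MonoidalPreadditive.zero_whiskerRight]
  · exact whiskerRight_id_ne K f hk i j

theorem whiskerLeft_eq_zero (K : Mat_ C) {M N : Mat_ C} (f : M ⟶ N) {k k' : K.ι} (i : M.ι)
    (j : N.ι) (h : k = k' → f i j = 0) : (K ◁ f) (k, i) (k', j) = 0 := by
  by_cases hk : k = k'
  · subst hk
    refine (id_whiskerLeft_apply K f k i j).trans ?_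
    rw [h rfl, MonoidalPreadditive.whiskerLeft_zero]
  · exact id_whiskerLeft_ne K f hk i j

variable [RightRigidCategory C]

/-- Unitors and associators are generalized diagonal matrices, possibly transposed, so composing
with them only reindexes entries and introduces no sums. -/
theorem coev_assoc_apply {M N : Mat_ C} (c : 𝟙_ (Mat_ C) ⟶ M.dual ⊗ M) (i : N.ι)
    (k l : M.ι) (m : N.ι) :
    ((λ_ N).inv ≫ c ▷ N ≫ (α_ M.dual M N).hom) i (k, l, m) =
      (λ_ (N.X i)).inv ≫ (c ▷ N) (PUnit.unit, i) ((k, l), m) ≫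
        (α_ (M.dual.X k) (M.X l) (N.X m)).hom :=
  (codiag_comp_apply (M := tensorObj ⟨PUnit, fun _ => 𝟙_ C⟩ N) (N := N) (Equiv.punitProd _)
    (fun p => (λ_ (N.X p.2)).inv) (c ▷ N ≫ (α_ M.dual M N).hom) (PUnit.unit, i)
      (k, l, m)).trans
    (congrArg (_ ≫ ·) (comp_diag_apply (M := tensorObj (tensorObj M.dual M) N)
      (N := tensorObj M.dual (tensorObj M N)) (c ▷ N) (Equiv.prodAssoc _ _ _)
      (fun p => (α_ (M.dual.X p.1.1) (M.X p.1.2) (N.X p.2)).hom) (PUnit.unit, i) ((k, l), m)))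

theorem assoc_ev_apply {M N : Mat_ C} (e : M.dual ⊗ M ⟶ 𝟙_ (Mat_ C)) (j : N.ι)
    (k l : M.ι) (m : N.ι) :
    ((α_ M.dual M N).inv ≫ e ▷ N ≫ (λ_ N).hom) (k, l, m) j =
      (α_ (M.dual.X k) (M.X l) (N.X m)).inv ≫ (e ▷ N) ((k, l), m) (PUnit.unit, j) ≫
        (λ_ (N.X j)).hom := by
  rw [associator_inv_eq]
  exact (diag_comp_apply (M := tensorObj M.dual (tensorObj M N))
    (N := tensorObj (tensorObj M.dual M) N) _ _ _ (k, l, m) j).trans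
    (congrArg (_ ≫ ·) (comp_diag_apply (M := tensorObj ⟨PUnit, fun _ => 𝟙_ C⟩ N) (N := N)
      (e ▷ N) (Equiv.punitProd _) (fun p => (λ_ (N.X p.2)).hom) ((k, l), m) (PUnit.unit, j)))

/-- An entry of the composite is a sum over paths of indices. The cup and the cap vanish unless the
two ends of the loop carry equal indices, the dual strand keeps its index while passing `f`, and the
outer strand changes its index only at `f`. A path is therefore determined by the single index `k`
of the loop. -/
theorem traceLeft_apply {M N N' : Mat_ C} (c : 𝟙_ (Mat_ C) ⟶ M.dual ⊗ M)
    (e : M.dual ⊗ M ⟶ 𝟙_ (Mat_ C)) (hc : ∀ u k l, k ≠ l → c u (k, l) = 0)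
    (he : ∀ u k l, k ≠ l → e (k, l) u = 0) (f : M ⊗ N ⟶ M ⊗ N') (i : N.ι) (j : N'.ι) :
    traceLeft c e f i j = ∑ k : M.ι, traceLeft (V := M.X k) (W := N.X i) (W' := N'.X j)
      (c PUnit.unit (k, k)) (e (k, k) PUnit.unit) (f (k, i) (k, j)) := by
  -- Grouped in this way, the composite has only two genuine matrix products, since the structure
  -- isomorphisms are absorbed into the outer factors.
  have h : traceLeft c e f = ((λ_ N).inv ≫ c ▷ N ≫ (α_ M.dual M N).hom) ≫ M.dual ◁ f ≫
      ((α_ M.dual M N').inv ≫ e ▷ N' ≫ (λ_ N').hom) := by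
    simp only [traceLeft, Category.assoc]
  rw [h, comp_apply]
  refine (sum_diagonal (ι := M.ι) (κ := N.ι) _ i ?_).trans (Finset.sum_congr rfl fun k _ => ?_)
  · intro k l m hne
    have h0 : (c ▷ N) (PUnit.unit, i) ((k, l), m) = 0 :=
      whiskerRight_eq_zero N c PUnit.unit (k, l) fun hm => hc _ _ _ fun hk => hne ⟨hk, hm.symm⟩
    rw [coev_assoc_apply, h0, Limits.zero_comp, Limits.comp_zero, Limits.zero_comp]
  · have h1 : (c ▷ N) (PUnit.unit, i) ((k, k), i) = c PUnit.unit (k, k) ▷ N.X i :=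
      whiskerRight_id_apply N c i PUnit.unit (k, k)
    -- In the second product the cap forces equal loop indices and the final index `j`, while the
    -- identity on the dual strand forces the loop index to remain `k`.
    have h2 : (M.dual ◁ f ≫ ((α_ M.dual M N').inv ≫ e ▷ N' ≫ (λ_ N').hom)) (k, k, i) j =
        M.dual.X k ◁ f (k, i) (k, j) ≫ (α_ (M.dual.X k) (M.X k) (N'.X j)).inv ≫
          e (k, k) PUnit.unit ▷ N'.X j ≫ (λ_ (N'.X j)).hom := by
      rw [comp_apply]
      refine (sum_diagonal (ι := M.ι) (κ := N'.ι) _ j ?_).trans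
        ((Finset.sum_eq_single k ?_ fun h => absurd (Finset.mem_univ _) h).trans ?_)
      · intro k' l m hne
        have h0 : (e ▷ N') ((k', l), m) (PUnit.unit, j) = 0 :=
          whiskerRight_eq_zero N' e (k', l) PUnit.unit fun hm => he _ _ _ fun hk => hne ⟨hk, hm⟩
        rw [assoc_ev_apply, h0, Limits.zero_comp, Limits.comp_zero, Limits.comp_zero]
      · intro k' _ hk
        refine (congrArg (· ≫ _) (id_whiskerLeft_ne M.dual f hk.symm (k, i) (k', j))).trans ?_
        exact Limits.zero_comp
      · rw [assoc_ev_apply]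
        exact congrArg₂ (fun x y => x ≫ _ ≫ y ≫ _) (id_whiskerLeft_apply M.dual f k (k, i) (k, j))
          (whiskerRight_id_apply N' e j (k, k) PUnit.unit)
    rw [coev_assoc_apply, h1, h2]
    simp only [traceLeft, Category.assoc]

theorem assoc_coev_apply {M N : Mat_ C} (c : 𝟙_ (Mat_ C) ⟶ M ⊗ M.dual) (i m : N.ι)
    (k l : M.ι) :
    ((ρ_ N).inv ≫ N ◁ c ≫ (α_ N M M.dual).inv) i ((m, k), l) =
      (ρ_ (N.X i)).inv ≫ (N ◁ c) (i, PUnit.unit) (m, k, l) ≫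
        (α_ (N.X m) (M.X k) (M.dual.X l)).inv := by
  rw [associator_inv_eq]
  exact (codiag_comp_apply (M := tensorObj N ⟨PUnit, fun _ => 𝟙_ C⟩) (N := N) (Equiv.prodPUnit _)
    (fun p => (ρ_ (N.X p.1)).inv) (N ◁ c ≫ diag (M := tensorObj N (tensorObj M M.dual))
      (N := tensorObj (tensorObj N M) M.dual) (Equiv.prodAssoc _ _ _).symm
      (fun p => (α_ (N.X p.1) (M.X p.2.1) (M.dual.X p.2.2)).inv))
    (i, PUnit.unit) ((m, k), l)).trans
    (congrArg (_ ≫ ·) (comp_diag_apply (M := tensorObj N (tensorObj M M.dual))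
      (N := tensorObj (tensorObj N M) M.dual) (N ◁ c) (Equiv.prodAssoc _ _ _).symm
      (fun p => (α_ (N.X p.1) (M.X p.2.1) (M.dual.X p.2.2)).inv) (i, PUnit.unit) (m, k, l)))

theorem ev_assoc_apply {M N : Mat_ C} (e : M ⊗ M.dual ⟶ 𝟙_ (Mat_ C)) (j m : N.ι)
    (k l : M.ι) :
    ((α_ N M M.dual).hom ≫ N ◁ e ≫ (ρ_ N).hom) ((m, k), l) j =
      (α_ (N.X m) (M.X k) (M.dual.X l)).hom ≫ (N ◁ e) (m, k, l) (j, PUnit.unit) ≫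
        (ρ_ (N.X j)).hom :=
  (diag_comp_apply (M := tensorObj (tensorObj N M) M.dual)
    (N := tensorObj N (tensorObj M M.dual)) _ _ _ ((m, k), l) j).trans
    (congrArg (_ ≫ ·) (comp_diag_apply (M := tensorObj N ⟨PUnit, fun _ => 𝟙_ C⟩) (N := N)
      (N ◁ e) (Equiv.prodPUnit _) (fun p => (ρ_ (N.X p.1)).hom) (m, k, l) (j, PUnit.unit)))

/-- The variant of `sum_diagonal` for the bracketing `(N ⊗ M) ⊗ M.dual`, in which the strand outside
the loop comes first. -/
theorem sum_diagonal' {ι κ A : Type*} [Fintype ι] [Fintype κ] [AddCommMonoid A]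
    (g : (κ × ι) × ι → A) (i : κ) (h : ∀ k l m, ¬ (k = l ∧ m = i) → g ((m, k), l) = 0) :
    ∑ p, g p = ∑ k, g ((i, k), k) := by
  refine ((Equiv.prodAssoc ι ι κ).symm.trans (Equiv.prodComm _ _)
    |>.trans (Equiv.prodAssoc κ ι ι).symm).sum_comp g |>.symm.trans ?_
  exact sum_diagonal _ i h

/-- The argument of `traceLeft_apply` with the loop on the right: the dual strand is now the last
tensor factor, and it again keeps its index past `f`. -/
theorem traceRight_apply {M N N' : Mat_ C} (c : 𝟙_ (Mat_ C) ⟶ M ⊗ M.dual)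
    (e : M ⊗ M.dual ⟶ 𝟙_ (Mat_ C)) (hc : ∀ u k l, k ≠ l → c u (k, l) = 0)
    (he : ∀ u k l, k ≠ l → e (k, l) u = 0) (f : N ⊗ M ⟶ N' ⊗ M) (i : N.ι) (j : N'.ι) :
    traceRight c e f i j = ∑ k : M.ι, traceRight (W := M.X k) (V := N.X i) (V' := N'.X j)
      (c PUnit.unit (k, k)) (e (k, k) PUnit.unit) (f (i, k) (j, k)) := by
  have h : traceRight c e f = ((ρ_ N).inv ≫ N ◁ c ≫ (α_ N M M.dual).inv) ≫ f ▷ M.dual ≫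
      ((α_ N' M M.dual).hom ≫ N' ◁ e ≫ (ρ_ N').hom) := by
    simp only [traceRight, Category.assoc]
  rw [h, comp_apply]
  refine (sum_diagonal' (ι := M.ι) (κ := N.ι) _ i ?_).trans (Finset.sum_congr rfl fun k _ => ?_)
  · intro k l m hne
    have h0 : (N ◁ c) (i, PUnit.unit) (m, k, l) = 0 :=
      whiskerLeft_eq_zero N c PUnit.unit (k, l) fun hm => hc _ _ _ fun hk => hne ⟨hk, hm.symm⟩
    rw [assoc_coev_apply, h0, Limits.zero_comp, Limits.comp_zero, Limits.zero_comp]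
  · have h1 : (N ◁ c) (i, PUnit.unit) (i, k, k) = N.X i ◁ c PUnit.unit (k, k) :=
      id_whiskerLeft_apply N c i PUnit.unit (k, k)
    have h2 : (f ▷ M.dual ≫ ((α_ N' M M.dual).hom ≫ N' ◁ e ≫ (ρ_ N').hom)) ((i, k), k) j =
        f (i, k) (j, k) ▷ M.dual.X k ≫ (α_ (N'.X j) (M.X k) (M.dual.X k)).hom ≫
          N'.X j ◁ e (k, k) PUnit.unit ≫ (ρ_ (N'.X j)).hom := by
      rw [comp_apply]
      refine (sum_diagonal' (ι := M.ι) (κ := N'.ι) _ j ?_).trans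
        ((Finset.sum_eq_single k ?_ fun h => absurd (Finset.mem_univ _) h).trans ?_)
      · intro k' l m hne
        have h0 : (N' ◁ e) (m, k', l) (j, PUnit.unit) = 0 :=
          whiskerLeft_eq_zero N' e (k', l) PUnit.unit fun hm => he _ _ _ fun hk => hne ⟨hk, hm⟩
        rw [ev_assoc_apply, h0, Limits.zero_comp, Limits.comp_zero, Limits.comp_zero]
      · intro k' _ hk
        refine (congrArg (· ≫ _) (whiskerRight_id_ne M.dual f hk.symm (i, k) (j, k'))).trans ?_
        exact Limits.zero_comp
      · rw [ev_assoc_apply]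
        exact congrArg₂ (fun x y => x ≫ _ ≫ y ≫ _)
          (whiskerRight_id_apply M.dual f k (i, k) (j, k))
          (id_whiskerLeft_apply N' e j (k, k) PUnit.unit)
    rw [assoc_coev_apply, h1, h2]
    simp only [traceRight, Category.assoc]

variable [BraidedCategory C] [RibbonCategory C]

/-- Braiding and whiskered twist are generalized diagonal matrices, and their product is again one.
Only the braiding permutes indices, which turns `(k, l)` into `(l, k)`. In particular, off-diagonal
entries vanish together with those of `coev M`. -/
theorem coev'_apply (M : Mat_ C) (u : PUnit) (k l : M.ι) :
    coev' M u (k, l) = coev M u (l, k) ≫ (β_ (M.X l) (M.dual.X k)).hom ≫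
      M.dual.X k ◁ (twist (M.X l)).hom := by
  have h : coev' M = coev M ≫ diag (M := tensorObj M M.dual) (N := tensorObj M.dual M)
      (Equiv.prodComm _ _) (fun p => (β_ (M.X p.1) (M.dual.X p.2)).hom) ≫
      diag (M := tensorObj M.dual M) (N := tensorObj M.dual M)
      ((Equiv.refl _).prodCongr (Equiv.refl _)) (fun p => M.dual.X p.1 ◁ (twist (M.X p.2)).hom) :=
    congrArg (fun x => coev M ≫ _ ≫ x) (id_tensorHom_diag M.dual (Equiv.refl M.ι)
      fun i => (twist (M.X i)).hom)
  rw [h]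
  erw [diag_comp_diag]
  exact comp_diag_apply (M := tensorObj M M.dual) (N := tensorObj M.dual M) (coev M) _ _ u (l, k)

theorem coev'_self (M : Mat_ C) (u : PUnit) (k : M.ι) : coev' M u (k, k) = coev' (M.X k) := by
  rw [coev'_apply, coev_self]; rfl

theorem coev'_ne (M : Mat_ C) (u : PUnit) {k l : M.ι} (h : k ≠ l) : coev' M u (k, l) = 0 := by
  rw [coev'_apply, coev_ne _ _ h.symm, Limits.zero_comp]

theorem ev'_apply (M : Mat_ C) (u : PUnit) (k l : M.ι) :
    ev' M (k, l) u = ((twist (M.X k)).hom ▷ M.dual.X l ≫ (β_ (M.X k) (M.dual.X l)).hom) ≫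
      ev M (l, k) u := by
  -- Twist and braiding are bracketed together so that they merge into one generalized diagonal
  -- matrix in front of `ev M`.
  have h : ev' M = (diag (M := tensorObj M M.dual) (N := tensorObj M M.dual)
      ((Equiv.refl _).prodCongr (Equiv.refl _)) (fun p => (twist (M.X p.1)).hom ▷ M.dual.X p.2) ≫
      diag (M := tensorObj M M.dual) (N := tensorObj M.dual M)
      (Equiv.prodComm _ _) (fun p => (β_ (M.X p.1) (M.dual.X p.2)).hom)) ≫ ev M :=
    (congrArg (fun x => x ≫ _ ≫ ev M) (diag_tensorHom_id M.dual (Equiv.refl M.ι)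
      fun i => (twist (M.X i)).hom)).trans (Category.assoc _ _ _).symm
  rw [h]
  erw [diag_comp_diag]
  exact diag_comp_apply (M := tensorObj M M.dual) (N := tensorObj M.dual M) _ _ (ev M) (k, l) u

theorem ev'_self (M : Mat_ C) (u : PUnit) (k : M.ι) : ev' M (k, k) u = ev' (M.X k) := by
  rw [ev'_apply, ev_self, Category.assoc]; rfl

theorem ev'_ne (M : Mat_ C) (u : PUnit) {k l : M.ι} (h : k ≠ l) : ev' M (k, l) u = 0 := by
  rw [ev'_apply, ev_ne _ _ h.symm, Limits.comp_zero]

/-- The duality morphisms pair each summand of `M` only with its own dual, so the loop runs through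
one summand at a time. The braiding between different summands, where powers of `q` would not
cancel, never enters. -/
theorem trL_apply {M N : Mat_ C} (f : M ⊗ N ⟶ M ⊗ N) (i j : N.ι) :
    trL f i j = ∑ k : M.ι, traceLeft (V := M.X k) (W := N.X i) (W' := N.X j)
      (coev' (M.X k)) (ε_ (M.X k) ((M.X k)ᘁ)) (f (k, i) (k, j)) := by
  refine (traceLeft_apply (coev' M) (ev M) (fun u _ _ => coev'_ne M u) (fun u _ _ => ev_ne M u)
    f i j).trans (Finset.sum_congr rfl fun k _ => ?_)
  exact congrArg₂ (fun x y => traceLeft x y _) (coev'_self M _ k) (ev_self M _ k)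

theorem trR_apply {M N : Mat_ C} (f : N ⊗ M ⟶ N ⊗ M) (i j : N.ι) :
    trR f i j = ∑ k : M.ι, traceRight (W := M.X k) (V := N.X i) (V' := N.X j)
      (η_ (M.X k) ((M.X k)ᘁ)) (ev' (M.X k)) (f (i, k) (j, k)) := by
  refine (traceRight_apply (coev M) (ev' M) (fun u _ _ => coev_ne M u) (fun u _ _ => ev'_ne M u)
    f i j).trans (Finset.sum_congr rfl fun k _ => ?_)
  exact congrArg₂ (fun x y => traceRight x y _) (coev_self M _ k) (ev'_self M _ k)

end CategoryTheory.Mat_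

/-! ### Cups and caps under degrading, before the envelopes -/

namespace Rep₀

open RibbonCategory

variable {F : Type u} [Field F] {t : F}

theorem coev'_eq (X : Rep₀ F t) : coev' X = η_ X (Xᘁ) ≫ (β_ X (Xᘁ)).hom := by
  have h : (twist X).hom = 𝟙 X := rfl
  rw [coev', h, MonoidalCategory.whiskerLeft_id, Category.comp_id]

theorem ev'_eq (X : Rep₀ F t) : ev' X = (β_ X (Xᘁ)).hom ≫ ε_ X (Xᘁ) := by
  have h : (twist X).hom = 𝟙 X := rfl
  rw [ev', h, id_whiskerRight, Category.id_comp]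

end Rep₀

namespace GrRep₀

open RibbonCategory Functor.LaxMonoidal Functor.OplaxMonoidal

variable {F : Type u} [Field F] {t : F} {q : Fˣ}

/-- The degrading functor is compatible with duals. -/
noncomputable def degradeDual (X : GrRep₀ F t q) :
    (((degrade₀ F t q).obj X)ᘁ : Rep₀ F t) ≅ (degrade₀ F t q).obj (Xᘁ) :=
  eqToIso (und_dual X).symm

/-- The graded evaluation is the ungraded one transported along `und_tensorObj`, and `μ` is the
inverse transport. The identification of the two duals `[b + a]` and `[a + b]` is all that remains.
-/
theorem map_evaluation (X : GrRep₀ F t q) :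
    μ (degrade₀ F t q) (Xᘁ) X ≫ (degrade₀ F t q).map (ε_ X (Xᘁ)) ≫ η (degrade₀ F t q) =
      (degradeDual X).inv ▷ (degrade₀ F t q).obj X ≫
        ε_ ((degrade₀ F t q).obj X) (((degrade₀ F t q).obj X)ᘁ) := by
  show eqToHom (und_tensorObj X.dual X) ≫ (eqToHom (und_tensorObj X.dual X).symm ≫
    eqToHom (und_dual X) ▷ X.und ≫ Rep₀.ev X.und) ≫ 𝟙 _ = _
  rw [Category.comp_id, eqToHom_trans_assoc, eqToHom_refl, Category.id_comp]
  rfl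

theorem map_coevaluation (X : GrRep₀ F t q) :
    ε (degrade₀ F t q) ≫ (degrade₀ F t q).map (η_ X (Xᘁ)) ≫ δ (degrade₀ F t q) X (Xᘁ) =
      η_ ((degrade₀ F t q).obj X) (((degrade₀ F t q).obj X)ᘁ) ≫
        (degrade₀ F t q).obj X ◁ (degradeDual X).hom := by
  -- The cancellation is stated for an arbitrary equality of objects so that it can be substituted;
  -- the two sides of `und_tensorObj` are not variables.
  have h {A B B' B'' : Rep₀ F t} (e : B' = B'') (f : A ⟶ B) (g : B ⟶ B') :
      𝟙 A ≫ (f ≫ g ≫ eqToHom e) ≫ eqToHom e.symm = f ≫ g := by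
    subst e; simp
  show 𝟙 _ ≫ (Rep₀.coev X.und ≫ X.und ◁ eqToHom (und_dual X).symm ≫
    eqToHom (und_tensorObj X X.dual)) ≫ eqToHom (und_tensorObj X X.dual).symm = _
  exact h (und_tensorObj X X.dual) (Rep₀.coev X.und) (X.und ◁ eqToHom (und_dual X).symm)

/-- The unscaled transposition was defined by transport from Deligne's category, so degrading is
compatible with it on the nose. For the actual graded braiding this would fail by a power of `q`. -/
theorem map_braid₀ (X Y : GrRep₀ F t q) :
    (degrade₀ F t q).map (braid₀ X Y).hom = δ (degrade₀ F t q) X Y ≫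
      (β_ ((degrade₀ F t q).obj X) ((degrade₀ F t q).obj Y)).hom ≫ μ (degrade₀ F t q) Y X := rfl

/-- The powers of `q` in the braiding and in the twist cancel. -/
theorem coev'_eq (X : GrRep₀ F t q) : coev' X = η_ X (Xᘁ) ≫ (braid₀ X (Xᘁ)).hom := by
  have h : (twist X).hom = ((q ^ (X.deg ^ 2) : Fˣ) : F) • 𝟙 X := rfl
  rw [coev', h, braiding_hom, deg_rightDual, MonoidalLinear.whiskerLeft_smul,
    MonoidalCategory.whiskerLeft_id, Linear.comp_smul, Category.comp_id, smul_smul,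
    ← Units.val_mul, ← zpow_add]
  -- The first exponent comes from the twist of `X`, the second from braiding `X` with its dual,
  -- whose degree is `-X.deg`.
  rw [show X.deg ^ 2 + X.deg * -X.deg = 0 by ring, zpow_zero, Units.val_one, one_smul]

/-- The same two powers of `q` occur here, now with the twist before the braiding. -/
theorem ev'_eq (X : GrRep₀ F t q) : ev' X = (braid₀ X (Xᘁ)).hom ≫ ε_ X (Xᘁ) := by
  have h : (twist X).hom = ((q ^ (X.deg ^ 2) : Fˣ) : F) • 𝟙 X := rfl
  rw [ev', h, braiding_hom, deg_rightDual, MonoidalLinear.smul_whiskerRight,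
    id_whiskerRight, Linear.smul_comp, Category.id_comp, Linear.smul_comp, smul_smul,
    ← Units.val_mul, ← zpow_add]
  rw [show X.deg ^ 2 + X.deg * -X.deg = 0 by ring, zpow_zero, Units.val_one, one_smul]

/-- Once the scalars have cancelled, the transposition degrades to the braiding of Deligne's
category. Naturality of that braiding carries the comparison of duals over to the left-hand strand.
-/
theorem map_coev' (X : GrRep₀ F t q) :
    ε (degrade₀ F t q) ≫ (degrade₀ F t q).map (coev' X) ≫ δ (degrade₀ F t q) (Xᘁ) X =
      coev' ((degrade₀ F t q).obj X) ≫ (degradeDual X).hom ▷ (degrade₀ F t q).obj X := by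
  rw [coev'_eq, Functor.map_comp, map_braid₀, Rep₀.coev'_eq]
  simp only [Category.assoc, Functor.Monoidal.μ_δ, Category.comp_id]
  rw [reassoc_of% map_coevaluation X, BraidedCategory.braiding_naturality_right]

theorem map_ev' (X : GrRep₀ F t q) :
    μ (degrade₀ F t q) X (Xᘁ) ≫ (degrade₀ F t q).map (ev' X) ≫ η (degrade₀ F t q) =
      (degrade₀ F t q).obj X ◁ (degradeDual X).inv ≫ ev' ((degrade₀ F t q).obj X) := by
  rw [ev'_eq, Functor.map_comp, map_braid₀, Rep₀.ev'_eq]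
  simp only [Category.assoc, Functor.Monoidal.μ_δ_assoc]
  rw [map_evaluation X, BraidedCategory.braiding_naturality_right_assoc]

variable {X Y X' Y' : GrRep₀ F t q}

/-- The comparison of duals appears at the cup and its inverse at the cap. Both act on the dual
strand, so they can be slid together and cancel. -/
theorem map_traceLeft (f : X ⊗ Y ⟶ X ⊗ Y') :
    (degrade₀ F t q).map (traceLeft (coev' X) (ε_ X (Xᘁ)) f) =
      traceLeft (coev' ((degrade₀ F t q).obj X)) (ε_ ((degrade₀ F t q).obj X) _)
        (tensorMap (degrade₀ F t q) f) := by
  rw [RibbonCategory.map_traceLeft, map_evaluation, map_coev', traceLeft_slide,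
    hom_inv_whiskerRight_assoc]

theorem map_traceRight (f : X ⊗ Y ⟶ X' ⊗ Y) :
    (degrade₀ F t q).map (traceRight (η_ Y (Yᘁ)) (ev' Y) f) =
      traceRight (η_ ((degrade₀ F t q).obj Y) _) (ev' ((degrade₀ F t q).obj Y))
        (tensorMap (degrade₀ F t q) f) := by
  rw [RibbonCategory.map_traceRight, map_coevaluation, map_ev', traceRight_slide,
    whiskerLeft_hom_inv_assoc]

end GrRep₀

/-! ### The degrading functor on the envelopes -/

namespace gRepS

open RibbonCategory Idempotents

variable {F : Type u} [Field F] {t : F} {q : Fˣ}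

/-- The morphism between tensor products of the degraded tuples induced by a morphism between
tensor products of tuples. -/
noncomputable def tensorMapMat {M N M' N' : Mat_ (GrRep₀ F t q)} (f : M ⊗ N ⟶ M' ⊗ N') :
    (GrRep₀.degrade₀ F t q).mapMat_.obj M ⊗ (GrRep₀.degrade₀ F t q).mapMat_.obj N ⟶
      (GrRep₀.degrade₀ F t q).mapMat_.obj M' ⊗ (GrRep₀.degrade₀ F t q).mapMat_.obj N' :=
  fun p r => tensorMap (GrRep₀.degrade₀ F t q) (X := M.X p.1) (Y := N.X p.2) (X' := M'.X r.1)
    (Y' := N'.X r.2) (f p r)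

/-- Degrading does not change the index sets of tuples, so both sides have the same index set of
pairs and can be compared entrywise. -/
theorem tensorMapMat_tensorHom {M N M' N' : Mat_ (GrRep₀ F t q)} (f : M ⟶ M') (g : N ⟶ N') :
    tensorMapMat (f ⊗ₘ g) =
      (GrRep₀.degrade₀ F t q).mapMat_.map f ⊗ₘ (GrRep₀.degrade₀ F t q).mapMat_.map g :=
  Mat_.hom_ext _ _ fun p r => tensorMap_tensorHom _ (f p.1 r.1) (g p.2 r.2)

/-- An entry of a product is a sum of composites, so this combines the additivity of `tensorMap`
with its multiplicativity. -/
theorem tensorMapMat_comp {M N M' N' M'' N'' : Mat_ (GrRep₀ F t q)} (f : M ⊗ N ⟶ M' ⊗ N')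
    (g : M' ⊗ N' ⟶ M'' ⊗ N'') :
    tensorMapMat (f ≫ g) = tensorMapMat f ≫ tensorMapMat g := by
  refine Mat_.hom_ext _ _ fun p r => ?_
  refine (congrArg (tensorMap _) (Mat_.comp_apply f g p r)).trans ?_
  refine (tensorMap_sum _ _ _).trans ?_
  exact Finset.sum_congr rfl fun s _ => tensorMap_comp _ _ _

/-- Both sides are entrywise sums over the summands in the loop, and degrading respects each term.
Every term is homogeneous in the loop variable, so the cancellation of powers of `q` applies to it.
-/
theorem mapMat_trL {M N : Mat_ (GrRep₀ F t q)} (f : M ⊗ N ⟶ M ⊗ N) :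
    (GrRep₀.degrade₀ F t q).mapMat_.map (trL f) = trL (tensorMapMat f) := by
  refine Mat_.hom_ext _ _ fun i j => ?_
  refine (congrArg (GrRep₀.degrade₀ F t q).map (Mat_.trL_apply f i j)).trans ?_
  refine Eq.trans ?_ (Mat_.trL_apply (tensorMapMat f) i j).symm
  rw [Functor.map_sum]
  exact Finset.sum_congr rfl fun k _ => GrRep₀.map_traceLeft _

theorem mapMat_trR {M N : Mat_ (GrRep₀ F t q)} (f : M ⊗ N ⟶ M ⊗ N) :
    (GrRep₀.degrade₀ F t q).mapMat_.map (trR f) = trR (tensorMapMat f) := by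
  refine Mat_.hom_ext _ _ fun i j => ?_
  refine (congrArg (GrRep₀.degrade₀ F t q).map (Mat_.trR_apply f i j)).trans ?_
  refine Eq.trans ?_ (Mat_.trR_apply (tensorMapMat f) i j).symm
  rw [Functor.map_sum]
  exact Finset.sum_congr rfl fun k _ => GrRep₀.map_traceRight _

/-- The endomorphism of `ℱ(V) ⊗ ℱ(W)` given by an endomorphism of `V ⊗ W`. -/
noncomputable def degradeEnd {V W : gRepS F t q} (h : V ⊗ W ⟶ V ⊗ W) :
    (degrade F t q).obj V ⊗ (degrade F t q).obj W ⟶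
      (degrade F t q).obj V ⊗ (degrade F t q).obj W where
  f := tensorMapMat (M := V.X) (N := W.X) (M' := V.X) (N' := W.X) h.f
  comm := by
    -- The idempotent of `V ⊗ W` is sent to that of the tensor product of the degraded objects. By
    -- multiplicativity, the invariance of `h.f` under the former gives invariance under the latter.
    have e := tensorMapMat_tensorHom V.p W.p
    refine Eq.trans ?_ (congrArg (tensorMapMat (M := V.X) (N := W.X) (M' := V.X)
      (N' := W.X)) h.comm)
    refine Eq.trans ?_ ((tensorMapMat_comp (V.p ⊗ₘ W.p) _).trans
      (congrArg (_ ≫ ·) (tensorMapMat_comp h.f (V.p ⊗ₘ W.p)))).symm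
    exact congrArg (fun x => x ≫ _ ≫ x) e.symm

/-- Idempotents play no role in the partial traces on either side, by `Karoubi.trL_f`, so the
statement reduces to matrices. -/
theorem degrade_trL {V W : gRepS F t q} (h : V ⊗ W ⟶ V ⊗ W) :
    (degrade F t q).map (trL h) = trL (degradeEnd h) := by
  refine Karoubi.hom_ext _ _ ?_
  refine Eq.trans ?_ (Karoubi.trL_f (degradeEnd h)).symm
  exact (congrArg (GrRep₀.degrade₀ F t q).mapMat_.map (Karoubi.trL_f h)).trans (mapMat_trL _)

theorem degrade_trR {V W : gRepS F t q} (h : V ⊗ W ⟶ V ⊗ W) :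
    (degrade F t q).map (trR h) = trR (degradeEnd h) := by
  refine Karoubi.hom_ext _ _ ?_
  refine Eq.trans ?_ (Karoubi.trR_f (degradeEnd h)).symm
  exact (congrArg (GrRep₀.degrade₀ F t q).mapMat_.map (Karoubi.trR_f h)).trans (mapMat_trR _)

end gRepS

theorem theorem6p3 {F : Type*} [Field F] [CharZero F] (t : F) (q : Fˣ) (V : gRepS F t q)
    (τ : ((degrade F t q).obj V ⟶ (degrade F t q).obj V) →ₗ[F] F)
    (hτ : RibbonCategory.IsAmbidextrousTrace τ) :
    RibbonCategory.IsAmbidextrousTrace (τ ∘ₗ (degrade F t q).mapLinearMap F) := by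
  intro h
  show τ ((degrade F t q).map (RibbonCategory.trL h)) =
    τ ((degrade F t q).map (RibbonCategory.trR h))
  rw [gRepS.degrade_trL, gRepS.degrade_trR]
  -- Both partial traces have become partial traces of the same endomorphism of the tensor square of
  -- the degraded object, to which ambidexterity applies.
  exact hτ (gRepS.degradeEnd h)
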